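/- Let $K$ be a field. All gradings are by $\mathbb Z\times\mathbb Z$ (cohomological degree, internal degree), $[1]$ shifts the cohomological degree, $(M[1])^i_j=M^{i+1}_j$, and a topologically free bigraded $K[[\hbar]]$-module is one of the form $M_\hbar=\{M^i_j[[\hbar]]\}_{i,j}$ with $M$ a bigraded $K$-vector space. Let $A_\hbar$ be a flat topological $A_\infty$-algebra with a strict unit $\eta$: $A$ is a bigraded vector space with a $K[[\hbar]]$-linear coderivation $\mathrm d_A=\sum_k \mathrm d_A^{(k)}\hbar^k$ of bidegree $(1,0)$ on the tensor coalgebra $T(A[1])[[\hbar]]$, $\mathrm d_A^2=0$, $\mathrm d_A(1)=0$, and $\eta\in A^0_0$ is a strict unit. (In particular $A_\hbar$ may be any unital associative bigraded product on $A[[\hbar]]$ of bidegree $(0,0)$ with unit $\eta\in A$, such as the deformation quantizations $A_\hbar$ of $S(X^*)$ and $B_\hbar$ of $\wedge X$ along an $\hbar$-formal quadratic Poisson bivector on a finite-dimensional vector space $X$.) A strictly unital topologically free right $A_\infty$-$A_\hbar$-module is a topologically free $M_\hbar$ with a codifferential $\mathrm d_M$ of bidegree $(1,0)$ on the cofree right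 $T(A[1])[[\hbar]]$-comodule $(M[1]\otimes T(A[1]))[[\hbar]]$, $\mathrm d_M^2=0$, such that $\eta$ acts as the identity and the Taylor components $\mathrm d_M^{n}$, $n\ge 2$, vanish when some argument is $\eta$. Morphisms are $K[[\hbar]]$-linear comodule maps $f$ of bidegree $(0,0)$ commuting with the codifferentials whose Taylor components $f^{n}:M[1]\otimes A[1]^{\otimes n}\to N[1]$, $n\ge1$, vanish when some argument from $A$ is $\eta$; $f$ is strict if $f^n=0$ for $n\ge1$. Two morphisms $f,g:M_\hbar\to N_\hbar$ are homotopic if $f-g=\mathrm d_N H+H\mathrm d_M$ for a $K[[\hbar]]$-linear comodule map $H$ of bidegree $(-1,0)$ with the same vanishing property. Let $\mathcal H=\mathcal H^{tf}_\infty(A_\hbar)$ be the resulting homotopy category; the shift $M_\hbar[1]$ carries the codifferential $-\mathrm d_M$ and $[1]$ does not change the underlying comodule maps. A sequence of strict morphisms $M_\hbar\xrightarrow{f}M'_\hbar\xrightarrow{g}M''_\hbar$ is semi-split if it is short exact in every bidegree and there is a $K[[\hbar]]$-linear map $\rho:M'_\hbar\to M_\hbar$ of bidegree $(0,0)$ with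 $\rho f=1$ and $\rho\,\mathrm d_{M'}^n=\mathrm d_M^n(\rho\otimes1)$ for $n\ge1$. 1. For every semi-split sequence with splitting $\rho$ there is a unique morphism $h:M''_\hbar\to M_\hbar[1]$ with $h\circ g=\mathrm d_M\circ(\rho\otimes1)-(\rho\otimes1)\circ\mathrm d_{M'}$; that is, on $M'=M\oplus M''$ one has $\mathrm d_{M'}(x,z)=(\mathrm d_Mx-hz,\mathrm d_{M''}z)$. 2. The category $\mathcal H$, with shift functor $[1]$ and with distinguished triangles those isomorphic in $\mathcal H$ to a triangle $M_\hbar\xrightarrow{f}M'_\hbar\xrightarrow{g}M''_\hbar\xrightarrow{h}M_\hbar[1]$ obtained from a semi-split sequence as in 1., is triangulated. 3. For every morphism $f:M_\hbar\to N_\hbar$ let $C(f)=M_\hbar[1]\oplus N_\hbar$ with $\mathrm d(x,y)=(-\mathrm d_Mx,fx+\mathrm d_Ny)$ and $\mathrm{Cyl}(f)=M_\hbar\oplus M_\hbar[1]\oplus N_\hbar$ with $\mathrm d(m,m',n)=(\mathrm d_Mm-m',-\mathrm d_Mm',fm'+\mathrm d_Nn)$. The triangles $M_\hbar\to \mathrm{Cyl}(f)\to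 C(f)\to M_\hbar[1]$ and $M_\hbar\xrightarrow{f}N_\hbar\to C(f)\to M_\hbar[1]$, with the natural inclusions and projections, are distinguished. 4. The class $\mathrm{Qis}$ of quasi-isomorphisms in $\mathcal H$ (the classes of morphisms $f$ for which $f^0$ induces isomorphisms in every bidegree on the cohomology of the differentials $\mathrm d^0$ on $M_\hbar$, $N_\hbar$) is localizing, i.e. admits a calculus of left and right fractions, and is compatible with the triangulation: $s\in\mathrm{Qis}$ if and only if $s[1]\in\mathrm{Qis}$, and if $(a,b)$ is a morphism between the first arrows of two distinguished triangles with $a,b\in\mathrm{Qis}$, it extends to a morphism of triangles $(a,b,c)$ with $c\in\mathrm{Qis}$. Hence the derived category $\mathcal H[\mathrm{Qis}^{-1}]$ is triangulated, its distinguished triangles being those isomorphic to images of distinguished triangles of $\mathcal H$. -/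

import Mathlib

open CategoryTheory CategoryTheory.Limits TensorProduct

universe u

namespace TopAInf

noncomputable section

/-! ### Formal power series of linear maps -/

section Series

variable {K : Type u} [Field K] {U V W X : Type u} [AddCommGroup U] [Module K U]
  [AddCommGroup V] [Module K V] [AddCommGroup W] [Module K W] [AddCommGroup X] [Module K X]

/-- `Ser K V W` is `Hom(V, W)⟦ħ⟧`, identified with the `K⟦ħ⟧`-linear maps `V⟦ħ⟧ → W⟦ħ⟧`. -/
abbrev Ser (K : Type u) [Field K] (V W : Type u) [AddCommGroup V] [Module K V]
    [AddCommGroup W] [Module K W] : Type u := ℕ → (V →ₗ[K] W)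

/-- Composition of power series of linear maps (Cauchy product), `g` after `f`. -/
def Ser.comp (g : Ser K V W) (f : Ser K U V) : Ser K U W :=
  fun n => ∑ p ∈ Finset.HasAntidiagonal.antidiagonal n, g p.1 ∘ₗ f p.2

/-- The series `l + 0 ħ + 0 ħ² + ⋯`. -/
def Ser.const (l : V →ₗ[K] W) : Ser K V W := fun n => if n = 0 then l else 0

/-- The map `V⟦ħ⟧ → W⟦ħ⟧` given by a power series of linear maps; the elements of `V⟦ħ⟧` are
the sequences of their coefficients. -/
def Ser.eval (f : Ser K V W) : (ℕ → V) →ₗ[K] (ℕ → W) :=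
  LinearMap.pi fun n => ∑ p ∈ Finset.HasAntidiagonal.antidiagonal n, f p.1 ∘ₗ LinearMap.proj p.2

lemma Ser.comp_assoc (h : Ser K W X) (g : Ser K V W) (f : Ser K U V) :
    (h.comp g).comp f = h.comp (g.comp f) := by
  funext n
  ext x
  simp only [Ser.comp, LinearMap.sum_apply, LinearMap.comp_apply, map_sum]
  rw [Finset.sum_sigma', Finset.sum_sigma']
  refine Finset.sum_nbij' (fun ⟨⟨_, j⟩, ⟨k, l⟩⟩ ↦ ⟨(k, l + j), (l, j)⟩)
    (fun ⟨⟨i, _⟩, ⟨k, l⟩⟩ ↦ ⟨(i + k, l), (i, k)⟩) ?_ ?_ ?_ ?_ ?_ <;>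
    simp only [Finset.mem_sigma, Finset.HasAntidiagonal.mem_antidiagonal, Sigma.forall, Prod.forall] <;>
    rintro a b c d ⟨rfl, rfl⟩ <;> simp [add_assoc]

lemma Ser.const_comp (l : V →ₗ[K] W) (f : Ser K U V) :
    (Ser.const l).comp f = fun n => l ∘ₗ f n := by
  funext n
  simp only [Ser.comp, Ser.const]
  rw [Finset.sum_eq_single (0, n)]
  · simp
  · rintro ⟨i, j⟩ hb hne
    have : i ≠ 0 := by
      rintro rfl
      simp at hb
      exact hne (by simp [hb])
    simp [this]
  · simp

lemma Ser.comp_const (f : Ser K V W) (l : U →ₗ[K] V) :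
    f.comp (Ser.const l) = fun n => f n ∘ₗ l := by
  funext n
  simp only [Ser.comp, Ser.const]
  rw [Finset.sum_eq_single (n, 0)]
  · simp
  · rintro ⟨i, j⟩ hb hne
    have : j ≠ 0 := by
      rintro rfl
      simp at hb
      exact hne (by simp [hb])
    simp [this]
  · simp

lemma Ser.add_comp (g g' : Ser K V W) (f : Ser K U V) :
    (g + g').comp f = g.comp f + g'.comp f := by
  funext n; simp [Ser.comp, LinearMap.add_comp, Finset.sum_add_distrib]

lemma Ser.comp_add (g : Ser K V W) (f f' : Ser K U V) :
    g.comp (f + f') = g.comp f + g.comp f' := by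
  funext n; simp [Ser.comp, LinearMap.comp_add, Finset.sum_add_distrib]

lemma Ser.smul_comp (c : K) (g : Ser K V W) (f : Ser K U V) :
    (c • g).comp f = c • g.comp f := by
  funext n; simp [Ser.comp, LinearMap.smul_comp, Finset.smul_sum]

lemma Ser.comp_smul (c : K) (g : Ser K V W) (f : Ser K U V) :
    g.comp (c • f) = c • g.comp f := by
  funext n; simp [Ser.comp, LinearMap.comp_smul, Finset.smul_sum]

lemma Ser.neg_comp (g : Ser K V W) (f : Ser K U V) : (-g).comp f = -g.comp f := by
  funext n; simp [Ser.comp, LinearMap.neg_comp]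

lemma Ser.comp_neg (g : Ser K V W) (f : Ser K U V) : g.comp (-f) = -g.comp f := by
  funext n; simp [Ser.comp, LinearMap.comp_neg]

lemma Ser.sub_comp (g g' : Ser K V W) (f : Ser K U V) :
    (g - g').comp f = g.comp f - g'.comp f := by
  rw [sub_eq_add_neg, Ser.add_comp, Ser.neg_comp, sub_eq_add_neg]

lemma Ser.comp_sub (g : Ser K V W) (f f' : Ser K U V) :
    g.comp (f - f') = g.comp f - g.comp f' := by
  rw [sub_eq_add_neg, Ser.comp_add, Ser.comp_neg, sub_eq_add_neg]

lemma Ser.zero_comp (f : Ser K U V) : (0 : Ser K V W).comp f = 0 := by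
  funext n; simp [Ser.comp]

lemma Ser.comp_zero (g : Ser K V W) : g.comp (0 : Ser K U V) = 0 := by
  funext n; simp [Ser.comp]

lemma Ser.id_comp (f : Ser K U V) : (Ser.const LinearMap.id).comp f = f := by
  rw [Ser.const_comp]; funext n; rfl

lemma Ser.comp_id (f : Ser K U V) : f.comp (Ser.const LinearMap.id) = f := by
  rw [Ser.comp_const]; funext n; rfl

end Series

/-! ### The tensor coalgebra -/

section Coalgebra

variable (K : Type u) [Field K] (V : Type u) [AddCommGroup V] [Module K V]

/-- Left multiplication by `v` on `T(V)`, together with the corresponding recursive step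
`x ↦ 1 ⊗ v t + (v ⊗ 1) x` for the deconcatenation of `v t`. -/
def deconcStep : V →ₗ[K] Module.End K
    (TensorAlgebra K V × (TensorAlgebra K V ⊗[K] TensorAlgebra K V)) where
  toFun v :=
    LinearMap.prod (LinearMap.mulLeft K (TensorAlgebra.ι K v) ∘ₗ LinearMap.fst K _ _)
      ((TensorProduct.mk K _ _ 1 ∘ₗ LinearMap.mulLeft K (TensorAlgebra.ι K v)) ∘ₗ
          LinearMap.fst K _ _ +
        LinearMap.rTensor _ (LinearMap.mulLeft K (TensorAlgebra.ι K v)) ∘ₗ LinearMap.snd K _ _)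
  map_add' v w := by
    have : ∀ v : V, LinearMap.mulLeft K (TensorAlgebra.ι K v) =
      LinearMap.mul K _ (TensorAlgebra.ι K v) := fun _ => rfl
    ext x <;> simp [this, add_mul, tmul_add, add_tmul]
  map_smul' c v := by
    have : ∀ v : V, LinearMap.mulLeft K (TensorAlgebra.ι K v) =
      LinearMap.mul K _ (TensorAlgebra.ι K v) := fun _ => rfl
    ext x <;> simp [this, smul_tmul']

/-- The deconcatenation coproduct
`v₁ ⋯ vₙ ↦ ∑ₖ (v₁ ⋯ vₖ) ⊗ (vₖ₊₁ ⋯ vₙ)` (`0 ≤ k ≤ n`) on `T(V)`, determined by `deconc_one` and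
`deconc_ι_mul`. -/
def deconc : TensorAlgebra K V →ₗ[K] TensorAlgebra K V ⊗[K] TensorAlgebra K V where
  toFun t := (TensorAlgebra.lift K (deconcStep K V) t (1, 1 ⊗ₜ 1)).2
  map_add' := by simp
  map_smul' := by simp

lemma deconc_aux (t : TensorAlgebra K V) (s : TensorAlgebra K V)
    (x : TensorAlgebra K V ⊗[K] TensorAlgebra K V) :
    (TensorAlgebra.lift K (deconcStep K V) t (s, x)).1 = t * s := by
  induction t using TensorAlgebra.induction generalizing s x with
  | algebraMap r => simp [Algebra.smul_def]
  | ι v => simp [deconcStep]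
  | mul a b ha hb =>
    rw [map_mul, Module.End.mul_apply, ← Prod.mk.eta (p := TensorAlgebra.lift K (deconcStep K V) b (s, x)),
      ha, hb, mul_assoc]
  | add a b ha hb => simp [ha, hb, add_mul]

lemma deconc_one : deconc K V 1 = 1 ⊗ₜ 1 := by simp [deconc]

lemma deconc_ι_mul (v : V) (t : TensorAlgebra K V) :
    deconc K V (TensorAlgebra.ι K v * t) = 1 ⊗ₜ (TensorAlgebra.ι K v * t) +
      LinearMap.rTensor _ (LinearMap.mulLeft K (TensorAlgebra.ι K v)) (deconc K V t) := by
  have := deconc_aux K V t 1 (1 ⊗ₜ 1)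
  simp only [mul_one] at this
  change (TensorAlgebra.lift K (deconcStep K V) _ _).2 = 1 ⊗ₜ (_ * t) +
    LinearMap.rTensor _ _ (TensorAlgebra.lift K (deconcStep K V) _ _).2
  rw [map_mul, Module.End.mul_apply, TensorAlgebra.lift_ι_apply]
  nth_rw 2 [← this]
  rfl

variable {K V} in
/-- To prove something on `T(V)` it suffices to treat `1` and left multiplication by `V`. -/
lemma tensor_induction {P : TensorAlgebra K V → Prop} (h1 : P 1)
    (hmul : ∀ v t, P t → P (TensorAlgebra.ι K v * t)) (hadd : ∀ s t, P s → P t → P (s + t))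
    (hsmul : ∀ (c : K) t, P t → P (c • t)) (t : TensorAlgebra K V) : P t := by
  suffices h : ∀ s : TensorAlgebra K V, ∀ t, P t → P (s * t) by simpa using h t 1 h1
  intro s
  induction s using TensorAlgebra.induction with
  | algebraMap r => intro t ht; rw [← Algebra.smul_def]; exact hsmul _ _ ht
  | ι v => exact hmul v
  | mul a b ha hb => intro t ht; rw [mul_assoc]; exact ha _ (hb _ ht)
  | add a b ha hb => intro t ht; rw [add_mul]; exact hadd _ _ (ha _ ht) (hb _ ht)

/-- The counit `T(V) → K`, the projection onto tensors of length `0`. -/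
abbrev counit : TensorAlgebra K V →ₗ[K] K := TensorAlgebra.algebraMapInv.toLinearMap

lemma counit_deconc (t : TensorAlgebra K V) :
    TensorProduct.lid K _ (LinearMap.rTensor _ (counit K V) (deconc K V t)) = t := by
  induction t using tensor_induction with
  | h1 => simp [deconc_one]
  | hmul v t ih =>
    rw [deconc_ι_mul]
    have : counit K V ∘ₗ LinearMap.mulLeft K (TensorAlgebra.ι K v) = 0 := by
      ext t; simp [TensorAlgebra.algebraMapInv]
    rw [map_add, ← LinearMap.comp_apply (LinearMap.rTensor _ (counit K V)),
      ← LinearMap.rTensor_comp, this]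
    simp
  | hadd s t hs ht => simp only [map_add, hs, ht]
  | hsmul c t ht => simp only [map_smul, ht]

end Coalgebra

/-! ### Cofree comodules over the tensor coalgebra -/

section Cofree

variable (K : Type u) [Field K] (A : Type u) [AddCommGroup A] [Module K A] (M N P : Type u)
  [AddCommGroup M] [Module K M] [AddCommGroup N] [Module K N] [AddCommGroup P] [Module K P]

/-- `M[1] ⊗ T(A[1])`; the suspensions are only visible in the degrees and in the signs below. -/
abbrev Cof : Type u := M ⊗[K] TensorAlgebra K A

/-- The right coaction of `T(A[1])` on `M[1] ⊗ T(A[1])`. -/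
def coact : Cof K A M →ₗ[K] Cof K A M ⊗[K] TensorAlgebra K A :=
  (TensorProduct.assoc K _ _ _).symm.toLinearMap ∘ₗ
    LinearMap.lTensor M (deconc K A)

/-- The projection `M[1] ⊗ T(A[1]) → M[1]`. Composing a map with it and restricting the result
to `M[1] ⊗ A[1]^{⊗ n}` gives the `n`-th Taylor component of the map. -/
def toCogen : Cof K A M →ₗ[K] M :=
  (TensorProduct.rid K _).toLinearMap ∘ₗ LinearMap.lTensor M (counit K A)

variable {M N}

/-- The map `l ⊗ 1 : M[1] ⊗ T(A[1]) → N[1] ⊗ T(A[1])`. -/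
abbrev strictMap (l : M →ₗ[K] N) : Cof K A M →ₗ[K] Cof K A N :=
  LinearMap.rTensor (TensorAlgebra K A) l

/-- `f` is a morphism of right `T(A[1])`-comodules. -/
def IsComoduleMap (f : Cof K A M →ₗ[K] Cof K A N) : Prop :=
  coact K A N ∘ₗ f = LinearMap.rTensor _ f ∘ₗ coact K A M

/-- The Taylor components `fⁿ`, `n ≥ 1`, of `f` vanish as soon as one argument from `A` is `η`. -/
def VanishesOn (η : A) (f : Cof K A M →ₗ[K] Cof K A N) : Prop :=
  ∀ m s t, toCogen K A N (f (m ⊗ₜ (s * TensorAlgebra.ι K η * t))) = 0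

variable {K A P}

lemma toCogen_tmul (m : M) (t : TensorAlgebra K A) :
    toCogen K A M (m ⊗ₜ t) = counit K A t • m := by simp [toCogen]

lemma toCogen_strictMap (l : M →ₗ[K] N) (x : Cof K A M) :
    toCogen K A N (strictMap K A l x) = l (toCogen K A M x) := by
  induction x using TensorProduct.induction_on with
  | zero => simp
  | tmul m t => simp [toCogen_tmul]
  | add x y hx hy => rw [map_add, map_add, map_add, hx, hy, map_add]

/-- A comodule map is determined by its Taylor components. -/
lemma cogen_coact (x : Cof K A M) :
    LinearMap.rTensor _ (toCogen K A M) (coact K A M x) = x := by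
  induction x using TensorProduct.induction_on with
  | zero => simp
  | tmul m t =>
    have key : ∀ y : TensorAlgebra K A ⊗[K] TensorAlgebra K A,
        LinearMap.rTensor _ (toCogen K A M) ((TensorProduct.assoc K _ _ _).symm (m ⊗ₜ y)) =
          m ⊗ₜ[K] TensorProduct.lid K _ (LinearMap.rTensor _ (counit K A) y) := by
      intro y
      induction y using TensorProduct.induction_on with
      | zero => simp
      | tmul a b => simp [toCogen_tmul, smul_tmul]
      | add a b ha hb => simp only [tmul_add, map_add, ha, hb]
    simp only [coact, LinearMap.comp_apply, LinearMap.lTensor_tmul, LinearEquiv.coe_coe]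
    rw [key, counit_deconc]
  | add x y hx hy => simp only [map_add, hx, hy]

lemma coact_strictMap (l : M →ₗ[K] N) : IsComoduleMap K A (strictMap K A l) := by
  refine TensorProduct.ext' fun m t => ?_
  simp only [coact, LinearMap.comp_apply, LinearMap.lTensor_tmul, LinearMap.rTensor_tmul,
    LinearEquiv.coe_coe]
  generalize deconc K A t = y
  induction y using TensorProduct.induction_on with
  | zero => simp
  | tmul a b => simp
  | add a b ha hb => simp only [tmul_add, map_add, ha, hb]

lemma IsComoduleMap.comp {g : Cof K A N →ₗ[K] Cof K A P}
    {f : Cof K A M →ₗ[K] Cof K A N}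
    (hg : IsComoduleMap K A g) (hf : IsComoduleMap K A f) : IsComoduleMap K A (g ∘ₗ f) := by
  unfold IsComoduleMap at *
  rw [← LinearMap.comp_assoc, hg, LinearMap.comp_assoc, hf, ← LinearMap.comp_assoc,
    LinearMap.rTensor_comp]

lemma vanishesOn_strictMap (η : A) (l : M →ₗ[K] N) :
    VanishesOn K A η (strictMap K A l) := by
  intro m s t
  rw [toCogen_strictMap, toCogen_tmul]
  simp [TensorAlgebra.algebraMapInv]

lemma deconc_unit (η : A) {X : Type u} [AddCommGroup X] [Module K X]
    (L : TensorAlgebra K A ⊗[K] TensorAlgebra K A →ₗ[K] X)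
    (hl : ∀ s t b, L ((s * TensorAlgebra.ι K η * t) ⊗ₜ b) = 0)
    (hr : ∀ a s t, L (a ⊗ₜ (s * TensorAlgebra.ι K η * t)) = 0)
    (s t : TensorAlgebra K A) :
    L (deconc K A (s * TensorAlgebra.ι K η * t)) = 0 := by
  let G : Set (TensorAlgebra K A ⊗[K] TensorAlgebra K A) :=
    {x | (∃ s t b, x = (s * TensorAlgebra.ι K η * t) ⊗ₜ b) ∨
      ∃ a s t, x = a ⊗ₜ (s * TensorAlgebra.ι K η * t)}
  have hQ : Submodule.span K G ≤ LinearMap.ker L := by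
    rw [Submodule.span_le]
    rintro _ (⟨s, t, b, rfl⟩ | ⟨a, s, t, rfl⟩)
    · exact hl _ _ _
    · exact hr _ _ _
  apply hQ
  have step : ∀ v : A, ∀ y ∈ Submodule.span K G,
      LinearMap.rTensor _ (LinearMap.mulLeft K (TensorAlgebra.ι K v)) y ∈ Submodule.span K G := by
    intro v y hy
    refine Submodule.span_induction (p := fun y _ => LinearMap.rTensor _
      (LinearMap.mulLeft K (TensorAlgebra.ι K v)) y ∈ Submodule.span K G) ?_ (by simp)
      (fun x y _ _ hx hy => by rw [map_add]; exact add_mem hx hy)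
      (fun c x _ hx => by rw [map_smul]; exact Submodule.smul_mem _ _ hx) hy
    rintro _ (⟨s, t, b, rfl⟩ | ⟨a, s, t, rfl⟩)
    · exact Submodule.subset_span (Or.inl ⟨TensorAlgebra.ι K v * s, t, b, by simp [mul_assoc]⟩)
    · exact Submodule.subset_span (Or.inr ⟨TensorAlgebra.ι K v * a, s, t, by simp⟩)
  induction s using tensor_induction with
  | h1 =>
    rw [one_mul, deconc_ι_mul]
    refine add_mem (Submodule.subset_span (Or.inr ⟨1, 1, t, by simp⟩)) ?_
    generalize deconc K A t = y
    induction y using TensorProduct.induction_on with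
    | zero => simp
    | tmul a b => exact Submodule.subset_span (Or.inl ⟨1, a, b, by simp⟩)
    | add a b ha hb => rw [map_add]; exact add_mem ha hb
  | hmul v s ih =>
    rw [mul_assoc] at ih
    rw [mul_assoc, mul_assoc, deconc_ι_mul]
    refine add_mem (Submodule.subset_span (Or.inr ⟨1, TensorAlgebra.ι K v * s, t, ?_⟩)) ?_
    · simp [mul_assoc]
    · exact step v _ ih
  | hadd a b ha hb => rw [add_mul, add_mul, map_add]; exact add_mem ha hb
  | hsmul c a ha =>
    rw [smul_mul_assoc, smul_mul_assoc, map_smul]; exact Submodule.smul_mem _ _ ha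

lemma VanishesOn.comp {η : A} {g : Cof K A N →ₗ[K] Cof K A P}
    {f : Cof K A M →ₗ[K] Cof K A N} (hg : VanishesOn K A η g) (hf : VanishesOn K A η f)
    (hfc : IsComoduleMap K A f) : VanishesOn K A η (g ∘ₗ f) := by
  intro m s t
  rw [LinearMap.comp_apply, ← cogen_coact (f _), ← LinearMap.comp_apply (coact K A N), hfc]
  simp only [coact, LinearMap.comp_apply, LinearMap.lTensor_tmul, LinearEquiv.coe_coe]
  refine deconc_unit η (toCogen K A P ∘ₗ g ∘ₗ LinearMap.rTensor _ (toCogen K A N) ∘ₗ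
    LinearMap.rTensor _ f ∘ₗ (TensorProduct.assoc K _ _ _).symm.toLinearMap ∘ₗ
    TensorProduct.mk K _ _ m) ?_ ?_ s t
  · intro s t b
    simp [hf m s t]
  · intro a s t
    simpa using hg _ s t

end Cofree

/-! ### Bigraded vector spaces -/

/-- A `ℤ × ℤ`-graded vector space, presented as its total space with the homogeneous components
`gr i j` (`i` the cohomological, `j` the internal degree). It stands for the topologically free
bigraded `K⟦ħ⟧`-module with components `(gr i j)⟦ħ⟧`. -/
structure BigradedSpace (K : Type u) [Field K] where
  carrier : Type u
  [addCommGroup : AddCommGroup carrier]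
  [module : Module K carrier]
  gr : ℤ → ℤ → Submodule K carrier
  isInternal : DirectSum.IsInternal fun p : ℤ × ℤ => gr p.1 p.2

attribute [instance] BigradedSpace.addCommGroup BigradedSpace.module

namespace BigradedSpace

variable {K : Type u} [Field K]

lemma hom_ext (M : BigradedSpace K) {X : Type u} [AddCommGroup X] [Module K X]
    {f g : M.carrier →ₗ[K] X} (h : ∀ i j, ∀ m ∈ M.gr i j, f m = g m) : f = g := by
  have hs := M.isInternal.submodule_iSup_eq_top
  have : (⨆ p : ℤ × ℤ, M.gr p.1 p.2) ≤ LinearMap.eqLocus f g :=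
    iSup_le fun p m hm => h p.1 p.2 m hm
  ext m
  exact this (hs ▸ Submodule.mem_top)

/-- The linear map which is `(-1)^i` on the component of cohomological degree `i`. -/
def parity (M : BigradedSpace K) : M.carrier →ₗ[K] M.carrier :=
  (DirectSum.toModule K (ℤ × ℤ) M.carrier fun p => (-1 : K) ^ p.1 • (M.gr p.1 p.2).subtype) ∘ₗ
    (LinearEquiv.ofBijective (DirectSum.coeLinearMap fun p : ℤ × ℤ => M.gr p.1 p.2)
      M.isInternal).symm.toLinearMap

lemma parity_of_mem (M : BigradedSpace K) {i j : ℤ} {m : M.carrier} (hm : m ∈ M.gr i j) :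
    M.parity m = (-1 : K) ^ i • m := by
  have : (LinearEquiv.ofBijective (DirectSum.coeLinearMap fun p : ℤ × ℤ => M.gr p.1 p.2)
      M.isInternal).symm m =
      DirectSum.lof K (ℤ × ℤ) (fun p : ℤ × ℤ => M.gr p.1 p.2) (i, j) ⟨m, hm⟩ := by
    rw [LinearEquiv.symm_apply_eq]
    exact (DirectSum.coeLinearMap_lof (fun p : ℤ × ℤ => M.gr p.1 p.2) (i, j) ⟨m, hm⟩).symm
  rw [parity, LinearMap.comp_apply, LinearEquiv.coe_coe, this, DirectSum.toModule_lof]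
  rfl

lemma parity_comp {M N : BigradedSpace K} {l : M.carrier →ₗ[K] N.carrier}
    (hl : ∀ i j, ∀ m ∈ M.gr i j, l m ∈ N.gr i j) : N.parity ∘ₗ l = l ∘ₗ M.parity :=
  M.hom_ext fun i j m hm => by
    rw [LinearMap.comp_apply, LinearMap.comp_apply, N.parity_of_mem (hl i j m hm),
      M.parity_of_mem hm, map_smul]

/-- The shift `M[a]`, with `(M[a])^i_j = M^{i+a}_j`. -/
abbrev shift (M : BigradedSpace K) (a : ℤ) : BigradedSpace K where
  carrier := M.carrier
  gr i j := M.gr (i + a) j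
  isInternal := by
    have h := M.isInternal
    rw [DirectSum.isInternal_submodule_iff_iSupIndep_and_iSup_eq_top] at h ⊢
    let e : ℤ × ℤ ≃ ℤ × ℤ := (Equiv.addRight a).prodCongr (Equiv.refl ℤ)
    exact ⟨h.1.comp e.injective, (e.iSup_comp (g := fun p : ℤ × ℤ => M.gr p.1 p.2)).trans h.2⟩

lemma parity_shift (M : BigradedSpace K) (a : ℤ) :
    (M.shift a).parity = (-1 : K) ^ a • M.parity :=
  (M.shift a).hom_ext fun i j m hm => by
    rw [(M.shift a).parity_of_mem hm, LinearMap.smul_apply,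
      M.parity_of_mem (i := i + a) (j := j) hm, zpow_add₀ (by simp), smul_smul, mul_comm,
      mul_assoc, ← mul_zpow]
    simp

/-- The direct sum of bigraded spaces. -/
abbrev prod (M N : BigradedSpace K) : BigradedSpace K where
  carrier := M.carrier × N.carrier
  gr i j := (M.gr i j).prod (N.gr i j)
  isInternal := by
    have hM := M.isInternal
    have hN := N.isInternal
    rw [DirectSum.isInternal_submodule_iff_iSupIndep_and_iSup_eq_top] at hM hN ⊢
    constructor
    · rw [iSupIndep_def]
      intro p
      rw [Submodule.disjoint_def]
      rintro ⟨x, y⟩ hx hy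
      have hle : (⨆ q, ⨆ (_ : q ≠ p), (M.gr q.1 q.2).prod (N.gr q.1 q.2)) ≤
          (⨆ q, ⨆ (_ : q ≠ p), M.gr q.1 q.2).prod (⨆ q, ⨆ (_ : q ≠ p), N.gr q.1 q.2) :=
        iSup₂_le fun q hq => Submodule.prod_mono
          (le_iSup₂ (f := fun q (_ : q ≠ p) => M.gr q.1 q.2) q hq)
          (le_iSup₂ (f := fun q (_ : q ≠ p) => N.gr q.1 q.2) q hq)
      have hy' := hle hy
      have h1 := Submodule.disjoint_def.1 (iSupIndep_def.1 hM.1 p) x hx.1 hy'.1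
      have h2 := Submodule.disjoint_def.1 (iSupIndep_def.1 hN.1 p) y hx.2 hy'.2
      simp [h1, h2]
    · rw [eq_top_iff]
      rintro ⟨x, y⟩ -
      have h1 : (⨆ p : ℤ × ℤ, M.gr p.1 p.2) ≤ (⨆ p : ℤ × ℤ, (M.gr p.1 p.2).prod
          (N.gr p.1 p.2)).comap (LinearMap.inl K M.carrier N.carrier) :=
        iSup_le fun p x hx => Submodule.mem_iSup_of_mem p ⟨hx, Submodule.zero_mem _⟩
      have h2 : (⨆ p : ℤ × ℤ, N.gr p.1 p.2) ≤ (⨆ p : ℤ × ℤ, (M.gr p.1 p.2).prod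
          (N.gr p.1 p.2)).comap (LinearMap.inr K M.carrier N.carrier) :=
        iSup_le fun p x hx => Submodule.mem_iSup_of_mem p ⟨Submodule.zero_mem _, hx⟩
      have hx : x ∈ ⨆ p : ℤ × ℤ, M.gr p.1 p.2 := hM.2 ▸ Submodule.mem_top
      have hy : y ∈ ⨆ p : ℤ × ℤ, N.gr p.1 p.2 := hN.2 ▸ Submodule.mem_top
      have := Submodule.add_mem _ (Submodule.mem_comap.1 (h1 hx)) (Submodule.mem_comap.1 (h2 hy))
      simpa using this

/-- The component `(M^i_j)⟦ħ⟧`, as a set of sequences of coefficients. -/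
def seriesGr (M : BigradedSpace K) (i j : ℤ) : Submodule K (ℕ → M.carrier) :=
  Submodule.pi Set.univ fun _ => M.gr i j

/-- The tensors `a₁ ⊗ ⋯ ⊗ aₙ` of homogeneous elements of `A`, seen in `T(A[1])`, with their
bidegree: each `aᵢ` counts with cohomological degree `|aᵢ| - 1`. -/
inductive BarWord (A : BigradedSpace K) : ℤ → ℤ → TensorAlgebra K A.carrier → Prop
  | nil : BarWord A 0 0 1
  | cons {p q r s : ℤ} {a : A.carrier} {t : TensorAlgebra K A.carrier} :
      a ∈ A.gr p q → BarWord A r s t → BarWord A (p - 1 + r) (q + s) (TensorAlgebra.ι K a * t)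

/-- The component of bidegree `(r, s)` of `T(A[1])`. -/
def barGr (A : BigradedSpace K) (r s : ℤ) : Submodule K (TensorAlgebra K A.carrier) :=
  Submodule.span K {t | BarWord A r s t}

/-- The linear map which is `(-1)^r` on the component of cohomological degree `r` of `T(A[1])`. -/
def barSign (A : BigradedSpace K) : TensorAlgebra K A.carrier →ₗ[K] TensorAlgebra K A.carrier :=
  (TensorAlgebra.lift K (-(TensorAlgebra.ι K ∘ₗ A.parity))).toLinearMap

/-- The component of bidegree `(i, j)` of `M[1] ⊗ T(A[1])`. -/
def cofreeGr (A M : BigradedSpace K) (i j : ℤ) :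
    Submodule K (Cof K A.carrier M.carrier) :=
  Submodule.span K {x | ∃ p q r s m t, m ∈ M.gr p q ∧ t ∈ A.barGr r s ∧
    p - 1 + r = i ∧ q + s = j ∧ x = m ⊗ₜ[K] t}

/-- The linear map which is `(-1)^i` on the component of cohomological degree `i` of
`M[1] ⊗ T(A[1])`. -/
def cofreeSign (A M : BigradedSpace K) : Cof K A.carrier M.carrier →ₗ[K]
    Cof K A.carrier M.carrier :=
  TensorProduct.map (-M.parity) A.barSign

/-- `f` has bidegree `(r, 0)`. -/
def HasDegree (A M N : BigradedSpace K) (r : ℤ) (f : Cof K A.carrier M.carrier →ₗ[K]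
    Cof K A.carrier N.carrier) : Prop :=
  ∀ i j, ∀ x ∈ cofreeGr A M i j, f x ∈ cofreeGr A N (i + r) j

lemma HasDegree.comp {A M N P : BigradedSpace K} {r s k : ℤ}
    {g : Cof K A.carrier N.carrier →ₗ[K] Cof K A.carrier P.carrier}
    {f : Cof K A.carrier M.carrier →ₗ[K] Cof K A.carrier N.carrier}
    (hg : HasDegree A N P r g) (hf : HasDegree A M N s f)
    (hk : s + r = k) : HasDegree A M P k (g ∘ₗ f) := by
  intro i j x hx
  have := hg _ _ _ (hf i j x hx)
  rwa [add_assoc, hk] at this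

lemma hasDegree_strictMap {A M N : BigradedSpace K} {l : M.carrier →ₗ[K] N.carrier}
    (hl : ∀ i j, ∀ m ∈ M.gr i j, l m ∈ N.gr i j) : HasDegree A M N 0 (strictMap K A.carrier l) := by
  intro i j x hx
  rw [add_zero]
  refine Submodule.span_induction (p := fun x _ => strictMap K A.carrier l x ∈ cofreeGr A N i j)
    ?_ (by simp) (fun x y _ _ hx hy => by rw [map_add]; exact add_mem hx hy)
    (fun c x _ hx => by rw [map_smul]; exact Submodule.smul_mem _ _ hx) hx
  rintro _ ⟨p, q, r, s, m, t, hm, ht, hi, hj, rfl⟩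
  exact Submodule.subset_span ⟨p, q, r, s, l m, t, hl _ _ _ hm, ht, hi, hj, by simp⟩

end BigradedSpace

open BigradedSpace

/-! ### Topological A∞-algebras and their modules -/

/-- A topological `A∞`-algebra: a codifferential `d = ∑ d⁽ⁿ⁾ ħⁿ` of bidegree `(1, 0)` on the
topological tensor coalgebra `T(A[1])⟦ħ⟧`. -/
structure TopAInfAlg (K : Type u) [Field K] extends BigradedSpace K where
  d : Ser K (TensorAlgebra K carrier) (TensorAlgebra K carrier)
  d_degree : ∀ n r s, ∀ t ∈ toBigradedSpace.barGr r s, d n t ∈ toBigradedSpace.barGr (r + 1) s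
  d_coderivation : ∀ n, deconc K carrier ∘ₗ d n =
    (TensorProduct.map (d n) LinearMap.id + TensorProduct.map toBigradedSpace.barSign (d n)) ∘ₗ
      deconc K carrier
  d_comp_d : d.comp d = 0

namespace TopAInfAlg

variable {K : Type u} [Field K] (A : TopAInfAlg K)

/-- The algebra is flat: the curvature `K → A[1]` vanishes, at every order in `ħ`. -/
def IsFlat : Prop := ∀ n, A.d n 1 = 0

/-- A strict unit. In terms of `m₂` and `mₙ`, where `d̄ⁿ = -s ∘ mₙ ∘ (s⁻¹)^{⊗ n}`, the conditions
are `m₂(a, 1) = a = m₂(1, a)`, and `mₙ(a₁, …, aₙ) = 0` if `n ≥ 3` and some `aᵢ` is `1`. -/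
structure StrictUnit where
  one : A.carrier
  one_mem : one ∈ A.gr 0 0
  right_unit : ∀ n a, TensorAlgebra.ιInv (A.d n (TensorAlgebra.ι K a * TensorAlgebra.ι K one)) =
    if n = 0 then A.parity a else 0
  left_unit : ∀ n a, TensorAlgebra.ιInv (A.d n (TensorAlgebra.ι K one * TensorAlgebra.ι K a)) =
    if n = 0 then a else 0
  higher_right : ∀ n a b s t, TensorAlgebra.ιInv (A.d n (TensorAlgebra.ι K a *
    TensorAlgebra.ι K b * s * TensorAlgebra.ι K one * t)) = 0
  higher_middle : ∀ n a b s t, TensorAlgebra.ιInv (A.d n (TensorAlgebra.ι K a * s *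
    TensorAlgebra.ι K one * t * TensorAlgebra.ι K b)) = 0
  higher_left : ∀ n a b s t, TensorAlgebra.ιInv (A.d n (s * TensorAlgebra.ι K one * t *
    TensorAlgebra.ι K a * TensorAlgebra.ι K b)) = 0

end TopAInfAlg

variable {K : Type u} [Field K] {A : TopAInfAlg K}

/-- A strictly unital topological right `A∞`-module over `A`: a topologically free bigraded
module with a codifferential `d = ∑ d⁽ⁿ⁾ ħⁿ` of bidegree `(1, 0)` on the `T(A[1])⟦ħ⟧`-comodule
`(M[1] ⊗ T(A[1]))⟦ħ⟧`. The last three fields say that the unit of `A` acts as the identity, and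
that the Taylor components `d̄ⁿ`, `n ≥ 2`, vanish if one argument from `A` is the unit. -/
structure TopMod (e : A.StrictUnit) extends BigradedSpace K where
  d : Ser K (Cof K A.carrier carrier) (Cof K A.carrier carrier)
  d_degree : ∀ n, HasDegree A.toBigradedSpace toBigradedSpace toBigradedSpace 1 (d n)
  d_coderivation : ∀ n, coact K A.carrier carrier ∘ₗ d n =
    (TensorProduct.map (d n) LinearMap.id +
      TensorProduct.map (cofreeSign A.toBigradedSpace toBigradedSpace) (A.d n)) ∘ₗ
        coact K A.carrier carrier
  d_comp_d : d.comp d = 0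
  unit_act : ∀ n m, toCogen K A.carrier carrier (d n (m ⊗ₜ TensorAlgebra.ι K e.one)) =
    if n = 0 then toBigradedSpace.parity m else 0
  unit_right : ∀ n m a s t, toCogen K A.carrier carrier
    (d n (m ⊗ₜ (TensorAlgebra.ι K a * s * TensorAlgebra.ι K e.one * t))) = 0
  unit_left : ∀ n m a s t, toCogen K A.carrier carrier
    (d n (m ⊗ₜ (s * TensorAlgebra.ι K e.one * t * TensorAlgebra.ι K a))) = 0

namespace TopMod

variable {e : A.StrictUnit}

/-- The comodule `M[1] ⊗ T(A[1])`. -/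
abbrev R (M : TopMod e) : Type u := Cof K A.carrier M.carrier

/-- The series of comodule maps `M[1] ⊗ T(A[1]) → N[1] ⊗ T(A[1])` of bidegree `(r, 0)` which are
strictly unital, that is, whose Taylor components of order `≥ 1` vanish if one argument from `A`
is the unit. -/
structure IsPreHom (M N : TopMod e) (r : ℤ) (f : Ser K M.R N.R) : Prop where
  comodule : ∀ n, IsComoduleMap K A.carrier (f n)
  degree : ∀ n, HasDegree A.toBigradedSpace M.toBigradedSpace N.toBigradedSpace r (f n)
  unital : ∀ n, VanishesOn K A.carrier e.one (f n)

lemma IsPreHom.zero (M N : TopMod e) (r : ℤ) : IsPreHom M N r 0 where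
  comodule n := by simp [IsComoduleMap]
  degree n i j x _ := by simp
  unital n m s t := by simp

lemma IsPreHom.add {M N : TopMod e} {r : ℤ} {f g : Ser K M.R N.R} (hf : IsPreHom M N r f)
    (hg : IsPreHom M N r g) : IsPreHom M N r (f + g) where
  comodule n := by
    have h1 := hf.comodule n
    have h2 := hg.comodule n
    unfold IsComoduleMap at *
    rw [Pi.add_apply, LinearMap.comp_add, h1, h2, LinearMap.rTensor_add, LinearMap.add_comp]
  degree n i j x hx := add_mem (hf.degree n i j x hx) (hg.degree n i j x hx)
  unital n m s t := by
    rw [Pi.add_apply, LinearMap.add_apply, map_add, hf.unital n m s t, hg.unital n m s t,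
      add_zero]

lemma IsPreHom.smul {M N : TopMod e} {r : ℤ} {f : Ser K M.R N.R} (c : K)
    (hf : IsPreHom M N r f) : IsPreHom M N r (c • f) where
  comodule n := by
    have h1 := hf.comodule n
    unfold IsComoduleMap at *
    rw [Pi.smul_apply, LinearMap.comp_smul, h1, LinearMap.rTensor_smul, LinearMap.smul_comp]
  degree n i j x hx := Submodule.smul_mem _ _ (hf.degree n i j x hx)
  unital n m s t := by
    rw [Pi.smul_apply, LinearMap.smul_apply, map_smul, hf.unital n m s t, smul_zero]

lemma IsPreHom.neg {M N : TopMod e} {r : ℤ} {f : Ser K M.R N.R} (hf : IsPreHom M N r f) :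
    IsPreHom M N r (-f) := neg_one_smul K f ▸ hf.smul (-1)

lemma IsPreHom.comp {M N P : TopMod e} {r s k : ℤ} {g : Ser K N.R P.R} {f : Ser K M.R N.R}
    (hg : IsPreHom N P r g) (hf : IsPreHom M N s f) (hk : s + r = k) :
    IsPreHom M P k (g.comp f) := by
  have key : ∀ p : ℕ × ℕ, IsPreHom M P k (fun _ => g p.1 ∘ₗ f p.2) := fun p =>
    ⟨fun _ => (hg.comodule p.1).comp (hf.comodule p.2),
      fun _ => (hg.degree p.1).comp (hf.degree p.2) hk,
      fun _ => (hg.unital p.1).comp (hf.unital p.2) (hf.comodule p.2)⟩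
  have h : ∀ s : Finset (ℕ × ℕ), IsPreHom M P k (fun _ => ∑ p ∈ s, g p.1 ∘ₗ f p.2) := by
    classical
    intro s
    induction s using Finset.induction_on with
    | empty => exact IsPreHom.zero M P k
    | insert p s hp ih => simp only [Finset.sum_insert hp]; exact (key p).add ih
  exact ⟨fun n => (h (Finset.HasAntidiagonal.antidiagonal n)).comodule n,
    fun n => (h (Finset.HasAntidiagonal.antidiagonal n)).degree n,
    fun n => (h (Finset.HasAntidiagonal.antidiagonal n)).unital n⟩

lemma IsPreHom.const {M N : TopMod e} {l : M.carrier →ₗ[K] N.carrier}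
    (hl : ∀ i j, ∀ m ∈ M.gr i j, l m ∈ N.gr i j) :
    IsPreHom M N 0 (Ser.const (strictMap K A.carrier l)) := by
  have h0 := IsPreHom.zero M N 0
  constructor <;> intro n <;> by_cases hn : n = 0 <;> simp only [Ser.const, hn, if_true, if_false]
  · exact coact_strictMap l
  · exact h0.comodule 0
  · exact hasDegree_strictMap hl
  · exact h0.degree 0
  · exact vanishesOn_strictMap _ l
  · exact h0.unital 0

/-- The morphisms of strictly unital topological `A∞`-modules. -/
@[ext] structure Hom (M N : TopMod e) where
  ser : Ser K M.R N.R
  isPreHom : IsPreHom M N 0 ser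
  comm : N.d.comp ser = ser.comp M.d

lemma isPreHom_id (M : TopMod e) : IsPreHom M M 0 (Ser.const LinearMap.id) := by
  have := IsPreHom.const (M := M) (N := M) (l := LinearMap.id) (fun _ _ _ h => h)
  rwa [strictMap, LinearMap.rTensor_id] at this

instance : Category (TopMod e) where
  Hom M N := Hom M N
  id M := ⟨Ser.const LinearMap.id, isPreHom_id M, by rw [Ser.comp_id, Ser.id_comp]⟩
  comp f g := ⟨g.ser.comp f.ser, g.isPreHom.comp f.isPreHom (add_zero 0), by
    rw [← Ser.comp_assoc, g.comm, Ser.comp_assoc, f.comm, Ser.comp_assoc]⟩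
  id_comp f := Hom.ext (Ser.comp_id f.ser)
  comp_id f := Hom.ext (Ser.id_comp f.ser)
  assoc f g h := Hom.ext (Ser.comp_assoc h.ser g.ser f.ser).symm

@[ext] lemma hom_ext {M N : TopMod e} {f g : M ⟶ N} (h : f.ser = g.ser) : f = g := Hom.ext h

@[simp] lemma ser_id (M : TopMod e) : Hom.ser (𝟙 M) = Ser.const LinearMap.id := rfl

@[simp] lemma ser_comp {M N P : TopMod e} (f : M ⟶ N) (g : N ⟶ P) :
    (f ≫ g).ser = g.ser.comp f.ser := rfl

instance (M N : TopMod e) : Zero (M ⟶ N) :=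
  ⟨⟨0, IsPreHom.zero M N 0, by rw [Ser.comp_zero, Ser.zero_comp]⟩⟩

instance (M N : TopMod e) : Add (M ⟶ N) :=
  ⟨fun f g => ⟨f.ser + g.ser, f.isPreHom.add g.isPreHom, by
    rw [Ser.comp_add, Ser.add_comp, f.comm, g.comm]⟩⟩

instance (M N : TopMod e) : Neg (M ⟶ N) :=
  ⟨fun f => ⟨-f.ser, f.isPreHom.neg, by rw [Ser.comp_neg, Ser.neg_comp, f.comm]⟩⟩

@[simp] lemma ser_zero {M N : TopMod e} : Hom.ser (0 : M ⟶ N) = 0 := rfl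

@[simp] lemma ser_add {M N : TopMod e} (f g : M ⟶ N) : (f + g).ser = f.ser + g.ser := rfl

@[simp] lemma ser_neg {M N : TopMod e} (f : M ⟶ N) : (-f).ser = -f.ser := rfl

instance (M N : TopMod e) : AddCommGroup (M ⟶ N) where
  add_assoc f g h := Hom.ext (add_assoc f.ser g.ser h.ser)
  zero_add f := Hom.ext (zero_add f.ser)
  add_zero f := Hom.ext (add_zero f.ser)
  add_comm f g := Hom.ext (add_comm f.ser g.ser)
  neg_add_cancel f := Hom.ext (neg_add_cancel f.ser)
  nsmul := nsmulRec
  zsmul := zsmulRec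

instance : Preadditive (TopMod e) where
  add_comp _ _ _ f f' g := Hom.ext (Ser.comp_add g.ser f.ser f'.ser)
  comp_add _ _ _ f g g' := Hom.ext (Ser.add_comp g.ser g'.ser f.ser)

/-- The strict morphism given by a linear map of bidegree `(0, 0)`, constant in `ħ`. -/
def strictHom {M N : TopMod e} (l : M.carrier →ₗ[K] N.carrier)
    (hl : ∀ i j, ∀ m ∈ M.gr i j, l m ∈ N.gr i j)
    (hd : ∀ n, N.d n ∘ₗ strictMap K A.carrier l = strictMap K A.carrier l ∘ₗ M.d n) : M ⟶ N where
  ser := Ser.const (strictMap K A.carrier l)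
  isPreHom := IsPreHom.const hl
  comm := by rw [Ser.comp_const, Ser.const_comp]; exact funext hd

/-! ### The shift -/

lemma cofreeGr_shift (A M : BigradedSpace K) (a i j : ℤ) :
    cofreeGr A (M.shift a) i j = cofreeGr A M (i + a) j := by
  unfold cofreeGr
  congr 1
  ext x
  constructor
  · rintro ⟨p, q, r, s, m, t, hm, ht, hi, hj, rfl⟩
    exact ⟨p + a, q, r, s, m, t, hm, ht, by omega, hj, rfl⟩
  · rintro ⟨p, q, r, s, m, t, hm, ht, hi, hj, rfl⟩
    exact ⟨p - a, q, r, s, m, t, by simpa using hm, ht, by omega, hj, rfl⟩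

lemma hasDegree_shift {A M N : BigradedSpace K}
    {f : Cof K A.carrier M.carrier →ₗ[K] Cof K A.carrier N.carrier} {r : ℤ}
    (hf : HasDegree A M N r f) (a b k : ℤ) (h : r + a = k + b) :
    HasDegree A (M.shift a) (N.shift b) k f := by
  intro i j x hx
  rw [cofreeGr_shift] at hx ⊢
  have := hf _ _ _ hx
  rwa [show i + a + r = i + k + b by omega] at this

lemma cofreeSign_shift (A M : BigradedSpace K) (a : ℤ) :
    cofreeSign A (M.shift a) = (-1 : K) ^ a • cofreeSign A M := by
  rw [cofreeSign, cofreeSign, parity_shift, ← smul_neg, TensorProduct.map_smul_left]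

/-- The shift `M[a]` of a module. On `M[a][1] ⊗ T(A[1])`, whose underlying space is that of
`M[1] ⊗ T(A[1])`, the codifferential is `(-1)^a d`; for `a = 1` its Taylor components are
`-s ∘ d̄ⁿ ∘ (s⁻¹ ⊗ 1)`. -/
abbrev shiftObj (M : TopMod e) (a : ℤ) : TopMod e where
  toBigradedSpace := M.toBigradedSpace.shift a
  d := (-1 : K) ^ a • M.d
  d_degree n := hasDegree_shift (M := M.toBigradedSpace) (N := M.toBigradedSpace)
    (f := (-1 : K) ^ a • M.d n)
    (fun i j x hx => Submodule.smul_mem _ _ (M.d_degree n i j x hx)) a a 1 rfl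
  d_coderivation n := by
    rw [cofreeSign_shift, Pi.smul_apply, LinearMap.comp_smul, M.d_coderivation n,
      TensorProduct.map_smul_left, TensorProduct.map_smul_left, ← smul_add, LinearMap.smul_comp]
  d_comp_d := by rw [Ser.comp_smul, Ser.smul_comp, M.d_comp_d, smul_zero, smul_zero]
  unit_act n m := by
    rw [parity_shift, Pi.smul_apply, LinearMap.smul_apply, map_smul, M.unit_act n m]
    split_ifs <;> simp
  unit_right n m b s t := by
    rw [Pi.smul_apply, LinearMap.smul_apply, map_smul, M.unit_right, smul_zero]
  unit_left n m b s t := by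
    rw [Pi.smul_apply, LinearMap.smul_apply, map_smul, M.unit_left, smul_zero]

lemma IsPreHom.shift {M N : TopMod e} {r : ℤ} {f : Ser K M.R N.R} (hf : IsPreHom M N r f)
    (a b k : ℤ) (h : r + a = k + b) : IsPreHom (M.shiftObj a) (N.shiftObj b) k f where
  comodule n := hf.comodule n
  degree n := hasDegree_shift (hf.degree n) a b k h
  unital n := hf.unital n

end TopMod

lemma Ser.smul_comm_aux {V W : Type u} [AddCommGroup V] [Module K V] [AddCommGroup W]
    [Module K W] (c : K) {d : Ser K V V} {d' : Ser K W W} {f : Ser K V W}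
    (h : d'.comp f = f.comp d) : (c • d').comp f = f.comp (c • d) := by
  rw [Ser.smul_comp, Ser.comp_smul, h]

namespace TopMod

variable {e : A.StrictUnit}

/-- The shift functor `[a]`; it does not change the underlying maps of comodules. -/
def shiftBy (e : A.StrictUnit) (a : ℤ) : TopMod e ⥤ TopMod e where
  obj M := M.shiftObj a
  map {M N} f :=
    { ser := f.ser
      isPreHom := f.isPreHom.shift a a 0 (by omega)
      comm := Ser.smul_comm_aux ((-1 : K) ^ a) f.comm }
  map_id M := Hom.ext rfl
  map_comp f g := Hom.ext rfl

/-- `M[0] ≅ M`, given by the identity. -/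
def shiftZeroIso (M : TopMod e) : M.shiftObj 0 ≅ M where
  hom :=
    { ser := (Ser.const LinearMap.id : Ser K M.R M.R)
      isPreHom :=
        { comodule := (isPreHom_id M).comodule
          degree := fun n i j x hx => by
            rw [cofreeGr_shift] at hx
            simpa using (isPreHom_id M).degree n _ _ _ hx
          unital := (isPreHom_id M).unital }
      comm := by rw [Ser.comp_id, Ser.id_comp]; simp }
  inv :=
    { ser := (Ser.const LinearMap.id : Ser K M.R M.R)
      isPreHom :=
        { comodule := (isPreHom_id M).comodule
          degree := fun n i j x hx => by
            rw [cofreeGr_shift]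
            simpa using (isPreHom_id M).degree n _ _ _ hx
          unital := (isPreHom_id M).unital }
      comm := by rw [Ser.comp_id, Ser.id_comp]; simp }
  hom_inv_id := Hom.ext (Ser.id_comp _)
  inv_hom_id := Hom.ext (Ser.id_comp _)

/-- `M[a + b] ≅ M[a][b]`, given by the identity. -/
def shiftAddIso (M : TopMod e) (a b : ℤ) : M.shiftObj (a + b) ≅ (M.shiftObj a).shiftObj b where
  hom :=
    { ser := (Ser.const LinearMap.id : Ser K M.R M.R)
      isPreHom :=
        { comodule := (isPreHom_id M).comodule
          degree := fun n i j x hx => by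
            rw [cofreeGr_shift] at hx
            rw [cofreeGr_shift, cofreeGr_shift]
            simpa [add_assoc, add_comm a b] using (isPreHom_id M).degree n _ _ _ hx
          unital := (isPreHom_id M).unital }
      comm := by
        rw [Ser.comp_id, Ser.id_comp]
        change (-1 : K) ^ b • (-1 : K) ^ a • M.d = (-1 : K) ^ (a + b) • M.d
        rw [smul_smul, zpow_add₀ (by simp), mul_comm] }
  inv :=
    { ser := (Ser.const LinearMap.id : Ser K M.R M.R)
      isPreHom :=
        { comodule := (isPreHom_id M).comodule
          degree := fun n i j x hx => by
            rw [cofreeGr_shift, cofreeGr_shift] at hx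
            rw [cofreeGr_shift]
            simpa [add_assoc, add_comm a b] using (isPreHom_id M).degree n _ _ _ hx
          unital := (isPreHom_id M).unital }
      comm := by
        rw [Ser.comp_id, Ser.id_comp]
        change (-1 : K) ^ (a + b) • M.d = (-1 : K) ^ b • (-1 : K) ^ a • M.d
        rw [smul_smul, zpow_add₀ (by simp), mul_comm] }
  hom_inv_id := Hom.ext (Ser.id_comp _)
  inv_hom_id := Hom.ext (Ser.id_comp _)

lemma ser_eqToHom (M : TopMod e) {a b : ℤ} (h : a = b) (h' : M.shiftObj a = M.shiftObj b) :
    (eqToHom h').ser = (Ser.const LinearMap.id : Ser K M.R M.R) := by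
  subst h; rfl

lemma ser_comp_of {M N P : TopMod e} {f : M ⟶ N} {g : N ⟶ P} {f' : Ser K M.R N.R}
    {g' : Ser K N.R P.R} (hf : f.ser = f') (hg : g.ser = g') : (f ≫ g).ser = g'.comp f' := by
  rw [ser_comp, hf, hg]

/-- The shift functors `[a]`, with `M[0] ≅ M` and `M[a + b] ≅ M[a][b]` given by identity maps. -/
instance : HasShift (TopMod e) ℤ := hasShiftMk (TopMod e) ℤ
  { F := shiftBy e
    zero := NatIso.ofComponents shiftZeroIso (fun {M N} f =>
      Hom.ext ((Ser.id_comp f.ser).trans (Ser.comp_id f.ser).symm))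
    add := fun a b => NatIso.ofComponents (fun M => shiftAddIso M a b) (fun {M N} f =>
      Hom.ext ((Ser.id_comp f.ser).trans (Ser.comp_id f.ser).symm))
    assoc_hom_app := fun a b c M => Hom.ext (by
      have h := ser_comp_of (g := (shiftAddIso M a (b + c)).hom ≫
        (shiftAddIso (M.shiftObj a) b c).hom) (ser_eqToHom M (add_assoc a b c) (by rw [add_assoc]))
        (Ser.id_comp _)
      exact (Ser.id_comp _).trans ((Ser.id_comp _).symm.trans h.symm))
    zero_add_hom_app := fun a M => Hom.ext (by
      have h := ser_comp_of (g := (shiftBy e a).map (shiftZeroIso M).inv)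
        (ser_eqToHom M (zero_add a) (by rw [zero_add])) rfl
      exact (Ser.id_comp _).symm.trans h.symm)
    add_zero_hom_app := fun a M => Hom.ext (by
      have h := ser_comp_of (g := (shiftZeroIso (M.shiftObj a)).inv)
        (ser_eqToHom M (add_zero a) (by rw [add_zero])) rfl
      exact (Ser.id_comp _).symm.trans h.symm) }

instance (a : ℤ) : (shiftFunctor (TopMod e) a).Additive where
  map_add := rfl

end TopMod

/-! ### The homotopy category -/

section Homotopy

variable (e : A.StrictUnit)

/-- `f` and `g` are homotopic: `f - g = d_N ∘ H + H ∘ d_M` for a strictly unital series `H` of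
comodule maps of bidegree `(-1, 0)`. -/
def homotopic : HomRel (TopMod e) := fun M N f g =>
  ∃ H : Ser K M.R N.R, TopMod.IsPreHom M N (-1) H ∧ f.ser - g.ser = N.d.comp H + H.comp M.d

lemma homotopic_add ⦃M N : TopMod e⦄ (f₁ f₂ g₁ g₂ : M ⟶ N) (hf : homotopic e f₁ f₂)
    (hg : homotopic e g₁ g₂) : homotopic e (f₁ + g₁) (f₂ + g₂) := by
  obtain ⟨H, hH, h⟩ := hf
  obtain ⟨H', hH', h'⟩ := hg
  refine ⟨H + H', hH.add hH', ?_⟩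
  rw [TopMod.ser_add, TopMod.ser_add, add_sub_add_comm, h, h', Ser.comp_add, Ser.add_comp]
  abel

instance homotopic_congruence : Congruence (homotopic e) where
  equivalence {M N} :=
    { refl := fun f => ⟨0, TopMod.IsPreHom.zero _ _ _, by
        rw [Ser.comp_zero, Ser.zero_comp, sub_self, add_zero]⟩
      symm := by
        rintro f g ⟨H, hH, h⟩
        exact ⟨-H, hH.neg, by rw [Ser.comp_neg, Ser.neg_comp, ← neg_sub, h, neg_add]⟩
      trans := by
        rintro f g k ⟨H, hH, h⟩ ⟨H', hH', h'⟩
        refine ⟨H + H', hH.add hH', ?_⟩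
        rw [← sub_add_sub_cancel f.ser g.ser k.ser, h, h', Ser.comp_add, Ser.add_comp]
        abel }
  comp_left := by
    rintro M N P f g g' ⟨H, hH, h⟩
    refine ⟨H.comp f.ser, hH.comp f.isPreHom (by omega), ?_⟩
    rw [TopMod.ser_comp, TopMod.ser_comp, ← Ser.sub_comp, h, Ser.add_comp, Ser.comp_assoc,
      Ser.comp_assoc, Ser.comp_assoc, f.comm]
  comp_right := by
    rintro M N P f f' g ⟨H, hH, h⟩
    refine ⟨g.ser.comp H, g.isPreHom.comp hH (by omega), ?_⟩
    rw [TopMod.ser_comp, TopMod.ser_comp, ← Ser.comp_sub, h, Ser.comp_add, ← Ser.comp_assoc,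
      ← Ser.comp_assoc, ← Ser.comp_assoc, g.comm]

instance : (homotopic e).IsCompatibleWithShift ℤ where
  condition := by
    rintro a M N f g ⟨H, hH, h⟩
    refine ⟨((-1 : K) ^ a • H : Ser K M.R N.R), (hH.smul _).shift a a (-1) rfl, ?_⟩
    change f.ser - g.ser = ((-1 : K) ^ a • N.d).comp ((-1 : K) ^ a • H) +
      ((-1 : K) ^ a • H).comp ((-1 : K) ^ a • M.d)
    have h1 : (-1 : K) ^ a * (-1 : K) ^ a = 1 := by rw [← mul_zpow]; simp
    rw [Ser.comp_smul, Ser.comp_smul, Ser.smul_comp, Ser.smul_comp, smul_smul, smul_smul, h1,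
      one_smul, one_smul, h]

/-- The homotopy category of strictly unital topologically free `A∞`-modules over `A`. -/
abbrev HoCat : Type (u + 1) := CategoryTheory.Quotient (homotopic e)

instance : Preadditive (HoCat e) := Quotient.preadditive _ (homotopic_add e)

/-- The functor which sends a morphism to its homotopy class. -/
abbrev hoFunctor : TopMod e ⥤ HoCat e := CategoryTheory.Quotient.functor (homotopic e)

instance : (hoFunctor e).Additive where
  map_add := rfl

lemma isInternal_of_subsingleton {V : Type u} [AddCommGroup V] [Module K V] [Subsingleton V]
    (p : ℤ × ℤ → Submodule K V) : DirectSum.IsInternal p := by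
  constructor
  · intro x y _
    exact DFinsupp.ext fun i => Subsingleton.elim _ _
  · exact fun y => ⟨0, Subsingleton.elim _ _⟩

/-- The zero module. -/
def zeroMod : TopMod e where
  carrier := PUnit
  gr _ _ := ⊤
  isInternal := isInternal_of_subsingleton _
  d := 0
  d_degree n i j x _ := by simp
  d_coderivation n := by
    refine TensorProduct.ext' fun m t => ?_
    rw [Subsingleton.elim m 0, zero_tmul, map_zero, map_zero]
  d_comp_d := Ser.comp_zero _
  unit_act _ _ := Subsingleton.elim _ _
  unit_right _ _ _ _ _ := Subsingleton.elim _ _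
  unit_left _ _ _ _ _ := Subsingleton.elim _ _

instance : HasZeroObject (TopMod e) :=
  ⟨zeroMod e, by
    rw [IsZero.iff_id_eq_zero]
    ext n : 2
    refine TensorProduct.ext' fun m t => ?_
    have : m = 0 := Subsingleton.elim (α := PUnit) _ _
    rw [this, zero_tmul, map_zero, map_zero]⟩

open ZeroObject in
instance : HasZeroObject (HoCat e) :=
  ⟨(hoFunctor e).obj 0, by
    rw [IsZero.iff_id_eq_zero, ← (hoFunctor e).map_id, id_zero, Functor.map_zero]⟩

instance (n : ℤ) : (shiftFunctor (HoCat e) n).Additive := by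
  have : (hoFunctor e ⋙ shiftFunctor (HoCat e) n).Additive :=
    Functor.additive_of_iso ((hoFunctor e).commShiftIso n)
  exact Functor.additive_of_full_essSurj_comp (hoFunctor e) (shiftFunctor (HoCat e) n)

end Homotopy

/-! ### Cones and cylinders -/

lemma coderivation_sandwich {A : TopAInfAlg K} {M N P Q : Type u}
    [AddCommGroup M] [Module K M] [AddCommGroup N] [Module K N]
    [AddCommGroup P] [Module K P] [AddCommGroup Q] [Module K Q]
    {g : Cof K A.carrier P →ₗ[K] Cof K A.carrier Q}
    {d s : Cof K A.carrier N →ₗ[K] Cof K A.carrier P}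
    {f : Cof K A.carrier M →ₗ[K] Cof K A.carrier N}
    {a : TensorAlgebra K A.carrier →ₗ[K] TensorAlgebra K A.carrier}
    (hg : IsComoduleMap K A.carrier g) (hf : IsComoduleMap K A.carrier f)
    (hd : coact K A.carrier P ∘ₗ d =
      (TensorProduct.map d LinearMap.id + TensorProduct.map s a) ∘ₗ coact K A.carrier N) :
    coact K A.carrier Q ∘ₗ (g ∘ₗ d ∘ₗ f) =
      (TensorProduct.map (g ∘ₗ d ∘ₗ f) LinearMap.id + TensorProduct.map (g ∘ₗ s ∘ₗ f) a) ∘ₗ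
        coact K A.carrier M := by
  unfold IsComoduleMap at hg hf
  rw [← LinearMap.comp_assoc, hg, LinearMap.comp_assoc, ← LinearMap.comp_assoc f d, hd,
    LinearMap.comp_assoc, hf, ← LinearMap.comp_assoc, ← LinearMap.comp_assoc]
  congr 1
  refine TensorProduct.ext' fun x t => ?_
  simp

namespace TopMod

variable {e : A.StrictUnit}

section Twist

variable (M N : TopMod e)

/-- The codifferential `(x, y) ↦ (d_M x, φ x + d_N y)` on `(M ⊕ N)[1] ⊗ T(A[1])`. -/
def twistD (φ : Ser K M.R N.R) :
    Ser K (Cof K A.carrier (M.carrier × N.carrier)) (Cof K A.carrier (M.carrier × N.carrier)) :=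
  fun n =>
    strictMap K A.carrier (LinearMap.inl K M.carrier N.carrier) ∘ₗ M.d n ∘ₗ
        strictMap K A.carrier (LinearMap.fst K M.carrier N.carrier) +
      strictMap K A.carrier (LinearMap.inr K M.carrier N.carrier) ∘ₗ φ n ∘ₗ
        strictMap K A.carrier (LinearMap.fst K M.carrier N.carrier) +
      strictMap K A.carrier (LinearMap.inr K M.carrier N.carrier) ∘ₗ N.d n ∘ₗ
        strictMap K A.carrier (LinearMap.snd K M.carrier N.carrier)

variable {M N}

lemma toCogen_twistD (φ : Ser K M.R N.R) (n : ℕ) (x : Cof K A.carrier (M.carrier × N.carrier)) :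
    toCogen K A.carrier _ (twistD M N φ n x) =
      (toCogen K A.carrier _ (M.d n (strictMap K A.carrier (LinearMap.fst K _ _) x)),
        toCogen K A.carrier _ (φ n (strictMap K A.carrier (LinearMap.fst K _ _) x)) +
        toCogen K A.carrier _ (N.d n (strictMap K A.carrier (LinearMap.snd K _ _) x))) := by
  simp only [twistD, LinearMap.add_apply, LinearMap.comp_apply, map_add, toCogen_strictMap]
  simp

lemma strictMap_comp {U V W B : Type u} [AddCommGroup U] [Module K U] [AddCommGroup V]
    [Module K V] [AddCommGroup W] [Module K W] [AddCommGroup B] [Module K B]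
    (g : V →ₗ[K] W) (f : U →ₗ[K] V) :
    strictMap K B g ∘ₗ strictMap K B f = strictMap K B (g ∘ₗ f) :=
  (LinearMap.rTensor_comp _ g f).symm

lemma fst_twistD (φ : Ser K M.R N.R) (n : ℕ) :
    strictMap K A.carrier (LinearMap.fst K _ _) ∘ₗ twistD M N φ n =
      M.d n ∘ₗ strictMap K A.carrier (LinearMap.fst K _ _) := by
  simp only [twistD, LinearMap.comp_add, ← LinearMap.comp_assoc, strictMap_comp,
    LinearMap.fst_comp_inl, LinearMap.fst_comp_inr]
  simp

lemma snd_twistD (φ : Ser K M.R N.R) (n : ℕ) :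
    strictMap K A.carrier (LinearMap.snd K _ _) ∘ₗ twistD M N φ n =
      φ n ∘ₗ strictMap K A.carrier (LinearMap.fst K _ _) +
      N.d n ∘ₗ strictMap K A.carrier (LinearMap.snd K _ _) := by
  simp only [twistD, LinearMap.comp_add, ← LinearMap.comp_assoc, strictMap_comp,
    LinearMap.snd_comp_inl, LinearMap.snd_comp_inr]
  simp

lemma twistD_inr (φ : Ser K M.R N.R) (n : ℕ) :
    twistD M N φ n ∘ₗ strictMap K A.carrier (LinearMap.inr K _ _) =
      strictMap K A.carrier (LinearMap.inr K _ _) ∘ₗ N.d n := by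
  simp only [twistD, LinearMap.add_comp, LinearMap.comp_assoc, strictMap_comp,
    LinearMap.fst_comp_inr, LinearMap.snd_comp_inr]
  simp

lemma ext_prod {B U V X : Type u} [AddCommGroup B] [Module K B] [AddCommGroup U] [Module K U]
    [AddCommGroup V] [Module K V] [AddCommGroup X] [Module K X]
    {f g : X →ₗ[K] Cof K B (U × V)}
    (h1 : strictMap K B (LinearMap.fst K U V) ∘ₗ f = strictMap K B (LinearMap.fst K U V) ∘ₗ g)
    (h2 : strictMap K B (LinearMap.snd K U V) ∘ₗ f = strictMap K B (LinearMap.snd K U V) ∘ₗ g) :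
    f = g := by
  have key : strictMap K B (LinearMap.inl K U V) ∘ₗ strictMap K B (LinearMap.fst K U V) +
      strictMap K B (LinearMap.inr K U V) ∘ₗ strictMap K B (LinearMap.snd K U V) =
      LinearMap.id := by
    rw [strictMap_comp, strictMap_comp, ← LinearMap.rTensor_add]
    convert! LinearMap.rTensor_id (TensorAlgebra K B) (U × V) using 2
    ext <;> simp
  rw [← LinearMap.id_comp f, ← LinearMap.id_comp g, ← key, LinearMap.add_comp, LinearMap.add_comp,
    LinearMap.comp_assoc, LinearMap.comp_assoc, LinearMap.comp_assoc, LinearMap.comp_assoc, h1, h2]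

lemma twistD_comp (φ : Ser K M.R N.R) (h : N.d.comp φ + φ.comp M.d = 0) :
    (twistD M N φ).comp (twistD M N φ) = 0 := by
  have f1 : (Ser.const (strictMap K A.carrier (LinearMap.fst K M.carrier N.carrier))).comp
      (twistD M N φ) = M.d.comp (Ser.const (strictMap K A.carrier (LinearMap.fst K _ _))) := by
    rw [Ser.const_comp, Ser.comp_const]; exact funext (fst_twistD φ)
  have f2 : (Ser.const (strictMap K A.carrier (LinearMap.snd K M.carrier N.carrier))).comp
      (twistD M N φ) = φ.comp (Ser.const (strictMap K A.carrier (LinearMap.fst K _ _))) +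
        N.d.comp (Ser.const (strictMap K A.carrier (LinearMap.snd K _ _))) := by
    rw [Ser.const_comp, Ser.comp_const, Ser.comp_const]; exact funext (snd_twistD φ)
  have g1 : (Ser.const (strictMap K A.carrier (LinearMap.fst K M.carrier N.carrier))).comp
      ((twistD M N φ).comp (twistD M N φ)) = 0 := by
    rw [← Ser.comp_assoc, f1, Ser.comp_assoc, f1, ← Ser.comp_assoc, M.d_comp_d, Ser.zero_comp]
  have g2 : (Ser.const (strictMap K A.carrier (LinearMap.snd K M.carrier N.carrier))).comp
      ((twistD M N φ).comp (twistD M N φ)) = 0 := by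
    rw [← Ser.comp_assoc, f2, Ser.add_comp, Ser.comp_assoc, f1, Ser.comp_assoc, f2, Ser.comp_add,
      ← Ser.comp_assoc, ← Ser.comp_assoc, ← Ser.comp_assoc, N.d_comp_d, Ser.zero_comp, add_zero,
      ← Ser.add_comp, add_comm, h, Ser.zero_comp]
  rw [Ser.const_comp] at g1 g2
  funext n
  exact ext_prod ((congrFun g1 n).trans (LinearMap.comp_zero _).symm)
    ((congrFun g2 n).trans (LinearMap.comp_zero _).symm)

variable (M N)

lemma cofreeSign_prod : cofreeSign A.toBigradedSpace (M.toBigradedSpace.prod N.toBigradedSpace) =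
    strictMap K A.carrier (LinearMap.inl K _ _) ∘ₗ cofreeSign A.toBigradedSpace M.toBigradedSpace ∘ₗ
        strictMap K A.carrier (LinearMap.fst K _ _) +
      strictMap K A.carrier (LinearMap.inr K _ _) ∘ₗ
        cofreeSign A.toBigradedSpace N.toBigradedSpace ∘ₗ
        strictMap K A.carrier (LinearMap.snd K _ _) := by
  have hp : (M.toBigradedSpace.prod N.toBigradedSpace).parity =
      LinearMap.inl K _ _ ∘ₗ M.parity ∘ₗ LinearMap.fst K _ _ +
      LinearMap.inr K _ _ ∘ₗ N.parity ∘ₗ LinearMap.snd K _ _ := by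
    refine BigradedSpace.hom_ext _ fun i j m hm => ?_
    rw [BigradedSpace.parity_of_mem _ hm]
    have h1 : M.parity m.1 = (-1 : K) ^ i • m.1 := BigradedSpace.parity_of_mem _ hm.1
    have h2 : N.parity m.2 = (-1 : K) ^ i • m.2 := BigradedSpace.parity_of_mem _ hm.2
    ext <;> simp [h1, h2]
  refine TensorProduct.ext' fun x t => ?_
  simp only [cofreeSign, hp, LinearMap.add_apply, LinearMap.comp_apply, LinearMap.rTensor_tmul,
    TensorProduct.map_tmul, LinearMap.neg_apply, neg_add, add_tmul, map_neg]

/-- The module on `M ⊕ N` with codifferential `(x, y) ↦ (d_M x, φ x + d_N y)`, for a strictly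
unital series `φ` of comodule maps of bidegree `(1, 0)` with `d_N ∘ φ + φ ∘ d_M = 0`. -/
abbrev twist (φ : Ser K M.R N.R) (hφ : IsPreHom M N 1 φ) (h : N.d.comp φ + φ.comp M.d = 0) :
    TopMod e where
  toBigradedSpace := M.toBigradedSpace.prod N.toBigradedSpace
  d := twistD M N φ
  d_degree n := by
    have i1 := hasDegree_strictMap (A := A.toBigradedSpace) (M := M.toBigradedSpace)
      (N := M.toBigradedSpace.prod N.toBigradedSpace) (l := LinearMap.inl K _ _)
      (fun i j m hm => ⟨hm, Submodule.zero_mem _⟩)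
    have i2 := hasDegree_strictMap (A := A.toBigradedSpace) (M := N.toBigradedSpace)
      (N := M.toBigradedSpace.prod N.toBigradedSpace) (l := LinearMap.inr K _ _)
      (fun i j m hm => ⟨Submodule.zero_mem _, hm⟩)
    have p1 := hasDegree_strictMap (A := A.toBigradedSpace)
      (M := M.toBigradedSpace.prod N.toBigradedSpace) (N := M.toBigradedSpace)
      (l := LinearMap.fst K _ _) (fun i j m hm => hm.1)
    have p2 := hasDegree_strictMap (A := A.toBigradedSpace)
      (M := M.toBigradedSpace.prod N.toBigradedSpace) (N := N.toBigradedSpace)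
      (l := LinearMap.snd K _ _) (fun i j m hm => hm.2)
    have c1 := i1.comp ((M.d_degree n).comp p1 (zero_add 1)) (add_zero 1)
    have c2 := i2.comp ((hφ.degree n).comp p1 (zero_add 1)) (add_zero 1)
    have c3 := i2.comp ((N.d_degree n).comp p2 (zero_add 1)) (add_zero 1)
    exact fun i j x hx => add_mem (add_mem (c1 i j x hx) (c2 i j x hx)) (c3 i j x hx)
  d_coderivation n := by
    have hz : coact K A.carrier N.carrier ∘ₗ φ n = (TensorProduct.map (φ n) LinearMap.id +
        TensorProduct.map (0 : M.R →ₗ[K] N.R) (A.d n)) ∘ₗ coact K A.carrier M.carrier := by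
      rw [TensorProduct.map_zero_left, add_zero]
      exact hφ.comodule n
    have c1 := coderivation_sandwich (coact_strictMap (LinearMap.inl K M.carrier N.carrier))
      (coact_strictMap (LinearMap.fst K M.carrier N.carrier)) (M.d_coderivation n)
    have c2 := coderivation_sandwich (coact_strictMap (LinearMap.inr K M.carrier N.carrier))
      (coact_strictMap (LinearMap.fst K M.carrier N.carrier)) hz
    have c3 := coderivation_sandwich (coact_strictMap (LinearMap.inr K M.carrier N.carrier))
      (coact_strictMap (LinearMap.snd K M.carrier N.carrier)) (N.d_coderivation n)
    rw [cofreeSign_prod, twistD, LinearMap.comp_add, LinearMap.comp_add, c1, c2, c3,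
      ← LinearMap.add_comp, ← LinearMap.add_comp]
    congr 1
    refine TensorProduct.ext' fun x t => ?_
    simp only [LinearMap.add_apply, TensorProduct.map_tmul, add_tmul, LinearMap.zero_comp,
      LinearMap.comp_zero, LinearMap.zero_apply, zero_tmul]
    abel
  d_comp_d := twistD_comp φ h
  unit_act n m := by
    have h0 : toCogen K A.carrier N.carrier (φ n (m.1 ⊗ₜ TensorAlgebra.ι K e.one)) = 0 := by
      have := hφ.unital n m.1 1 1
      rwa [one_mul, mul_one] at this
    have h1 := BigradedSpace.parity_comp (M := M.toBigradedSpace.prod N.toBigradedSpace)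
      (N := M.toBigradedSpace) (l := LinearMap.fst K _ _) (fun i j m hm => hm.1)
    have h2 := BigradedSpace.parity_comp (M := M.toBigradedSpace.prod N.toBigradedSpace)
      (N := N.toBigradedSpace) (l := LinearMap.snd K _ _) (fun i j m hm => hm.2)
    have h1' := LinearMap.congr_fun h1 m
    have h2' := LinearMap.congr_fun h2 m
    simp only [LinearMap.comp_apply, LinearMap.fst_apply, LinearMap.snd_apply] at h1' h2'
    rw [toCogen_twistD, LinearMap.rTensor_tmul, LinearMap.rTensor_tmul, LinearMap.fst_apply,
      LinearMap.snd_apply, h0, M.unit_act, N.unit_act, zero_add]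
    split_ifs
    · exact Prod.ext h1' h2'
    · rfl
  unit_right n m a s t := by
    have h0 := hφ.unital n m.1 (TensorAlgebra.ι K a * s) t
    rw [toCogen_twistD, LinearMap.rTensor_tmul, LinearMap.rTensor_tmul, LinearMap.fst_apply,
      LinearMap.snd_apply, h0, M.unit_right, N.unit_right, zero_add]
    rfl
  unit_left n m a s t := by
    have h0 := hφ.unital n m.1 s (t * TensorAlgebra.ι K a)
    rw [← mul_assoc] at h0
    rw [toCogen_twistD, LinearMap.rTensor_tmul, LinearMap.rTensor_tmul, LinearMap.fst_apply,
      LinearMap.snd_apply, h0, M.unit_left, N.unit_left, zero_add]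
    rfl

end Twist

end TopMod

section Aux

variable {U V W X Y : Type u} [AddCommGroup U] [Module K U] [AddCommGroup V] [Module K V]
  [AddCommGroup W] [Module K W] [AddCommGroup X] [Module K X] [AddCommGroup Y] [Module K Y]

lemma Ser.anticomm_aux {d : Ser K V V} {d' : Ser K W W} {f : Ser K V W}
    (h : d'.comp f = f.comp d) : d'.comp f + f.comp ((-1 : K) ^ (1 : ℤ) • d) = 0 := by
  rw [Ser.comp_smul, h, zpow_one, neg_one_smul, add_neg_cancel]

lemma comp_comm_aux {D : W →ₗ[K] W} {D' : V →ₗ[K] V} {d : U →ₗ[K] U} {i : V →ₗ[K] W}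
    {j : U →ₗ[K] V} (h1 : D ∘ₗ i = i ∘ₗ D') (h2 : D' ∘ₗ j = j ∘ₗ d) :
    D ∘ₗ (i ∘ₗ j) = (i ∘ₗ j) ∘ₗ d := by
  rw [← LinearMap.comp_assoc, h1, LinearMap.comp_assoc, h2, LinearMap.comp_assoc]

lemma comp_add_aux {S : V →ₗ[K] W} {c : X →ₗ[K] V} {f : X →ₗ[K] W} {D : V →ₗ[K] V}
    {d : W →ₗ[K] W} {P : Y →ₗ[K] X} {Q T : Y →ₗ[K] V} (h1 : S ∘ₗ c = f) (h2 : S ∘ₗ D = d ∘ₗ S)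
    (h3 : T = c ∘ₗ P + D ∘ₗ Q) : f ∘ₗ P + d ∘ₗ S ∘ₗ Q = S ∘ₗ T := by
  rw [h3, LinearMap.comp_add, ← h1, LinearMap.comp_assoc, ← LinearMap.comp_assoc Q S d, ← h2,
    LinearMap.comp_assoc]

end Aux

namespace TopMod

variable {e : A.StrictUnit}

lemma IsPreHom.shiftSource {M N : TopMod e} {r : ℤ} {f : Ser K M.R N.R} (hf : IsPreHom M N r f)
    (a k : ℤ) (h : r + a = k) : IsPreHom (M.shiftObj a) N k f where
  comodule n := hf.comodule n
  degree n i j x hx := by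
    rw [cofreeGr_shift] at hx
    have := hf.degree n _ _ _ hx
    rwa [show i + a + r = i + k by omega] at this
  unital n := hf.unital n

/-- The direct sum `M ⊕ N`. -/
abbrev prod (M N : TopMod e) : TopMod e :=
  twist M N 0 (IsPreHom.zero M N 1) (by rw [Ser.comp_zero, Ser.zero_comp, add_zero])

/-- The cone `C(f) = M[1] ⊕ N`, with codifferential `(x, y) ↦ (-d_M x, f x + d_N y)`. -/
abbrev cone {M N : TopMod e} (f : M ⟶ N) : TopMod e :=
  twist (M.shiftObj 1) N f.ser (f.isPreHom.shiftSource 1 1 (zero_add 1)) (by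
    exact Ser.anticomm_aux f.comm)

/-- The map `M → M ⊕ N`, `m ↦ (-m, f m)`. -/
def cylMap {M N : TopMod e} (f : M ⟶ N) : Ser K M.R (M.prod N).R :=
  -(Ser.const (strictMap K A.carrier (LinearMap.inl K M.carrier N.carrier))) +
    (Ser.const (strictMap K A.carrier (LinearMap.inr K M.carrier N.carrier))).comp f.ser

lemma isPreHom_cylMap {M N : TopMod e} (f : M ⟶ N) : IsPreHom M (M.prod N) 0 (cylMap f) :=
  (IsPreHom.const (M := M) (N := M.prod N) (l := LinearMap.inl K M.carrier N.carrier)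
    (fun _ _ _ hm => ⟨hm, Submodule.zero_mem _⟩)).neg.add
  ((IsPreHom.const (M := N) (N := M.prod N) (l := LinearMap.inr K M.carrier N.carrier)
    (fun _ _ _ hm => ⟨Submodule.zero_mem _, hm⟩)).comp f.isPreHom (add_zero 0))

lemma twistD_inl {M N : TopMod e} (φ : Ser K M.R N.R) (n : ℕ) :
    twistD M N φ n ∘ₗ strictMap K A.carrier (LinearMap.inl K _ _) =
      strictMap K A.carrier (LinearMap.inl K _ _) ∘ₗ M.d n +
        strictMap K A.carrier (LinearMap.inr K _ _) ∘ₗ φ n := by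
  simp only [twistD, LinearMap.add_comp, LinearMap.comp_assoc, strictMap_comp,
    LinearMap.fst_comp_inl, LinearMap.snd_comp_inl]
  simp

lemma cylMap_comm {M N : TopMod e} (f : M ⟶ N) :
    (M.prod N).d.comp (cylMap f) = (cylMap f).comp M.d := by
  have h1 : (twistD M N 0).comp (Ser.const (strictMap K A.carrier (LinearMap.inl K _ _))) =
      (Ser.const (strictMap K A.carrier (LinearMap.inl K M.carrier N.carrier))).comp M.d := by
    rw [Ser.const_comp, Ser.comp_const]
    funext n
    rw [twistD_inl, Pi.zero_apply, LinearMap.comp_zero, add_zero]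
  have h2 : (twistD M N 0).comp (Ser.const (strictMap K A.carrier (LinearMap.inr K _ _))) =
      (Ser.const (strictMap K A.carrier (LinearMap.inr K M.carrier N.carrier))).comp N.d := by
    rw [Ser.const_comp, Ser.comp_const]
    funext n
    rw [twistD_inr]
  change (twistD M N 0).comp (cylMap f) = _
  rw [cylMap, Ser.comp_add, Ser.comp_neg, h1, ← Ser.comp_assoc, h2, Ser.comp_assoc, f.comm,
    Ser.add_comp, Ser.neg_comp, Ser.comp_assoc]

/-- The cylinder `Cyl(f) = M ⊕ M[1] ⊕ N`, with codifferential
`(m, m', n) ↦ (d_M m - m', -d_M m', f m' + d_N n)`. The underlying space is written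
`M[1] ⊕ (M ⊕ N)`, with elements `(m', (m, n))`. -/
abbrev cyl {M N : TopMod e} (f : M ⟶ N) : TopMod e :=
  twist (M.shiftObj 1) (M.prod N) (cylMap (M := M) f) ((isPreHom_cylMap f).shiftSource 1 1 (zero_add 1)) (by
    exact Ser.anticomm_aux (cylMap_comm f))

/-- The inclusion `N → C(f)`. -/
def coneIn {M N : TopMod e} (f : M ⟶ N) : N ⟶ cone f :=
  strictHom (LinearMap.inr K M.carrier N.carrier) (fun _ _ _ hm => ⟨Submodule.zero_mem _, hm⟩)
    (twistD_inr (M := M.shiftObj 1) f.ser)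

/-- The projection `C(f) → M[1]`. -/
def coneOut {M N : TopMod e} (f : M ⟶ N) : cone f ⟶ M.shiftObj 1 :=
  strictHom (LinearMap.fst K M.carrier N.carrier) (fun _ _ _ hm => hm.1)
    (fun n => (fst_twistD (M := M.shiftObj 1) f.ser n).symm)

/-- The inclusion `M → Cyl(f)`. -/
def cylIn {M N : TopMod e} (f : M ⟶ N) : M ⟶ cyl f :=
  strictHom (LinearMap.inr K M.carrier (M.carrier × N.carrier) ∘ₗ
      LinearMap.inl K M.carrier N.carrier)
    (fun _ _ _ hm => ⟨Submodule.zero_mem _, hm, Submodule.zero_mem _⟩)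
    (fun n => by
      have h1 := twistD_inr (M := M.shiftObj 1) (N := M.prod N) (cylMap (M := M) f) n
      have h2 := twistD_inl (M := M) (N := N) 0 n
      rw [Pi.zero_apply, LinearMap.comp_zero, add_zero] at h2
      rw [← strictMap_comp]
      exact comp_comm_aux h1 h2)

/-- The projection `Cyl(f) → C(f)`. -/
def cylOut {M N : TopMod e} (f : M ⟶ N) : cyl f ⟶ cone f :=
  strictHom ((LinearMap.id : M.carrier →ₗ[K] M.carrier).prodMap
      (LinearMap.snd K M.carrier N.carrier))
    (fun _ _ _ hm => ⟨hm.1, hm.2.2⟩)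
    (fun n => by
      have a1 := fst_twistD (M := M.shiftObj 1) (N := M.prod N) (cylMap (M := M) f) n
      have a2 := snd_twistD (M := M.shiftObj 1) (N := M.prod N) (cylMap (M := M) f) n
      have b1 := fst_twistD (M := M.shiftObj 1) (N := N) f.ser n
      have b2 := snd_twistD (M := M.shiftObj 1) (N := N) f.ser n
      have b3 := snd_twistD (M := M) (N := N) 0 n
      have c1 : strictMap K A.carrier (LinearMap.snd K M.carrier N.carrier) ∘ₗ cylMap f n =
          f.ser n := by
        rw [cylMap, Pi.add_apply, Ser.const_comp, LinearMap.comp_add, ← LinearMap.comp_assoc,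
          strictMap_comp, LinearMap.snd_comp_inr, Pi.neg_apply, Ser.const]
        split_ifs
        · rw [LinearMap.comp_neg, strictMap_comp, LinearMap.snd_comp_inl]; simp
        · simp
      have q1 : LinearMap.fst K M.carrier N.carrier ∘ₗ
          (LinearMap.id : M.carrier →ₗ[K] M.carrier).prodMap (LinearMap.snd K M.carrier N.carrier) =
          LinearMap.fst K M.carrier (M.carrier × N.carrier) := rfl
      have q2 : LinearMap.snd K M.carrier N.carrier ∘ₗ
          (LinearMap.id : M.carrier →ₗ[K] M.carrier).prodMap (LinearMap.snd K M.carrier N.carrier) =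
          LinearMap.snd K M.carrier N.carrier ∘ₗ
            LinearMap.snd K M.carrier (M.carrier × N.carrier) := rfl
      rw [Pi.zero_apply, LinearMap.zero_comp, zero_add] at b3
      apply ext_prod
      · rw [← LinearMap.comp_assoc, b1, LinearMap.comp_assoc, strictMap_comp, q1,
          ← LinearMap.comp_assoc, strictMap_comp, q1]
        exact a1.symm
      · rw [← LinearMap.comp_assoc, b2, LinearMap.add_comp, LinearMap.comp_assoc, strictMap_comp,
          LinearMap.comp_assoc, strictMap_comp, q1, q2, ← LinearMap.comp_assoc, strictMap_comp, q2,
          ← strictMap_comp, LinearMap.comp_assoc]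
        exact comp_add_aux c1 b3 a2)

/-- The sequence `M → N → C(f) → M[1]`. -/
def coneTriangle {M N : TopMod e} (f : M ⟶ N) : Pretriangulated.Triangle (TopMod e) :=
  Pretriangulated.Triangle.mk f (coneIn f) (coneOut f)

/-- The sequence `M → Cyl(f) → C(f) → M[1]`. -/
def cylTriangle {M N : TopMod e} (f : M ⟶ N) : Pretriangulated.Triangle (TopMod e) :=
  Pretriangulated.Triangle.mk (cylIn f) (cylOut f) (coneOut f)

/-! ### Semi-split sequences -/

/-- The Taylor component `m ↦ f̄ⁿ(m | a₁, …, aₙ)` of `f`, for `w = a₁ ⊗ ⋯ ⊗ aₙ`. -/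
def taylor {M N : TopMod e} (f : Ser K M.R N.R) (w : TensorAlgebra K A.carrier) :
    Ser K M.carrier N.carrier :=
  fun n => toCogen K A.carrier N.carrier ∘ₗ f n ∘ₗ
    (TensorProduct.mk K M.carrier (TensorAlgebra K A.carrier)).flip w

/-- `f` is strict: its Taylor components `f̄ⁿ`, `n ≥ 1`, vanish. -/
def IsStrict {M N : TopMod e} (f : M ⟶ N) : Prop :=
  ∀ a t, taylor f.ser (TensorAlgebra.ι K a * t) = 0

/-- `M → M' → M''` is a semi-split sequence of strict morphisms, with splitting `ρ`: it is short
exact in every bidegree, and `ρ` is a `K⟦ħ⟧`-linear map `M' → M` of bidegree `(0, 0)`, regarded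
as a strict map, with `ρ ∘ f = 1` and `ρ ∘ d̄ⁿ = d̄ⁿ ∘ (ρ ⊗ 1)` for `n ≥ 1`. -/
structure IsSemiSplit {M M' M'' : TopMod e} (f : M ⟶ M') (g : M' ⟶ M'')
    (ρ : Ser K M'.carrier M.carrier) : Prop where
  strict_left : IsStrict f
  strict_right : IsStrict g
  injective : ∀ i j, ∀ x ∈ M.seriesGr i j, (taylor f.ser 1).eval x = 0 → x = 0
  exact : ∀ i j, ∀ y ∈ M'.seriesGr i j, (taylor g.ser 1).eval y = 0 ↔
    ∃ x ∈ M.seriesGr i j, (taylor f.ser 1).eval x = y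
  surjective : ∀ i j, ∀ z ∈ M''.seriesGr i j, ∃ y ∈ M'.seriesGr i j, (taylor g.ser 1).eval y = z
  degree : ∀ n i j, ∀ y ∈ M'.gr i j, ρ n y ∈ M.gr i j
  retraction : ρ.comp (taylor f.ser 1) = Ser.const LinearMap.id
  compatible : ∀ a t, ρ.comp (taylor M'.d (TensorAlgebra.ι K a * t)) =
    (taylor M.d (TensorAlgebra.ι K a * t)).comp ρ

/-- `h : M'' → M[1]` is the connecting morphism of a semi-split sequence `M → M' → M''` with
splitting `ρ`: `h ∘ g = d_M ∘ P - P ∘ d_M'` with `P = ρ ⊗ 1`. In other words, the codifferential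
of `M' = M ⊕ M''` is `(x, z) ↦ (d_M x - h z, d_M'' z)`. -/
def IsConnecting {M M' M'' : TopMod e} (g : M' ⟶ M'') (ρ : Ser K M'.carrier M.carrier)
    (h : M'' ⟶ M.shiftObj 1) : Prop :=
  (h.ser.comp g.ser : Ser K M'.R M.R) =
    M.d.comp (fun n => strictMap K A.carrier (ρ n)) -
      Ser.comp (fun n => strictMap K A.carrier (ρ n)) M'.d

/-! ### Quasi-isomorphisms -/

/-- `f` is a quasi-isomorphism: `f⁰` induces in every bidegree a bijection between the
cohomology of `M` and that of `N` with respect to the differentials `d⁰`. -/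
structure IsQuasiIso {M N : TopMod e} (f : M ⟶ N) : Prop where
  injective : ∀ i j, ∀ x ∈ M.seriesGr i j, (taylor M.d 1).eval x = 0 →
    (∃ y ∈ N.seriesGr (i - 1) j, (taylor N.d 1).eval y = (taylor f.ser 1).eval x) →
      ∃ x' ∈ M.seriesGr (i - 1) j, (taylor M.d 1).eval x' = x
  surjective : ∀ i j, ∀ y ∈ N.seriesGr i j, (taylor N.d 1).eval y = 0 →
    ∃ x ∈ M.seriesGr i j, (taylor M.d 1).eval x = 0 ∧
      ∃ y' ∈ N.seriesGr (i - 1) j, y = (taylor f.ser 1).eval x + (taylor N.d 1).eval y'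

end TopMod

section

variable (e : A.StrictUnit)

/-- The triangles in the homotopy category which are isomorphic to a triangle
`M → M' → M'' → M[1]` coming from a semi-split sequence of strict morphisms. -/
def semiSplitTriangles : Set (Pretriangulated.Triangle (HoCat e)) :=
  {T | ∃ (M M' M'' : TopMod e) (f : M ⟶ M') (g : M' ⟶ M'') (ρ : Ser K M'.carrier M.carrier)
    (h : M'' ⟶ M.shiftObj 1), TopMod.IsSemiSplit f g ρ ∧ TopMod.IsConnecting g ρ h ∧
      Nonempty (T ≅ (hoFunctor e).mapTriangle.obj (Pretriangulated.Triangle.mk f g h))}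

/-- The class of quasi-isomorphisms in the homotopy category. -/
def qis : MorphismProperty (HoCat e) := fun X Y φ =>
  ∃ f : X.as ⟶ Y.as, (hoFunctor e).map f = φ ∧ TopMod.IsQuasiIso f

end

end

end TopAInf

open CategoryTheory.Pretriangulated TopAInf

/-!
A semi-split sequence `M → M' → M''` splits as a sequence of cofree comodules, and the
codifferential of `M' = M ⊕ M''` is triangular, its off-diagonal entry being `-h` for the connecting
morphism `h`. The map `C(f) → M''` induced by `g` is then a homotopy equivalence compatible with the
connecting morphisms, so every semi-split triangle is isomorphic to the triangle of a mapping cone.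
Conversely the cone triangle of `f` comes from the semi-split sequence of the cylinder of `f`, which
is homotopy equivalent to the target of `f`.

The axioms can therefore be checked on mapping cones, by explicit matrices. Rotating a cone triangle
gives the triangle of the split sequence `N → C(f) → M[1]`; inverse rotation is a double rotation
followed by the shift by `-1`; a square which commutes up to homotopy induces a map of cones; and
the octahedral axiom amounts to an explicit homotopy equivalence between `C(g)` and the cone of
`C(f) → C(f ≫ g)`.

By flatness `f⁰` is a chain map for `d⁰`, and `f` is a quasi-isomorphism if and only if `C(f)` is
acyclic. The acyclic modules form a triangulated subcategory of the homotopy category, so Verdier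
localization applies to the quasi-isomorphisms.
-/

namespace TopAInf

noncomputable section

open BigradedSpace

/-! ### Matrix calculus for series of comodule maps -/

namespace Ser

section General

variable {K : Type u} [Field K] {U V W X : Type u} [AddCommGroup U] [Module K U]
  [AddCommGroup V] [Module K V] [AddCommGroup W] [Module K W] [AddCommGroup X] [Module K X]

lemma comp_eq_assoc {g : Ser K V W} {f : Ser K U V} {k : Ser K U W} (h : g.comp f = k)
    (x : Ser K X U) : g.comp (f.comp x) = k.comp x := by
  rw [← Ser.comp_assoc, h]

lemma const_comp_const (l : V →ₗ[K] W) (l' : U →ₗ[K] V) :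
    (Ser.const l).comp (Ser.const l') = Ser.const (l ∘ₗ l') := by
  rw [Ser.const_comp]
  funext n
  simp only [Ser.const]
  split_ifs <;> simp

lemma const_zero : Ser.const (0 : V →ₗ[K] W) = 0 := by
  funext n
  simp [Ser.const]

lemma const_add (l l' : V →ₗ[K] W) : Ser.const (l + l') = Ser.const l + Ser.const l' := by
  funext n
  simp only [Ser.const, Pi.add_apply]
  split_ifs <;> simp

end General

section Sum

variable (K : Type u) [Field K] (B U V : Type u) [AddCommGroup B] [Module K B]
  [AddCommGroup U] [Module K U] [AddCommGroup V] [Module K V]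

/-- The first inclusion `U ⊗ T(B) → (U × V) ⊗ T(B)`, as a constant series. -/
def inl : Ser K (Cof K B U) (Cof K B (U × V)) := Ser.const (strictMap K B (LinearMap.inl K U V))

/-- The second inclusion `V ⊗ T(B) → (U × V) ⊗ T(B)`, as a constant series. -/
def inr : Ser K (Cof K B V) (Cof K B (U × V)) := Ser.const (strictMap K B (LinearMap.inr K U V))

/-- The first projection `(U × V) ⊗ T(B) → U ⊗ T(B)`, as a constant series. -/
def fst : Ser K (Cof K B (U × V)) (Cof K B U) := Ser.const (strictMap K B (LinearMap.fst K U V))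

/-- The second projection `(U × V) ⊗ T(B) → V ⊗ T(B)`, as a constant series. -/
def snd : Ser K (Cof K B (U × V)) (Cof K B V) := Ser.const (strictMap K B (LinearMap.snd K U V))

lemma fst_inl : (fst K B U V).comp (inl K B U V) = Ser.const LinearMap.id := by
  rw [fst, inl, const_comp_const, TopMod.strictMap_comp, LinearMap.fst_comp_inl, strictMap,
    LinearMap.rTensor_id]

lemma fst_inr : (fst K B U V).comp (inr K B U V) = 0 := by
  rw [fst, inr, const_comp_const, TopMod.strictMap_comp, LinearMap.fst_comp_inr, strictMap,
    LinearMap.rTensor_zero, const_zero]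

lemma snd_inl : (snd K B U V).comp (inl K B U V) = 0 := by
  rw [snd, inl, const_comp_const, TopMod.strictMap_comp, LinearMap.snd_comp_inl, strictMap,
    LinearMap.rTensor_zero, const_zero]

lemma snd_inr : (snd K B U V).comp (inr K B U V) = Ser.const LinearMap.id := by
  rw [snd, inr, const_comp_const, TopMod.strictMap_comp, LinearMap.snd_comp_inr, strictMap,
    LinearMap.rTensor_id]

lemma inl_fst_add_inr_snd :
    (inl K B U V).comp (fst K B U V) + (inr K B U V).comp (snd K B U V) =
      Ser.const LinearMap.id := by
  rw [inl, inr, fst, snd, const_comp_const, const_comp_const, TopMod.strictMap_comp,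
    TopMod.strictMap_comp, ← const_add, ← LinearMap.rTensor_add, ← LinearMap.rTensor_id]
  congr 2
  ext <;> simp

variable {K B U V} {X Y : Type u} [AddCommGroup X] [Module K X] [AddCommGroup Y] [Module K Y]

lemma fst_inl_assoc (x : Ser K X (Cof K B U)) :
    (fst K B U V).comp ((inl K B U V).comp x) = x := by
  rw [comp_eq_assoc (fst_inl K B U V), Ser.id_comp]

lemma fst_inr_assoc (x : Ser K X (Cof K B V)) : (fst K B U V).comp ((inr K B U V).comp x) = 0 := by
  rw [comp_eq_assoc (fst_inr K B U V), Ser.zero_comp]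

lemma snd_inl_assoc (x : Ser K X (Cof K B U)) : (snd K B U V).comp ((inl K B U V).comp x) = 0 := by
  rw [comp_eq_assoc (snd_inl K B U V), Ser.zero_comp]

lemma snd_inr_assoc (x : Ser K X (Cof K B V)) : (snd K B U V).comp ((inr K B U V).comp x) = x := by
  rw [comp_eq_assoc (snd_inr K B U V), Ser.id_comp]

lemma prod_ext {f g : Ser K X (Cof K B (U × V))}
    (h₁ : (fst K B U V).comp f = (fst K B U V).comp g)
    (h₂ : (snd K B U V).comp f = (snd K B U V).comp g) : f = g := by
  rw [← Ser.id_comp f, ← Ser.id_comp g, ← inl_fst_add_inr_snd, Ser.add_comp, Ser.add_comp,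
    Ser.comp_assoc, Ser.comp_assoc, Ser.comp_assoc, Ser.comp_assoc, h₁, h₂]

lemma coprod_ext {f g : Ser K (Cof K B (U × V)) X}
    (h₁ : f.comp (inl K B U V) = g.comp (inl K B U V))
    (h₂ : f.comp (inr K B U V) = g.comp (inr K B U V)) : f = g := by
  rw [← Ser.comp_id f, ← Ser.comp_id g, ← inl_fst_add_inr_snd, Ser.comp_add, Ser.comp_add,
    ← Ser.comp_assoc, ← Ser.comp_assoc, ← Ser.comp_assoc, ← Ser.comp_assoc, h₁, h₂]

/-- The series `x ↦ (a x, b x)`. -/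
def lift (a : Ser K X (Cof K B U)) (b : Ser K X (Cof K B V)) : Ser K X (Cof K B (U × V)) :=
  (inl K B U V).comp a + (inr K B U V).comp b

/-- The series `(x, y) ↦ a x + b y`. -/
def desc (a : Ser K (Cof K B U) X) (b : Ser K (Cof K B V) X) : Ser K (Cof K B (U × V)) X :=
  a.comp (fst K B U V) + b.comp (snd K B U V)

/-- The series `(x, y) ↦ (d x, φ x + d' y)` on a direct sum. -/
def twisted (d : Ser K (Cof K B U) (Cof K B U)) (φ : Ser K (Cof K B U) (Cof K B V))
    (d' : Ser K (Cof K B V) (Cof K B V)) : Ser K (Cof K B (U × V)) (Cof K B (U × V)) :=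
  lift (d.comp (fst K B U V)) (desc φ d')

variable (a : Ser K X (Cof K B U)) (b : Ser K X (Cof K B V)) (a' : Ser K (Cof K B U) X)
  (b' : Ser K (Cof K B V) X) (d : Ser K (Cof K B U) (Cof K B U))
  (φ : Ser K (Cof K B U) (Cof K B V)) (d' : Ser K (Cof K B V) (Cof K B V))

lemma fst_lift : (fst K B U V).comp (lift a b) = a := by
  rw [lift, Ser.comp_add, fst_inl_assoc, fst_inr_assoc, add_zero]

lemma snd_lift : (snd K B U V).comp (lift a b) = b := by
  rw [lift, Ser.comp_add, snd_inl_assoc, snd_inr_assoc, zero_add]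

lemma fst_lift_assoc (x : Ser K Y X) : (fst K B U V).comp ((lift a b).comp x) = a.comp x :=
  comp_eq_assoc (fst_lift a b) x

lemma snd_lift_assoc (x : Ser K Y X) : (snd K B U V).comp ((lift a b).comp x) = b.comp x :=
  comp_eq_assoc (snd_lift a b) x

lemma lift_comp (x : Ser K Y X) : (lift a b).comp x = lift (a.comp x) (b.comp x) := by
  rw [lift, lift, Ser.add_comp, Ser.comp_assoc, Ser.comp_assoc]

lemma desc_inl : (desc a' b').comp (inl K B U V) = a' := by
  rw [desc, Ser.add_comp, Ser.comp_assoc, Ser.comp_assoc, fst_inl, snd_inl, Ser.comp_id,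
    Ser.comp_zero, add_zero]

lemma desc_inr : (desc a' b').comp (inr K B U V) = b' := by
  rw [desc, Ser.add_comp, Ser.comp_assoc, Ser.comp_assoc, fst_inr, snd_inr, Ser.comp_id,
    Ser.comp_zero, zero_add]

lemma desc_inl_assoc (x : Ser K Y (Cof K B U)) :
    (desc a' b').comp ((inl K B U V).comp x) = a'.comp x :=
  comp_eq_assoc (desc_inl a' b') x

lemma desc_inr_assoc (x : Ser K Y (Cof K B V)) :
    (desc a' b').comp ((inr K B U V).comp x) = b'.comp x :=
  comp_eq_assoc (desc_inr a' b') x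

lemma desc_comp_lift (p : Ser K (Cof K B U) Y) (q : Ser K (Cof K B V) Y) :
    (desc p q).comp (lift a b) = p.comp a + q.comp b := by
  rw [desc, Ser.add_comp, Ser.comp_assoc, Ser.comp_assoc, fst_lift, snd_lift]

lemma fst_twisted : (fst K B U V).comp (twisted d φ d') = d.comp (fst K B U V) :=
  fst_lift _ _

lemma snd_twisted : (snd K B U V).comp (twisted d φ d') =
    φ.comp (fst K B U V) + d'.comp (snd K B U V) :=
  snd_lift _ _

lemma twisted_inl : (twisted d φ d').comp (inl K B U V) = lift d φ := by
  rw [twisted, lift_comp, Ser.comp_assoc, fst_inl, Ser.comp_id, desc_inl]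

lemma twisted_inr : (twisted d φ d').comp (inr K B U V) = (inr K B U V).comp d' := by
  rw [twisted, lift_comp, Ser.comp_assoc, fst_inr, Ser.comp_zero, desc_inr, lift, Ser.comp_zero,
    zero_add]

lemma fst_twisted_assoc (x : Ser K Y (Cof K B (U × V))) :
    (fst K B U V).comp ((twisted d φ d').comp x) = d.comp ((fst K B U V).comp x) := by
  rw [comp_eq_assoc (fst_twisted d φ d'), Ser.comp_assoc]

lemma snd_twisted_assoc (x : Ser K Y (Cof K B (U × V))) :
    (snd K B U V).comp ((twisted d φ d').comp x) =
      φ.comp ((fst K B U V).comp x) + d'.comp ((snd K B U V).comp x) := by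
  rw [comp_eq_assoc (snd_twisted d φ d'), Ser.add_comp, Ser.comp_assoc, Ser.comp_assoc]

lemma twisted_inl_assoc (x : Ser K Y (Cof K B U)) :
    (twisted d φ d').comp ((inl K B U V).comp x) = lift (d.comp x) (φ.comp x) := by
  rw [comp_eq_assoc (twisted_inl d φ d'), lift_comp]

lemma twisted_inr_assoc (x : Ser K Y (Cof K B V)) :
    (twisted d φ d').comp ((inr K B U V).comp x) = (inr K B U V).comp (d'.comp x) := by
  rw [comp_eq_assoc (twisted_inr d φ d'), Ser.comp_assoc]

end Sum

end Ser

attribute [local simp] Ser.comp_assoc Ser.add_comp Ser.comp_add Ser.sub_comp Ser.comp_sub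
  Ser.neg_comp Ser.comp_neg Ser.zero_comp Ser.comp_zero Ser.id_comp Ser.comp_id
  Ser.fst_inl Ser.fst_inr Ser.snd_inl Ser.snd_inr Ser.fst_inl_assoc Ser.fst_inr_assoc
  Ser.snd_inl_assoc Ser.snd_inr_assoc Ser.fst_lift Ser.snd_lift Ser.fst_lift_assoc
  Ser.snd_lift_assoc Ser.desc_inl Ser.desc_inr Ser.desc_inl_assoc Ser.desc_inr_assoc
  Ser.desc_comp_lift Ser.fst_twisted Ser.snd_twisted Ser.twisted_inl Ser.twisted_inr
  Ser.fst_twisted_assoc Ser.snd_twisted_assoc Ser.twisted_inl_assoc Ser.twisted_inr_assoc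

namespace Ser

section Cone

variable {K : Type u} [Field K] {B U V X : Type u} [AddCommGroup B] [Module K B]
  [AddCommGroup U] [Module K U] [AddCommGroup V] [Module K V] [AddCommGroup X] [Module K X]
  {dU : Ser K (Cof K B U) (Cof K B U)} {dV : Ser K (Cof K B V) (Cof K B V)}
  {f : Ser K (Cof K B U) (Cof K B V)} {dX : Ser K X X}

lemma twisted_comp_lift {a : Ser K X (Cof K B U)} {b : Ser K X (Cof K B V)}
    (ha : dU.comp a + a.comp dX = 0) (hb : f.comp a + dV.comp b = b.comp dX) :
    (twisted (-dU) f dV).comp (lift a b) = (lift a b).comp dX := by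
  apply prod_ext
  · simpa using (eq_neg_of_add_eq_zero_right ha).symm
  · simpa using hb

lemma comp_desc_eq_desc_comp_twisted {a : Ser K (Cof K B U) X} {b : Ser K (Cof K B V) X}
    (ha : dX.comp a + a.comp dU = b.comp f) (hb : dX.comp b = b.comp dV) :
    dX.comp (desc a b) = (desc a b).comp (twisted (-dU) f dV) := by
  apply coprod_ext
  · simp [← ha]
  · simpa using hb

end Cone

section Split

variable {K : Type u} [Field K] {X Y Z : Type u} [AddCommGroup X] [Module K X]
  [AddCommGroup Y] [Module K Y] [AddCommGroup Z] [Module K Z]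

/-- The sequence `X → Y → Z` is split exact, with retraction `ρ : Y → X` and section
`σ : Z → Y`. -/
structure IsSplitting (f : Ser K X Y) (g : Ser K Y Z) (ρ : Ser K Y X) (σ : Ser K Z Y) :
    Prop where
  retraction : ρ.comp f = Ser.const LinearMap.id
  sect : g.comp σ = Ser.const LinearMap.id
  total : f.comp ρ + σ.comp g = Ser.const LinearMap.id

namespace IsSplitting

variable {f : Ser K X Y} {g : Ser K Y Z} {ρ : Ser K Y X} {σ : Ser K Z Y}
  (H : IsSplitting f g ρ σ)

include H

lemma comp_eq_zero : g.comp f = 0 := by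
  have h := congrArg (fun x => (g.comp x).comp f) H.total
  simpa [H.retraction, comp_eq_assoc H.sect] using h

lemma retraction_comp_section : ρ.comp σ = 0 := by
  have h := congrArg (fun x => (ρ.comp x).comp σ) H.total
  simpa [H.sect, comp_eq_assoc H.retraction] using h

lemma eq_of_comp_eq {W : Type u} [AddCommGroup W] [Module K W] {h h' : Ser K Z W}
    (hg : h.comp g = h'.comp g) : h = h' := by
  rw [← Ser.comp_id h, ← Ser.comp_id h', ← H.sect, ← Ser.comp_assoc, hg, Ser.comp_assoc]

lemma comp_section_comp {W : Type u} [AddCommGroup W] [Module K W] {k : Ser K Y W}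
    (hk : k.comp f = 0) : (k.comp σ).comp g = k := by
  have h := congrArg k.comp H.total
  simpa [comp_eq_assoc hk] using h

variable {dX : Ser K X X} {dY : Ser K Y Y} {dZ : Ser K Z Z} {h : Ser K Z X}

lemma comp_connecting_add_comp_section (hg : dZ.comp g = g.comp dY)
    (hh : h.comp g = dX.comp ρ - ρ.comp dY) : f.comp h + dY.comp σ = σ.comp dZ := by
  have h_eq : h = -ρ.comp (dY.comp σ) := by
    rw [← Ser.comp_id h, ← H.sect, ← Ser.comp_assoc, hh]
    simp [H.retraction_comp_section]
  have section_comp : σ.comp dZ = σ.comp (g.comp (dY.comp σ)) := by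
    rw [← Ser.comp_assoc g, ← hg, Ser.comp_assoc, H.sect, Ser.comp_id]
  have decomposition := congrArg (fun x => x.comp (dY.comp σ)) H.total
  simp only [Ser.add_comp, Ser.comp_assoc, Ser.id_comp] at decomposition
  rw [section_comp, h_eq, Ser.comp_neg, neg_add_eq_iff_eq_add, decomposition]

end IsSplitting

lemma cone_homotopy_of_isSplitting {B U V : Type u} [AddCommGroup B] [Module K B]
    [AddCommGroup U] [Module K U] [AddCommGroup V] [Module K V]
    {f : Ser K (Cof K B U) (Cof K B V)} {g : Ser K (Cof K B V) Z}
    {ρ : Ser K (Cof K B V) (Cof K B U)} {σ : Ser K Z (Cof K B V)} (H : IsSplitting f g ρ σ)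
    {h : Ser K Z (Cof K B U)} {dU : Ser K (Cof K B U) (Cof K B U)}
    {dV : Ser K (Cof K B V) (Cof K B V)} (hh : h.comp g = dU.comp ρ - ρ.comp dV) :
    Ser.const LinearMap.id - (lift h σ).comp (desc 0 g) =
      (twisted (-dU) f dV).comp ((inl K B U V).comp (ρ.comp (snd K B U V))) +
        ((inl K B U V).comp (ρ.comp (snd K B U V))).comp (twisted (-dU) f dV) := by
  have ht : Ser.const LinearMap.id - σ.comp g = f.comp ρ := by
    rw [← H.total, add_sub_cancel_right]
  apply prod_ext <;> apply coprod_ext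
  · simp [H.retraction]
  · simp [hh, sub_eq_neg_add]
  · simp
  · simp [ht]

end Split

end Ser

variable {K : Type u} [Field K] {A : TopAInfAlg K} {e : A.StrictUnit}

namespace TopMod

lemma twistD_eq_twisted (M N : TopMod e) (φ : Ser K M.R N.R) :
    twistD M N φ = Ser.twisted M.d φ N.d := by
  simp only [Ser.twisted, Ser.lift, Ser.desc, Ser.inl, Ser.inr, Ser.fst, Ser.snd, Ser.const_comp,
    Ser.comp_const, Ser.comp_add, ← add_assoc]
  rfl

lemma shiftObj_one_d (M : TopMod e) : (M.shiftObj 1).d = (-M.d : Ser K M.R M.R) := by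
  change (-1 : K) ^ (1 : ℤ) • M.d = -M.d
  rw [zpow_one]
  exact neg_one_smul K M.d

lemma cone_d {M N : TopMod e} (f : M ⟶ N) : (cone f).d = Ser.twisted (-M.d) f.ser N.d := by
  change twistD (M.shiftObj 1) N f.ser = _
  rw [twistD_eq_twisted, shiftObj_one_d]

lemma isPreHom_shift_source {M N : TopMod e} {f : Ser K M.R N.R} {a k r : ℤ} (h : r + a = k) :
    IsPreHom (M.shiftObj a) N k f ↔ IsPreHom M N r f := by
  refine ⟨fun hf => ⟨hf.comodule, fun n i j x hx => ?_, hf.unital⟩,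
    fun hf => hf.shiftSource a k h⟩
  have := hf.degree n (i - a) j x (by rw [cofreeGr_shift]; simpa using hx)
  rwa [show i - a + k = i + r by omega] at this

lemma isPreHom_shift_target {M N : TopMod e} {f : Ser K M.R N.R} {a k r : ℤ} (h : k + a = r) :
    IsPreHom M (N.shiftObj a) k f ↔ IsPreHom M N r f := by
  have key : ∀ i, i + k + a = i + r := fun i => by omega
  refine ⟨fun hf => ⟨hf.comodule, fun n i j x hx => ?_, hf.unital⟩,
    fun hf => ⟨hf.comodule, fun n i j x hx => ?_, hf.unital⟩⟩
  · have := hf.degree n i j x hx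
    rwa [cofreeGr_shift, key] at this
  · rw [cofreeGr_shift, key]
    exact hf.degree n i j x hx

section Twist

variable (M N : TopMod e) (φ : Ser K M.R N.R) (hφ : IsPreHom M N 1 φ)
  (h : N.d.comp φ + φ.comp M.d = 0)

lemma isPreHom_inl :
    IsPreHom M (twist M N φ hφ h) 0 (Ser.inl K A.carrier M.carrier N.carrier) :=
  IsPreHom.const (M := M) (N := twist M N φ hφ h) (fun _ _ _ hm => ⟨hm, Submodule.zero_mem _⟩)

lemma isPreHom_inr :
    IsPreHom N (twist M N φ hφ h) 0 (Ser.inr K A.carrier M.carrier N.carrier) :=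
  IsPreHom.const (M := N) (N := twist M N φ hφ h) (fun _ _ _ hm => ⟨Submodule.zero_mem _, hm⟩)

lemma isPreHom_fst :
    IsPreHom (twist M N φ hφ h) M 0 (Ser.fst K A.carrier M.carrier N.carrier) :=
  IsPreHom.const (M := twist M N φ hφ h) (N := M) (fun _ _ _ hm => hm.1)

lemma isPreHom_snd :
    IsPreHom (twist M N φ hφ h) N 0 (Ser.snd K A.carrier M.carrier N.carrier) :=
  IsPreHom.const (M := twist M N φ hφ h) (N := N) (fun _ _ _ hm => hm.2)

end Twist

section Cone

variable {M N : TopMod e} (f : M ⟶ N)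

lemma isPreHom_cone_inl : IsPreHom M (cone f) (-1) (Ser.inl K A.carrier M.carrier N.carrier) :=
  (isPreHom_shift_source (M := M) (a := 1) (by omega)).1 (isPreHom_inl (M.shiftObj 1) N _ _ _)

lemma isPreHom_cone_inr : IsPreHom N (cone f) 0 (Ser.inr K A.carrier M.carrier N.carrier) :=
  isPreHom_inr (M.shiftObj 1) N _ _ _

lemma isPreHom_cone_fst : IsPreHom (cone f) M 1 (Ser.fst K A.carrier M.carrier N.carrier) :=
  (isPreHom_shift_target (N := M) (a := 1) (by omega)).1 (isPreHom_fst (M.shiftObj 1) N _ _ _)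

lemma isPreHom_cone_snd : IsPreHom (cone f) N 0 (Ser.snd K A.carrier M.carrier N.carrier) :=
  isPreHom_snd (M.shiftObj 1) N _ _ _

end Cone

/-- The morphism `x ↦ (a x, b x)` to a cone. -/
def coneLift {X M N : TopMod e} (f : M ⟶ N) {a : Ser K X.R M.R} {b : Ser K X.R N.R}
    (ha : IsPreHom X M 1 a) (hb : IsPreHom X N 0 b) (h₁ : M.d.comp a + a.comp X.d = 0)
    (h₂ : f.ser.comp a + N.d.comp b = b.comp X.d) : X ⟶ cone f where
  ser := Ser.lift a b
  isPreHom := ((isPreHom_cone_inl f).comp ha (by omega)).add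
    ((isPreHom_cone_inr f).comp hb (by omega))
  comm := by
    rw [cone_d]
    exact Ser.twisted_comp_lift h₁ h₂

/-- The morphism `(x, y) ↦ a x + b y` from a cone. -/
def coneDesc {X M N : TopMod e} (f : M ⟶ N) {a : Ser K M.R X.R} (b : N ⟶ X)
    (ha : IsPreHom M X (-1) a) (h : X.d.comp a + a.comp M.d = b.ser.comp f.ser) : cone f ⟶ X where
  ser := Ser.desc a b.ser
  isPreHom := (ha.comp (isPreHom_cone_fst f) (by omega)).add
    (b.isPreHom.comp (isPreHom_cone_snd f) (by omega))
  comm := by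
    rw [cone_d]
    exact Ser.comp_desc_eq_desc_comp_twisted h b.comm

lemma comm_shift_one {M N : TopMod e} (h : N ⟶ M.shiftObj 1) :
    (M.d.comp h.ser + Ser.comp (h.ser : Ser K N.R M.R) N.d : Ser K N.R M.R) = 0 := by
  have comm := h.comm
  rw [shiftObj_one_d] at comm
  rw [← show (Ser.comp (-M.d) (h.ser : Ser K N.R M.R) : Ser K N.R M.R) =
    Ser.comp (h.ser : Ser K N.R M.R) N.d from comm, Ser.neg_comp, add_neg_cancel]

lemma isPreHom_of_shift_one {M N : TopMod e} (h : N ⟶ M.shiftObj 1) :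
    IsPreHom N M 1 (h.ser : Ser K N.R M.R) :=
  (isPreHom_shift_target (by omega)).1 h.isPreHom

/-- The morphism `N → M[1]` given by a pre-morphism of degree `1` which anticommutes with the
codifferentials. -/
def homShiftOne {M N : TopMod e} {h : Ser K N.R M.R} (hh : IsPreHom N M 1 h)
    (comm : M.d.comp h + h.comp N.d = 0) : N ⟶ M.shiftObj 1 where
  ser := h
  isPreHom := (isPreHom_shift_target (by omega)).2 hh
  comm := by
    rw [shiftObj_one_d]
    change (Ser.comp (-M.d) h : Ser K N.R M.R) = h.comp N.d
    rw [Ser.neg_comp, eq_neg_of_add_eq_zero_left comm, neg_neg]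

lemma existsUnique_connecting_of_isSplitting {M M' M'' : TopMod e} {f : M ⟶ M'} {g : M' ⟶ M''}
    {ρ : Ser K M'.R M.R} {σ : Ser K M''.R M'.R} (H : Ser.IsSplitting f.ser g.ser ρ σ)
    (hσ : IsPreHom M'' M' 0 σ) (hδ : IsPreHom M' M 1 (M.d.comp ρ - ρ.comp M'.d)) :
    ∃! h : M'' ⟶ M.shiftObj 1,
      (h.ser.comp g.ser : Ser K M'.R M.R) = M.d.comp ρ - ρ.comp M'.d := by
  set δ := M.d.comp ρ - ρ.comp M'.d with hδ_def
  have hδf : δ.comp f.ser = 0 := by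
    rw [hδ_def, Ser.sub_comp, Ser.comp_assoc, Ser.comp_assoc, H.retraction, f.comm,
      Ser.comp_eq_assoc H.retraction, Ser.comp_id, Ser.id_comp, sub_self]
  have hδg : (δ.comp σ).comp g.ser = δ := H.comp_section_comp hδf
  have anticomm : M.d.comp (δ.comp σ) + (δ.comp σ).comp M''.d = 0 := H.eq_of_comp_eq <| by
    rw [Ser.add_comp, Ser.comp_assoc, hδg, Ser.comp_assoc (δ.comp σ), g.comm, ← Ser.comp_assoc,
      hδg, Ser.zero_comp, hδ_def]
    simp [M'.d_comp_d, Ser.comp_eq_assoc M.d_comp_d]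
  exact ⟨homShiftOne (hδ.comp hσ (by omega)) anticomm, hδg,
    fun h hh => hom_ext (H.eq_of_comp_eq (hh.trans hδg.symm))⟩

/-! ### Cone triangles in the homotopy category -/

section HomotopyCategory

lemma hoFunctor_map_eq {M N : TopMod e} {f g : M ⟶ N} {H : Ser K M.R N.R}
    (hH : IsPreHom M N (-1) H) (h : f.ser - g.ser = N.d.comp H + H.comp M.d) :
    (hoFunctor e).map f = (hoFunctor e).map g :=
  CategoryTheory.Quotient.sound _ ⟨H, hH, h⟩

lemma isIso_hoFunctor_map {M N : TopMod e} (f : M ⟶ N) (g : N ⟶ M)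
    (h₁ : (hoFunctor e).map (f ≫ g) = (hoFunctor e).map (𝟙 M))
    (h₂ : (hoFunctor e).map (g ≫ f) = (hoFunctor e).map (𝟙 N)) :
    IsIso ((hoFunctor e).map f) :=
  ⟨(hoFunctor e).map g, by rw [← Functor.map_comp, h₁, CategoryTheory.Functor.map_id],
    by rw [← Functor.map_comp, h₂, CategoryTheory.Functor.map_id]⟩

/-- The morphism of triangles in the homotopy category given by morphisms of modules which make
the diagram commute up to homotopy. -/
def hoTriangleHom {T₁ T₂ : Triangle (TopMod e)} (a : T₁.obj₁ ⟶ T₂.obj₁) (b : T₁.obj₂ ⟶ T₂.obj₂)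
    (c : T₁.obj₃ ⟶ T₂.obj₃)
    (h₁ : (hoFunctor e).map (T₁.mor₁ ≫ b) = (hoFunctor e).map (a ≫ T₂.mor₁))
    (h₂ : (hoFunctor e).map (T₁.mor₂ ≫ c) = (hoFunctor e).map (b ≫ T₂.mor₂))
    (h₃ : (hoFunctor e).map (T₁.mor₃ ≫ a⟦(1 : ℤ)⟧') = (hoFunctor e).map (c ≫ T₂.mor₃)) :
    (hoFunctor e).mapTriangle.obj T₁ ⟶ (hoFunctor e).mapTriangle.obj T₂ :=
  Triangle.homMk _ _ ((hoFunctor e).map a) ((hoFunctor e).map b) ((hoFunctor e).map c)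
    ((Functor.map_comp _ _ _).symm.trans (h₁.trans (Functor.map_comp _ _ _)))
    ((Functor.map_comp _ _ _).symm.trans (h₂.trans (Functor.map_comp _ _ _)))
    (by
      have h := congrArg (fun x => x ≫ ((hoFunctor e).commShiftIso (1 : ℤ)).hom.app T₂.obj₁) h₃
      simp only [Functor.map_comp, Category.assoc, Functor.commShiftIso_hom_naturality] at h
      exact (Category.assoc _ _ _).trans h)

lemma nonempty_hoTriangleIso {T₁ T₂ : Triangle (TopMod e)} (a : T₁.obj₁ ⟶ T₂.obj₁)
    (b : T₁.obj₂ ⟶ T₂.obj₂) (c : T₁.obj₃ ⟶ T₂.obj₃)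
    (ha : IsIso ((hoFunctor e).map a)) (hb : IsIso ((hoFunctor e).map b))
    (hc : IsIso ((hoFunctor e).map c))
    (h₁ : (hoFunctor e).map (T₁.mor₁ ≫ b) = (hoFunctor e).map (a ≫ T₂.mor₁))
    (h₂ : (hoFunctor e).map (T₁.mor₂ ≫ c) = (hoFunctor e).map (b ≫ T₂.mor₂))
    (h₃ : (hoFunctor e).map (T₁.mor₃ ≫ a⟦(1 : ℤ)⟧') = (hoFunctor e).map (c ≫ T₂.mor₃)) :
    Nonempty ((hoFunctor e).mapTriangle.obj T₁ ≅ (hoFunctor e).mapTriangle.obj T₂) := by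
  have := Triangle.isIso_of_isIsos (hoTriangleHom a b c h₁ h₂ h₃) ha hb hc
  exact ⟨asIso (hoTriangleHom a b c h₁ h₂ h₃)⟩

lemma nonempty_iso_coneTriangle_of_equiv {M M' M'' : TopMod e} {f : M ⟶ M'} {g : M' ⟶ M''}
    {h : M'' ⟶ M.shiftObj 1} (s : M'' ⟶ cone f) (t : cone f ⟶ M'') (hst : s ≫ t = 𝟙 M'')
    (hts : (hoFunctor e).map (t ≫ s) = (hoFunctor e).map (𝟙 (cone f))) (hg : coneIn f ≫ t = g)
    (hh : s ≫ coneOut f = h) :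
    Nonempty ((hoFunctor e).mapTriangle.obj (Triangle.mk f g h) ≅
      (hoFunctor e).mapTriangle.obj (coneTriangle f)) := by
  refine nonempty_hoTriangleIso (T₁ := Triangle.mk f g h) (T₂ := coneTriangle f) (𝟙 _) (𝟙 _) s
    (inferInstanceAs (IsIso ((hoFunctor e).map (𝟙 M))))
    (inferInstanceAs (IsIso ((hoFunctor e).map (𝟙 M'))))
    (isIso_hoFunctor_map s t (by rw [hst]) hts) ?_ ?_ ?_
  · exact congrArg _ ((Category.comp_id _).trans (Category.id_comp _).symm)
  · change (hoFunctor e).map (g ≫ s) = (hoFunctor e).map (𝟙 M' ≫ coneIn f)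
    rw [← hg, Category.assoc, Functor.map_comp, hts, CategoryTheory.Functor.map_id,
      Category.comp_id, Category.id_comp]
  · change (hoFunctor e).map (h ≫ (𝟙 M)⟦(1 : ℤ)⟧') = (hoFunctor e).map (s ≫ coneOut f)
    rw [hh, CategoryTheory.Functor.map_id]
    exact congrArg _ (Category.comp_id h)

end HomotopyCategory

/-- The sequence `M → M' → M''`, not necessarily of strict morphisms, is split by `ρ : M' → M` and
`σ : M'' → M'` as a sequence of cofree comodules, and `h` is its connecting morphism. -/
structure IsSplit {M M' M'' : TopMod e} (f : M ⟶ M') (g : M' ⟶ M'') (h : M'' ⟶ M.shiftObj 1)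
    (ρ : Ser K M'.R M.R) (σ : Ser K M''.R M'.R) : Prop where
  splitting : Ser.IsSplitting f.ser g.ser ρ σ
  retraction_isPreHom : IsPreHom M' M 0 ρ
  section_isPreHom : IsPreHom M'' M' 0 σ
  connecting : (h.ser.comp g.ser : Ser K M'.R M.R) = M.d.comp ρ - ρ.comp M'.d

namespace IsSplit

variable {M M' M'' : TopMod e} {f : M ⟶ M'} {g : M' ⟶ M''} {h : M'' ⟶ M.shiftObj 1}
  {ρ : Ser K M'.R M.R} {σ : Ser K M''.R M'.R} (H : IsSplit f g h ρ σ)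

include H

/-- The homotopy equivalence `M'' → C(f)` for a split sequence `M → M' → M''`. -/
def toCone : M'' ⟶ cone f :=
  coneLift f (a := h.ser) (isPreHom_of_shift_one h) H.section_isPreHom (comm_shift_one h)
    (H.splitting.comp_connecting_add_comp_section g.comm H.connecting)

/-- The homotopy equivalence `C(f) → M''` for a split sequence `M → M' → M''`. -/
def fromCone : cone f ⟶ M'' :=
  coneDesc f (a := 0) g (IsPreHom.zero _ _ _) (by
    rw [Ser.comp_zero, Ser.zero_comp, add_zero, H.splitting.comp_eq_zero])

lemma toCone_fromCone : H.toCone ≫ H.fromCone = 𝟙 M'' := by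
  ext1
  change (Ser.desc 0 g.ser).comp (Ser.lift h.ser σ) = Ser.const LinearMap.id
  rw [Ser.desc, Ser.zero_comp, zero_add, Ser.comp_assoc, Ser.snd_lift, H.splitting.sect]

lemma fromCone_toCone :
    (hoFunctor e).map (H.fromCone ≫ H.toCone) = (hoFunctor e).map (𝟙 (cone f)) := by
  symm
  refine hoFunctor_map_eq ((isPreHom_cone_inl f).comp
    (H.retraction_isPreHom.comp (isPreHom_cone_snd f) (add_zero 0)) (by omega)) ?_
  rw [cone_d]
  exact Ser.cone_homotopy_of_isSplitting H.splitting H.connecting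

lemma nonempty_iso_coneTriangle :
    Nonempty ((hoFunctor e).mapTriangle.obj (Triangle.mk f g h) ≅
      (hoFunctor e).mapTriangle.obj (coneTriangle f)) :=
  nonempty_iso_coneTriangle_of_equiv H.toCone H.fromCone H.toCone_fromCone H.fromCone_toCone
    (hom_ext (Ser.desc_inr _ _)) (hom_ext (Ser.fst_lift _ _))

end IsSplit

lemma isSplit_cone {M N : TopMod e} (f : M ⟶ N) :
    IsSplit (coneIn f) (coneOut f) (-f⟦(1 : ℤ)⟧') (Ser.snd K A.carrier M.carrier N.carrier)
      (Ser.inl K A.carrier M.carrier N.carrier) where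
  splitting :=
    { retraction := Ser.snd_inr K A.carrier M.carrier N.carrier
      sect := Ser.fst_inl K A.carrier M.carrier N.carrier
      total := (add_comm _ _).trans (Ser.inl_fst_add_inr_snd K A.carrier M.carrier N.carrier) }
  retraction_isPreHom := isPreHom_cone_snd f
  section_isPreHom := isPreHom_inl (M.shiftObj 1) N _ _ _
  connecting := by
    rw [cone_d, Ser.snd_twisted]
    change (-f.ser).comp (Ser.fst K A.carrier M.carrier N.carrier) = _
    rw [Ser.neg_comp]
    abel

section Shift

lemma ser_shiftFunctorComm_hom_app (M : TopMod e) (a b : ℤ) :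
    ((shiftFunctorComm (TopMod e) a b).hom.app M).ser =
      (Ser.const LinearMap.id : Ser K M.R M.R) := by
  have ser_add' : ∀ c (h : b + a = c), ((shiftFunctorAdd' (TopMod e) b a c h).hom.app M).ser =
      (Ser.const LinearMap.id : Ser K M.R M.R) := by
    rintro _ rfl
    rw [shiftFunctorAdd'_eq_shiftFunctorAdd]
    rfl
  exact (ser_comp_of rfl (ser_add' (a + b) (add_comm b a))).trans (Ser.comp_id _)

lemma ser_negOnePow_smul {M N : TopMod e} (n : ℤ) (f : M ⟶ N) :
    (n.negOnePow • f).ser = (-1 : K) ^ n • f.ser := by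
  rcases Int.even_or_odd n with hn | hn
  · rw [Int.negOnePow_even n hn, hn.neg_one_zpow, one_smul, one_smul]
  · rw [Int.negOnePow_odd n hn, hn.neg_one_zpow, Units.neg_smul, one_smul, ser_neg]
    exact (neg_one_smul K f.ser).symm

lemma IsSplit.shift {M M' M'' : TopMod e} {f : M ⟶ M'} {g : M' ⟶ M''} {h : M'' ⟶ M.shiftObj 1}
    {ρ : Ser K M'.R M.R} {σ : Ser K M''.R M'.R} (H : IsSplit f g h ρ σ) (n : ℤ) :
    IsSplit (n.negOnePow • f⟦n⟧') (n.negOnePow • g⟦n⟧')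
      (n.negOnePow • (shiftFunctor (TopMod e) n).map (Y := M⟦(1 : ℤ)⟧) h ≫
        (shiftFunctorComm (TopMod e) 1 n).hom.app M)
      ((-1 : K) ^ n • ρ : Ser K M'.R M.R) ((-1 : K) ^ n • σ : Ser K M''.R M'.R) := by
  have sign_sq : (-1 : K) ^ n * (-1 : K) ^ n = 1 := by rw [← mul_zpow]; simp
  have cancel {V W X : Type u} [AddCommGroup V] [Module K V] [AddCommGroup W] [Module K W]
      [AddCommGroup X] [Module K X] (a : Ser K W X) (b : Ser K V W) :
      ((-1 : K) ^ n • a).comp ((-1 : K) ^ n • b) = a.comp b := by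
    rw [Ser.smul_comp, Ser.comp_smul, smul_smul, sign_sq, one_smul]
  have ser_f : (n.negOnePow • f⟦n⟧').ser = (-1 : K) ^ n • f.ser := ser_negOnePow_smul n _
  have ser_g : (n.negOnePow • g⟦n⟧').ser = (-1 : K) ^ n • g.ser := ser_negOnePow_smul n _
  have ser_h : (n.negOnePow • (shiftFunctor (TopMod e) n).map (Y := M⟦(1 : ℤ)⟧) h ≫
      (shiftFunctorComm (TopMod e) 1 n).hom.app M).ser = ((-1 : K) ^ n • h.ser : Ser K M''.R M.R) :=
    (ser_negOnePow_smul n _).trans (congrArg _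
      ((ser_comp_of rfl (ser_shiftFunctorComm_hom_app M 1 n)).trans (Ser.id_comp _)))
  refine ⟨?_, (H.retraction_isPreHom.smul _).shift n n 0 rfl,
    (H.section_isPreHom.smul _).shift n n 0 rfl, ?_⟩
  · rw [ser_f, ser_g]
    exact ⟨(cancel _ _).trans H.splitting.retraction, (cancel _ _).trans H.splitting.sect,
      (congrArg₂ _ (cancel _ _) (cancel _ _)).trans H.splitting.total⟩
  · rw [ser_g, ser_h]
    exact (cancel _ _).trans (H.connecting.trans (congrArg₂ _ (cancel _ _) (cancel _ _)).symm)

end Shift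

end TopMod

/-! ### The octahedron and the cylinder -/

namespace Ser

variable {K : Type u} [Field K] {B X Y Z W : Type u} [AddCommGroup B] [Module K B]
  [AddCommGroup X] [Module K X] [AddCommGroup Y] [Module K Y] [AddCommGroup Z] [Module K Z]
  [AddCommGroup W] [Module K W]

section ConeMap

variable {f : Ser K (Cof K B X) (Cof K B Y)} {f' : Ser K (Cof K B Z) (Cof K B W)}
  {a : Ser K (Cof K B X) (Cof K B Z)} {b : Ser K (Cof K B Y) (Cof K B W)}
  {H : Ser K (Cof K B X) (Cof K B W)}
  {dX : Ser K (Cof K B X) (Cof K B X)} {dY : Ser K (Cof K B Y) (Cof K B Y)}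
  {dZ : Ser K (Cof K B Z) (Cof K B Z)} {dW : Ser K (Cof K B W) (Cof K B W)}

lemma comp_fst_anticomm_twisted (ha : dZ.comp a = a.comp dX) :
    dZ.comp (a.comp (fst K B X Y)) + (a.comp (fst K B X Y)).comp (twisted (-dX) f dY) = 0 := by
  simp [comp_eq_assoc ha]

lemma comp_fst_add_comp_desc_eq (hb : dW.comp b = b.comp dY)
    (hH : b.comp f - f'.comp a = dW.comp H + H.comp dX) :
    f'.comp (a.comp (fst K B X Y)) + dW.comp (desc H b) =
      (desc H b).comp (twisted (-dX) f dY) := by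
  apply coprod_ext
  · have hbf : b.comp f = dW.comp H + H.comp dX + f'.comp a := sub_eq_iff_eq_add.1 hH
    simp only [hbf, Ser.add_comp, Ser.comp_assoc, fst_inl, desc_inl, twisted_inl, desc_comp_lift,
      Ser.comp_id, Ser.comp_neg]
    abel
  · simp [hb]

end ConeMap

lemma id_eq_twisted_id_homotopy (dX : Ser K (Cof K B X) (Cof K B X)) :
    Ser.const LinearMap.id =
      (twisted (-dX) (Ser.const LinearMap.id) dX).comp ((inl K B X X).comp (snd K B X X)) +
        ((inl K B X X).comp (snd K B X X)).comp (twisted (-dX) (Ser.const LinearMap.id) dX) := by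
  apply prod_ext <;> apply coprod_ext <;> simp

section Octahedron

variable {f : Ser K (Cof K B X) (Cof K B Y)} {g : Ser K (Cof K B Y) (Cof K B Z)}
  {dX : Ser K (Cof K B X) (Cof K B X)} {dY : Ser K (Cof K B Y) (Cof K B Y)}
  {dZ : Ser K (Cof K B Z) (Cof K B Z)}

lemma octahedron_lift_fst :
    (twisted (-dX) f dY).comp ((inr K B X Y).comp (fst K B Y Z)) +
      ((inr K B X Y).comp (fst K B Y Z)).comp (twisted (-dY) g dZ) = 0 := by
  simp only [Ser.comp_assoc, fst_twisted, twisted_inr_assoc, Ser.neg_comp, Ser.comp_neg]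
  exact add_neg_cancel ((inr K B X Y).comp (dY.comp (fst K B Y Z)))

lemma octahedron_lift_snd :
    (lift ((Ser.const LinearMap.id).comp (fst K B X Y)) (desc 0 g)).comp
        ((inr K B X Y).comp (fst K B Y Z)) +
      (twisted (-dX) (g.comp f) dZ).comp ((inr K B X Z).comp (snd K B Y Z)) =
      ((inr K B X Z).comp (snd K B Y Z)).comp (twisted (-dY) g dZ) := by
  apply prod_ext <;> apply coprod_ext <;> simp

lemma octahedron_desc :
    (twisted (-dY) g dZ).comp ((inl K B Y Z).comp (snd K B X Y)) +
      ((inl K B Y Z).comp (snd K B X Y)).comp (twisted (-dX) f dY) =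
      (lift (f.comp (fst K B X Z)) (desc 0 (Ser.const LinearMap.id))).comp
        (lift ((Ser.const LinearMap.id).comp (fst K B X Y)) (desc 0 g)) := by
  apply prod_ext <;> apply coprod_ext <;> simp

lemma octahedron_section :
    (desc ((inl K B Y Z).comp (snd K B X Y))
        (lift (f.comp (fst K B X Z)) (desc 0 (Ser.const LinearMap.id)))).comp
      (lift ((inr K B X Y).comp (fst K B Y Z)) ((inr K B X Z).comp (snd K B Y Z))) =
      Ser.const LinearMap.id := by
  apply prod_ext <;> apply coprod_ext <;> simp

lemma octahedron_homotopy :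
    Ser.const LinearMap.id -
      (lift ((inr K B X Y).comp (fst K B Y Z)) ((inr K B X Z).comp (snd K B Y Z))).comp
      (desc ((inl K B Y Z).comp (snd K B X Y))
        (lift (f.comp (fst K B X Z)) (desc 0 (Ser.const LinearMap.id)))) =
    (twisted (-twisted (-dX) f dY)
        (lift ((Ser.const LinearMap.id).comp (fst K B X Y)) (desc 0 g))
        (twisted (-dX) (g.comp f) dZ)).comp ((inl K B (X × Y) (X × Z)).comp
          ((inl K B X Y).comp ((fst K B X Z).comp (snd K B (X × Y) (X × Z))))) +
      ((inl K B (X × Y) (X × Z)).comp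
          ((inl K B X Y).comp ((fst K B X Z).comp (snd K B (X × Y) (X × Z))))).comp
      (twisted (-twisted (-dX) f dY)
        (lift ((Ser.const LinearMap.id).comp (fst K B X Y)) (desc 0 g))
        (twisted (-dX) (g.comp f) dZ)) := by
  apply prod_ext <;> apply prod_ext <;> apply coprod_ext <;> apply coprod_ext <;> simp

end Octahedron

section Cylinder

variable {f : Ser K (Cof K B X) (Cof K B Y)}
  {dX : Ser K (Cof K B X) (Cof K B X)} {dY : Ser K (Cof K B Y) (Cof K B Y)}

lemma cyl_inclusion_comm :
    (twisted (-dX) (lift (-Ser.const LinearMap.id) f) (twisted dX 0 dY)).comp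
      ((inr K B X (X × Y)).comp (inr K B X Y)) =
      ((inr K B X (X × Y)).comp (inr K B X Y)).comp dY := by
  simp

lemma cyl_projection_comm (hf : dY.comp f = f.comp dX) :
    dY.comp ((desc f (Ser.const LinearMap.id)).comp (snd K B X (X × Y))) =
      ((desc f (Ser.const LinearMap.id)).comp (snd K B X (X × Y))).comp
      (twisted (-dX) (lift (-Ser.const LinearMap.id) f) (twisted dX 0 dY)) := by
  apply coprod_ext
  · simp
  · apply coprod_ext <;> simp [hf]

lemma cyl_homotopy :
    Ser.const LinearMap.id - ((inr K B X (X × Y)).comp (inr K B X Y)).comp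
      ((desc f (Ser.const LinearMap.id)).comp (snd K B X (X × Y))) =
    (twisted (-dX) (lift (-Ser.const LinearMap.id) f) (twisted dX 0 dY)).comp
      (-((inl K B X (X × Y)).comp ((fst K B X Y).comp (snd K B X (X × Y))))) +
      (-((inl K B X (X × Y)).comp ((fst K B X Y).comp (snd K B X (X × Y))))).comp
      (twisted (-dX) (lift (-Ser.const LinearMap.id) f) (twisted dX 0 dY)) := by
  apply prod_ext
  · apply coprod_ext
    · simp
    · apply coprod_ext <;> simp
  · apply prod_ext <;> apply coprod_ext
    · simp
    · apply coprod_ext <;> simp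
    · simp
    · apply coprod_ext <;> simp

lemma cyl_square_homotopy :
    ((inr K B X (X × Y)).comp (inr K B X Y)).comp f - (inr K B X (X × Y)).comp (inl K B X Y) =
    (twisted (-dX) (lift (-Ser.const LinearMap.id) f) (twisted dX 0 dY)).comp
      (inl K B X (X × Y)) + (inl K B X (X × Y)).comp dX := by
  apply prod_ext
  · simp
  · apply prod_ext <;> simp

end Cylinder

end Ser

namespace TopMod

section ConeMap

variable {M N M' N' : TopMod e} (f : M ⟶ N) (f' : M' ⟶ N') (a : M ⟶ M') (b : N ⟶ N')
  {H : Ser K M.R N'.R} (hH : IsPreHom M N' (-1) H)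
  (h : (f ≫ b).ser - (a ≫ f').ser = N'.d.comp H + H.comp M.d)

/-- The morphism `C(f) → C(f')`, `(x, y) ↦ (a x, H x + b y)`, given by a square which commutes up
to the homotopy `H`. -/
def coneMap : cone f ⟶ cone f' :=
  coneLift f' (a := a.ser.comp (Ser.fst K A.carrier M.carrier N.carrier)) (b := Ser.desc H b.ser)
    (a.isPreHom.comp (isPreHom_cone_fst f) (by omega))
    ((hH.comp (isPreHom_cone_fst f) (by omega)).add
      (b.isPreHom.comp (isPreHom_cone_snd f) (by omega)))
    (by rw [cone_d]; exact Ser.comp_fst_anticomm_twisted a.comm)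
    (by rw [cone_d]; exact Ser.comp_fst_add_comp_desc_eq b.comm h)

lemma coneIn_coneMap : coneIn f ≫ coneMap f f' a b hH h = b ≫ coneIn f' := by
  ext1
  change (Ser.lift (a.ser.comp (Ser.fst K A.carrier M.carrier N.carrier))
    (Ser.desc H b.ser)).comp (Ser.inr K A.carrier M.carrier N.carrier) =
    (Ser.inr K A.carrier M'.carrier N'.carrier).comp b.ser
  apply Ser.prod_ext
  · rw [Ser.fst_lift_assoc, Ser.comp_assoc, Ser.fst_inr, Ser.comp_zero, Ser.fst_inr_assoc]
  · rw [Ser.snd_lift_assoc, Ser.desc_inr, Ser.snd_inr_assoc]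

lemma coneMap_coneOut : coneMap f f' a b hH h ≫ coneOut f' = coneOut f ≫ a⟦(1 : ℤ)⟧' :=
  hom_ext (Ser.fst_lift _ _)

end ConeMap

section Octahedron

variable {X Y Z : TopMod e} (f : X ⟶ Y) (g : Y ⟶ Z)

/-- The morphism `C(f) → C(f ≫ g)`. -/
def coneCompRight : cone f ⟶ cone (f ≫ g) :=
  coneMap f (f ≫ g) (𝟙 X) g (IsPreHom.zero _ _ _) (by
    rw [Category.id_comp, sub_self, Ser.comp_zero, Ser.zero_comp, add_zero])

/-- The morphism `C(f ≫ g) → C(g)`. -/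
def coneCompLeft : cone (f ≫ g) ⟶ cone g :=
  coneMap (f ≫ g) g f (𝟙 Z) (IsPreHom.zero _ _ _) (by
    rw [Category.comp_id, sub_self, Ser.comp_zero, Ser.zero_comp, add_zero])

/-- The homotopy equivalence `C(g) → C(C(f) → C(f ≫ g))`. -/
def coneCompLift : cone g ⟶ cone (coneCompRight f g) :=
  coneLift (coneCompRight f g)
    (a := (Ser.inr K A.carrier X.carrier Y.carrier).comp
      (Ser.fst K A.carrier Y.carrier Z.carrier))
    (b := (Ser.inr K A.carrier X.carrier Z.carrier).comp
      (Ser.snd K A.carrier Y.carrier Z.carrier))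
    ((isPreHom_cone_inr f).comp (isPreHom_cone_fst g) (by omega))
    ((isPreHom_cone_inr (f ≫ g)).comp (isPreHom_cone_snd g) (by omega))
    (by rw [cone_d, cone_d]; exact Ser.octahedron_lift_fst)
    (by rw [cone_d, cone_d]; exact Ser.octahedron_lift_snd)

/-- The homotopy equivalence `C(C(f) → C(f ≫ g)) → C(g)`. -/
def coneCompDesc : cone (coneCompRight f g) ⟶ cone g :=
  coneDesc (coneCompRight f g)
    (a := (Ser.inl K A.carrier Y.carrier Z.carrier).comp
      (Ser.snd K A.carrier X.carrier Y.carrier)) (coneCompLeft f g)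
    ((isPreHom_cone_inl g).comp (isPreHom_cone_snd f) (by omega))
    (by rw [cone_d, cone_d]; exact Ser.octahedron_desc)

lemma coneCompLift_coneCompDesc : coneCompLift f g ≫ coneCompDesc f g = 𝟙 (cone g) :=
  hom_ext Ser.octahedron_section

lemma coneCompDesc_coneCompLift : (hoFunctor e).map (coneCompDesc f g ≫ coneCompLift f g) =
    (hoFunctor e).map (𝟙 (cone (coneCompRight f g))) := by
  symm
  refine hoFunctor_map_eq ((isPreHom_cone_inl (coneCompRight f g)).comp
    (r := -1) (s := 0) ((isPreHom_cone_inl f).comp ((isPreHom_cone_fst (f ≫ g)).comp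
      (isPreHom_cone_snd (coneCompRight f g)) (k := 1) (by omega)) (by omega)) (by omega)) ?_
  rw [cone_d, cone_d, cone_d]
  exact Ser.octahedron_homotopy

lemma nonempty_iso_coneCompTriangle :
    Nonempty ((hoFunctor e).mapTriangle.obj (Triangle.mk (coneCompRight f g) (coneCompLeft f g)
      (coneOut g ≫ (coneIn f)⟦(1 : ℤ)⟧')) ≅
      (hoFunctor e).mapTriangle.obj (coneTriangle (coneCompRight f g))) :=
  nonempty_iso_coneTriangle_of_equiv (coneCompLift f g) (coneCompDesc f g)
    (coneCompLift_coneCompDesc f g) (coneCompDesc_coneCompLift f g)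
    (hom_ext (Ser.desc_inr _ _)) (hom_ext (Ser.fst_lift _ _))

end Octahedron

section Cylinder

variable {M N : TopMod e} (f : M ⟶ N)

lemma cylMap_eq : cylMap f = Ser.lift (-Ser.const LinearMap.id) f.ser := by
  rw [cylMap, Ser.lift, Ser.comp_neg, Ser.comp_id]
  rfl

lemma cyl_d : (cyl f).d =
    Ser.twisted (-M.d) (Ser.lift (-Ser.const LinearMap.id) f.ser) (Ser.twisted M.d 0 N.d) := by
  change twistD (M.shiftObj 1) (M.prod N) (cylMap (M := M) f) = _
  rw [twistD_eq_twisted, shiftObj_one_d, cylMap_eq]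
  change Ser.twisted (-M.d) _ (twistD M N 0) = _
  rw [twistD_eq_twisted]

lemma isPreHom_cyl_snd :
    IsPreHom (cyl f) (M.prod N) 0 (Ser.snd K A.carrier M.carrier (M.carrier × N.carrier)) :=
  isPreHom_snd (M.shiftObj 1) (M.prod N) _ _ _

lemma isPreHom_cyl_inr :
    IsPreHom (M.prod N) (cyl f) 0 (Ser.inr K A.carrier M.carrier (M.carrier × N.carrier)) :=
  isPreHom_inr (M.shiftObj 1) (M.prod N) _ _ _

lemma isPreHom_cyl_inl :
    IsPreHom M (cyl f) (-1) (Ser.inl K A.carrier M.carrier (M.carrier × N.carrier)) :=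
  (isPreHom_shift_source (M := M) (a := 1) (by omega)).1
    (isPreHom_inl (M.shiftObj 1) (M.prod N) _ _ _)

/-- The inclusion `N → Cyl(f)`. -/
def cylInclusion : N ⟶ cyl f where
  ser := (Ser.inr K A.carrier M.carrier (M.carrier × N.carrier)).comp
    (Ser.inr K A.carrier M.carrier N.carrier)
  isPreHom := (isPreHom_cyl_inr f).comp (isPreHom_inr M N _ _ _) (add_zero 0)
  comm := by
    rw [cyl_d]
    exact Ser.cyl_inclusion_comm

/-- The projection `Cyl(f) → N`, `(m, m', n) ↦ f m + n`. -/
def cylProjection : cyl f ⟶ N where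
  ser := (Ser.desc f.ser (Ser.const LinearMap.id)).comp
    (Ser.snd K A.carrier M.carrier (M.carrier × N.carrier))
  isPreHom := IsPreHom.comp (N := M.prod N) ((f.isPreHom.comp
    (isPreHom_fst M N 0 (IsPreHom.zero _ _ _) _) (add_zero 0)).add
      ((isPreHom_id N).comp (isPreHom_snd M N 0 (IsPreHom.zero _ _ _) _) (add_zero 0)))
      (isPreHom_cyl_snd f) (add_zero 0)
  comm := by
    rw [cyl_d]
    exact Ser.cyl_projection_comm f.comm

lemma cylInclusion_cylProjection : cylInclusion f ≫ cylProjection f = 𝟙 N := by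
  ext1
  change ((Ser.desc f.ser (Ser.const LinearMap.id)).comp
    (Ser.snd K A.carrier M.carrier (M.carrier × N.carrier))).comp
    ((Ser.inr K A.carrier M.carrier (M.carrier × N.carrier)).comp
    (Ser.inr K A.carrier M.carrier N.carrier)) = Ser.const LinearMap.id
  rw [Ser.comp_assoc, Ser.snd_inr_assoc, Ser.desc_inr]

lemma isPreHom_cyl_fst_snd : IsPreHom (cyl f) M 0 ((Ser.fst K A.carrier M.carrier N.carrier).comp
    (Ser.snd K A.carrier M.carrier (M.carrier × N.carrier))) :=
  IsPreHom.comp (N := M.prod N) (isPreHom_fst M N 0 (IsPreHom.zero _ _ _) _)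
    (isPreHom_cyl_snd f) (add_zero 0)

lemma isIso_cylInclusion : IsIso ((hoFunctor e).map (cylInclusion f)) := by
  refine isIso_hoFunctor_map _ (cylProjection f) (by rw [cylInclusion_cylProjection])
    (Eq.symm ?_)
  refine hoFunctor_map_eq ((isPreHom_cyl_inl f).comp (isPreHom_cyl_fst_snd f) (by omega)).neg ?_
  rw [cyl_d]
  exact Ser.cyl_homotopy

lemma ser_cylIn : (cylIn f).ser = (Ser.inr K A.carrier M.carrier (M.carrier × N.carrier)).comp
    (Ser.inl K A.carrier M.carrier N.carrier) := by
  rw [Ser.inr, Ser.inl, Ser.const_comp_const, strictMap_comp]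
  rfl

lemma cylIn_homotopic :
    (hoFunctor e).map (f ≫ cylInclusion f) = (hoFunctor e).map (cylIn f) := by
  refine hoFunctor_map_eq (isPreHom_cyl_inl f) ?_
  rw [cyl_d, ser_cylIn]
  exact Ser.cyl_square_homotopy

lemma ser_cylOut : (cylOut f).ser = Ser.lift
    (Ser.fst K A.carrier M.carrier (M.carrier × N.carrier))
    ((Ser.snd K A.carrier M.carrier N.carrier).comp
      (Ser.snd K A.carrier M.carrier (M.carrier × N.carrier))) := by
  change Ser.const (strictMap K A.carrier ((LinearMap.id : M.carrier →ₗ[K] M.carrier).prodMap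
      (LinearMap.snd K M.carrier N.carrier))) = _
  apply Ser.prod_ext
  · rw [Ser.fst_lift, Ser.fst, Ser.fst, Ser.const_comp_const, strictMap_comp]
    rfl
  · rw [Ser.snd_lift, Ser.snd, Ser.snd, Ser.const_comp_const, Ser.const_comp_const,
      strictMap_comp, strictMap_comp]
    rfl

lemma cylInclusion_cylOut : cylInclusion f ≫ cylOut f = coneIn f := by
  ext1
  rw [ser_comp, ser_cylOut]
  change (Ser.lift _ _).comp ((Ser.inr K A.carrier M.carrier (M.carrier × N.carrier)).comp
    (Ser.inr K A.carrier M.carrier N.carrier)) = Ser.inr K A.carrier M.carrier N.carrier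
  apply Ser.prod_ext
  · rw [Ser.fst_lift_assoc, Ser.fst_inr_assoc, Ser.fst_inr]
  · rw [Ser.snd_lift_assoc, Ser.comp_assoc, Ser.snd_inr_assoc, Ser.snd_inr]

lemma nonempty_iso_cylTriangle :
    Nonempty ((hoFunctor e).mapTriangle.obj (coneTriangle f) ≅
      (hoFunctor e).mapTriangle.obj (cylTriangle f)) := by
  refine nonempty_hoTriangleIso (T₁ := coneTriangle f) (T₂ := cylTriangle f) (𝟙 M)
    (cylInclusion f) (𝟙 (cone f)) (inferInstanceAs (IsIso ((hoFunctor e).map (𝟙 M))))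
    (isIso_cylInclusion f) (inferInstanceAs (IsIso ((hoFunctor e).map (𝟙 (cone f))))) ?_ ?_ ?_
  · exact (cylIn_homotopic f).trans (congrArg _ (Category.id_comp _).symm)
  · exact congrArg _ ((Category.comp_id _).trans (cylInclusion_cylOut f).symm)
  · change (hoFunctor e).map (coneOut f ≫ (𝟙 M)⟦(1 : ℤ)⟧') =
      (hoFunctor e).map (𝟙 (cone f) ≫ coneOut f)
    rw [CategoryTheory.Functor.map_id]
    exact congrArg _ ((Category.comp_id _).trans (Category.id_comp _).symm)

end Cylinder

end TopMod

/-! ### Splittings of semi-split sequences -/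

namespace Ser

section Eval

variable {K : Type u} [Field K] {U V W : Type u} [AddCommGroup U] [Module K U]
  [AddCommGroup V] [Module K V] [AddCommGroup W] [Module K W]

/-- The element `x` of `V⟦ħ⟧`, regarded as the series of linear maps `c ↦ c x`; it turns the
evaluation of series into their composition. -/
def ofSeq (x : ℕ → V) : Ser K K V := fun n => LinearMap.toSpanSingleton K V (x n)

lemma ofSeq_injective : Function.Injective (ofSeq (K := K) (V := V)) := fun x y h => by
  funext n
  simpa [ofSeq] using LinearMap.congr_fun (congrFun h n) 1

lemma ofSeq_eval (f : Ser K V W) (x : ℕ → V) : ofSeq (f.eval x) = f.comp (ofSeq x) := by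
  funext n
  ext
  simp [ofSeq, Ser.eval, Ser.comp]

lemma eval_comp (g : Ser K V W) (f : Ser K U V) (x : ℕ → U) :
    (g.comp f).eval x = g.eval (f.eval x) :=
  ofSeq_injective (K := K) (by simp only [ofSeq_eval, Ser.comp_assoc])

lemma eval_const (l : V →ₗ[K] W) (x : ℕ → V) : (Ser.const l).eval x = fun n => l (x n) :=
  ofSeq_injective (K := K) (by
    rw [ofSeq_eval, Ser.const_comp]
    funext n
    ext
    simp [ofSeq])

lemma eval_id (x : ℕ → V) : (Ser.const (LinearMap.id : V →ₗ[K] V)).eval x = x :=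
  eval_const _ x

lemma eval_single (f : Ser K V W) (v : V) : f.eval (Pi.single 0 v) = fun n => f n v :=
  ofSeq_injective (K := K) (by
    have h : ofSeq (Pi.single 0 v) = Ser.const (LinearMap.toSpanSingleton K V v) := by
      funext n
      ext
      by_cases hn : n = 0 <;> simp [ofSeq, Ser.const, hn]
    rw [ofSeq_eval, h, Ser.comp_const]
    funext n
    ext
    simp [ofSeq])

lemma eval_add (f g : Ser K V W) (x : ℕ → V) : (f + g).eval x = f.eval x + g.eval x :=
  ofSeq_injective (K := K) (by
    rw [ofSeq_eval, Ser.add_comp, ← ofSeq_eval, ← ofSeq_eval]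
    funext n
    exact (LinearMap.toSpanSingleton_add _ _).symm)

lemma eval_smul (c : K) (f : Ser K V W) (x : ℕ → V) : (c • f).eval x = c • f.eval x :=
  ofSeq_injective (K := K) (by
    rw [ofSeq_eval, Ser.smul_comp, ← ofSeq_eval]
    funext n
    exact (LinearMap.toSpanSingleton_smul _ _).symm)

lemma eval_zero (x : ℕ → V) : (0 : Ser K V W).eval x = 0 := by
  simpa using eval_smul (0 : K) (0 : Ser K V W) x

lemma eval_neg (f : Ser K V W) (x : ℕ → V) : (-f).eval x = -f.eval x := by
  simpa using eval_smul (-1 : K) f x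

lemma eval_sub (f g : Ser K V W) (x : ℕ → V) : (f - g).eval x = f.eval x - g.eval x := by
  rw [sub_eq_add_neg, eval_add, eval_neg, ← sub_eq_add_neg]

end Eval

section Strict

variable {K : Type u} [Field K] {U V W : Type u} [AddCommGroup U] [Module K U]
  [AddCommGroup V] [Module K V] [AddCommGroup W] [Module K W]
  (B : Type u) [AddCommGroup B] [Module K B]

/-- The series `f ⊗ 1` of strict maps of cofree comodules induced by a series of linear maps. -/
def strict (f : Ser K V W) : Ser K (Cof K B V) (Cof K B W) := fun n => strictMap K B (f n)

lemma strict_comp (g : Ser K V W) (f : Ser K U V) :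
    (strict B g).comp (strict B f) = strict B (g.comp f) := by
  funext n
  refine TensorProduct.ext' fun x t => ?_
  simp [Ser.comp, strict, TensorProduct.sum_tmul]

lemma strict_const (l : V →ₗ[K] W) : strict B (Ser.const l) = Ser.const (strictMap K B l) := by
  funext n
  simp only [strict, Ser.const]
  split_ifs <;> simp

lemma strict_id : strict B (Ser.const (LinearMap.id : V →ₗ[K] V)) = Ser.const LinearMap.id := by
  rw [strict_const, strictMap, LinearMap.rTensor_id]

lemma strict_add (f g : Ser K V W) : strict B (f + g) = strict B f + strict B g := by
  funext n
  exact LinearMap.rTensor_add _ _ _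

lemma IsSplitting.strict {f : Ser K U V} {g : Ser K V W} {ρ : Ser K V U} {σ : Ser K W V}
    (H : IsSplitting f g ρ σ) :
    IsSplitting (strict B f) (strict B g) (strict B ρ) (strict B σ) where
  retraction := by rw [strict_comp, H.retraction, strict_id]
  sect := by rw [strict_comp, H.sect, strict_id]
  total := by rw [strict_comp, strict_comp, ← strict_add, H.total, strict_id]

end Strict

end Ser

section Comodules

variable {K : Type u} [Field K] {B V W : Type u} [AddCommGroup B] [Module K B] [AddCommGroup V]
  [Module K V] [AddCommGroup W] [Module K W]

lemma counit_ι_mul (a : B) (t : TensorAlgebra K B) : counit K B (TensorAlgebra.ι K a * t) = 0 := by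
  simp [TensorAlgebra.algebraMapInv]

lemma isComoduleMap_sum {ι : Type} {s : Finset ι} {F : ι → Cof K B V →ₗ[K] Cof K B W}
    (h : ∀ i ∈ s, IsComoduleMap K B (F i)) : IsComoduleMap K B (∑ i ∈ s, F i) := by
  refine Finset.sum_induction F (IsComoduleMap K B) (fun f g hf hg => ?_) ?_ h
  · unfold IsComoduleMap at *
    rw [LinearMap.comp_add, hf, hg, LinearMap.rTensor_add, LinearMap.add_comp]
  · simp [IsComoduleMap]

lemma IsComoduleMap.eq_of_toCogen_comp_eq {f g : Cof K B V →ₗ[K] Cof K B W}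
    (hf : IsComoduleMap K B f) (hg : IsComoduleMap K B g)
    (h : toCogen K B W ∘ₗ f = toCogen K B W ∘ₗ g) : f = g := by
  have reconstruct : ∀ {k : Cof K B V →ₗ[K] Cof K B W}, IsComoduleMap K B k → ∀ x,
      k x = LinearMap.rTensor (TensorAlgebra K B) (toCogen K B W ∘ₗ k) (coact K B V x) := by
    intro k hk x
    rw [LinearMap.rTensor_comp, LinearMap.comp_apply, ← LinearMap.comp_apply _ (coact K B V), ← hk]
    exact (cogen_coact (k x)).symm
  refine LinearMap.ext fun x => ?_
  rw [reconstruct hf, reconstruct hg, h]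

lemma IsComoduleMap.eq_strictMap {f : Cof K B V →ₗ[K] Cof K B W} (hf : IsComoduleMap K B f)
    (h : ∀ m a t, toCogen K B W (f (m ⊗ₜ (TensorAlgebra.ι K a * t))) = 0) :
    f = strictMap K B
      (toCogen K B W ∘ₗ f ∘ₗ (TensorProduct.mk K V (TensorAlgebra K B)).flip 1) := by
  refine hf.eq_of_toCogen_comp_eq (coact_strictMap _) (TensorProduct.ext' fun m t => ?_)
  rw [LinearMap.comp_apply, LinearMap.comp_apply, toCogen_strictMap, toCogen_tmul]
  induction t using tensor_induction with
  | h1 => simp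
  | hmul a t _ => rw [h, counit_ι_mul, zero_smul, map_zero]
  | hadd s t hs ht => rw [tmul_add, map_add, map_add, hs, ht, map_add, add_smul, map_add]
  | hsmul c t ht => simp only [tmul_smul, map_smul, ht, smul_eq_mul, mul_smul]

end Comodules

namespace BigradedSpace

variable {K : Type u} [Field K]

lemma counit_of_mem_barGr {A : BigradedSpace K} {r s : ℤ} {t : TensorAlgebra K A.carrier}
    (ht : t ∈ A.barGr r s) (h : ¬ (r = 0 ∧ s = 0)) : counit K A.carrier t = 0 := by
  have : A.barGr r s ≤ LinearMap.ker (counit K A.carrier) := by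
    refine Submodule.span_le.2 fun t ht => ?_
    cases ht with
    | nil => exact absurd ⟨rfl, rfl⟩ h
    | cons _ _ => exact counit_ι_mul _ _
  exact this ht

lemma toCogen_mem {A M : BigradedSpace K} {i j k : ℤ} (hk : i + 1 = k)
    {x : Cof K A.carrier M.carrier} (hx : x ∈ cofreeGr A M i j) :
    toCogen K A.carrier M.carrier x ∈ M.gr k j := by
  have : cofreeGr A M i j ≤ (M.gr k j).comap (toCogen K A.carrier M.carrier) := by
    refine Submodule.span_le.2 ?_
    rintro _ ⟨p, q, r, s, m, t, hm, ht, hi, hj, rfl⟩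
    rw [SetLike.mem_coe, Submodule.mem_comap, toCogen_tmul]
    by_cases h : r = 0 ∧ s = 0
    · obtain ⟨rfl, rfl⟩ := h
      obtain rfl : p = k := by omega
      obtain rfl : q = j := by omega
      exact Submodule.smul_mem _ _ hm
    · rw [counit_of_mem_barGr ht h, zero_smul]
      exact Submodule.zero_mem _
  exact this hx

lemma tmul_one_mem {A M : BigradedSpace K} {i j : ℤ} {m : M.carrier} (hm : m ∈ M.gr i j) :
    m ⊗ₜ[K] (1 : TensorAlgebra K A.carrier) ∈ cofreeGr A M (i - 1) j :=
  Submodule.subset_span ⟨i, j, 0, 0, m, 1, hm, Submodule.subset_span BarWord.nil, by omega,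
    by omega, rfl⟩

lemma exists_linearMap (M : BigradedSpace K) {X : Type u} [AddCommGroup X] [Module K X]
    (s : ∀ i j, M.gr i j →ₗ[K] X) :
    ∃ σ : M.carrier →ₗ[K] X, ∀ i j m (hm : m ∈ M.gr i j), σ m = s i j ⟨m, hm⟩ := by
  let decompose := LinearEquiv.ofBijective
    (DirectSum.coeLinearMap fun p : ℤ × ℤ => M.gr p.1 p.2) M.isInternal
  refine ⟨DirectSum.toModule K (ℤ × ℤ) X (fun p => s p.1 p.2) ∘ₗ decompose.symm.toLinearMap,
    fun i j m hm => ?_⟩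
  have : decompose.symm m =
      DirectSum.lof K (ℤ × ℤ) (fun p : ℤ × ℤ => M.gr p.1 p.2) (i, j) ⟨m, hm⟩ := by
    rw [LinearEquiv.symm_apply_eq]
    exact (DirectSum.coeLinearMap_lof (fun p : ℤ × ℤ => M.gr p.1 p.2) (i, j) ⟨m, hm⟩).symm
  rw [LinearMap.comp_apply, LinearEquiv.coe_coe, this, DirectSum.toModule_lof]

lemma mem_seriesGr {M : BigradedSpace K} {i j : ℤ} {x : ℕ → M.carrier} :
    x ∈ M.seriesGr i j ↔ ∀ n, x n ∈ M.gr i j := by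
  simp [seriesGr]

lemma single_mem_seriesGr {M : BigradedSpace K} {i j : ℤ} {m : M.carrier} (hm : m ∈ M.gr i j) :
    Pi.single 0 m ∈ M.seriesGr i j := by
  refine mem_seriesGr.2 fun n => ?_
  by_cases hn : n = 0
  · simpa [hn] using hm
  · simp [hn]

lemma eval_mem_seriesGr {M N : BigradedSpace K} {i j k l : ℤ} {f : Ser K M.carrier N.carrier}
    (hf : ∀ n, ∀ m ∈ M.gr i j, f n m ∈ N.gr k l) {x : ℕ → M.carrier} (hx : x ∈ M.seriesGr i j) :
    f.eval x ∈ N.seriesGr k l := by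
  refine mem_seriesGr.2 fun n => ?_
  rw [Ser.eval, LinearMap.pi_apply, LinearMap.sum_apply]
  exact Submodule.sum_mem _ fun p _ => hf _ _ (mem_seriesGr.1 hx _)

lemma ser_ext (M : BigradedSpace K) {X : Type u} [AddCommGroup X] [Module K X]
    {f g : Ser K M.carrier X} (h : ∀ i j, ∀ x ∈ M.seriesGr i j, f.eval x = g.eval x) : f = g := by
  funext n
  refine M.hom_ext fun i j m hm => ?_
  have := congrFun (h i j _ (single_mem_seriesGr hm)) n
  rwa [Ser.eval_single, Ser.eval_single] at this

/-- A series of linear maps of bidegree `(0, 0)`. -/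
def PreservesGrading (M N : BigradedSpace K) (f : Ser K M.carrier N.carrier) : Prop :=
  ∀ n i j, ∀ m ∈ M.gr i j, f n m ∈ N.gr i j

namespace PreservesGrading

variable {L M N : BigradedSpace K}

lemma eval_mem {f : Ser K M.carrier N.carrier} (hf : PreservesGrading M N f) {i j : ℤ}
    {x : ℕ → M.carrier} (hx : x ∈ M.seriesGr i j) : f.eval x ∈ N.seriesGr i j :=
  eval_mem_seriesGr (fun n => hf n i j) hx

lemma of_eval_mem {f : Ser K M.carrier N.carrier}
    (hf : ∀ i j, ∀ x ∈ M.seriesGr i j, f.eval x ∈ N.seriesGr i j) : PreservesGrading M N f := by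
  intro n i j m hm
  have := mem_seriesGr.1 (hf i j _ (single_mem_seriesGr hm)) n
  rwa [Ser.eval_single] at this

lemma comp {g : Ser K M.carrier N.carrier} {f : Ser K L.carrier M.carrier}
    (hg : PreservesGrading M N g) (hf : PreservesGrading L M f) :
    PreservesGrading L N (g.comp f) :=
  of_eval_mem fun i j x hx => by
    rw [Ser.eval_comp]
    exact hg.eval_mem (hf.eval_mem hx)

lemma sub {f g : Ser K M.carrier N.carrier} (hf : PreservesGrading M N f)
    (hg : PreservesGrading M N g) : PreservesGrading M N (f - g) :=
  fun n i j m hm => sub_mem (hf n i j m hm) (hg n i j m hm)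

lemma const {l : M.carrier →ₗ[K] N.carrier} (hl : ∀ i j, ∀ m ∈ M.gr i j, l m ∈ N.gr i j) :
    PreservesGrading M N (Ser.const l) :=
  of_eval_mem fun i j x hx => by
    rw [Ser.eval_const]
    exact mem_seriesGr.2 fun n => hl i j _ (mem_seriesGr.1 hx n)

end PreservesGrading

section Splitting

variable {L M M' M'' : BigradedSpace K} {f : Ser K M.carrier M'.carrier}
  {g : Ser K M'.carrier M''.carrier} {ρ : Ser K M'.carrier M.carrier}

lemma exists_section (hg : PreservesGrading M' M'' g)
    (surjective : ∀ i j, ∀ z ∈ M''.seriesGr i j, ∃ y ∈ M'.seriesGr i j, g.eval y = z) :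
    ∃ σ : Ser K M''.carrier M'.carrier,
      PreservesGrading M'' M' σ ∧ g.comp σ = Ser.const LinearMap.id := by
  have exists_homogeneous : ∀ i j, ∃ s : M''.gr i j →ₗ[K] (ℕ → M'.carrier), ∀ z,
      s z ∈ M'.seriesGr i j ∧ g.eval (s z) = Pi.single 0 z.1 := by
    intro i j
    let g' : M'.seriesGr i j →ₗ[K] M''.seriesGr i j := g.eval.restrict fun _ hy => hg.eval_mem hy
    have g'_surjective : LinearMap.range g' = ⊤ := LinearMap.range_eq_top.2 fun z => by
      obtain ⟨y, hy, hyz⟩ := surjective i j z.1 z.2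
      exact ⟨⟨y, hy⟩, Subtype.ext hyz⟩
    obtain ⟨s, hs⟩ := g'.exists_rightInverse_of_surjective g'_surjective
    let constant : M''.gr i j →ₗ[K] M''.seriesGr i j :=
      (LinearMap.single K (fun _ => M''.carrier) 0).restrict fun _ hz => single_mem_seriesGr hz
    exact ⟨Submodule.subtype _ ∘ₗ s ∘ₗ constant, fun z => ⟨(s _).2,
      congrArg Subtype.val (LinearMap.congr_fun hs (constant z))⟩⟩
  choose s hs_mem hs using exists_homogeneous
  obtain ⟨S, hS⟩ := M''.exists_linearMap s
  let σ : Ser K M''.carrier M'.carrier := fun n => LinearMap.proj n ∘ₗ S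
  refine ⟨σ, fun n i j z hz => ?_, ?_⟩
  · rw [LinearMap.comp_apply, hS i j z hz]
    exact mem_seriesGr.1 (hs_mem i j ⟨z, hz⟩) n
  · funext n
    refine M''.hom_ext fun i j z hz => ?_
    have h : g.eval (σ.eval (Pi.single 0 z)) = Pi.single 0 z := by
      rw [Ser.eval_single, ← hs i j ⟨z, hz⟩, ← hS i j z hz]
      rfl
    rw [← Ser.eval_comp, Ser.eval_single] at h
    rw [congrFun h n]
    by_cases hn : n = 0 <;> simp [Ser.const, hn]

lemma comp_eq_zero_of_exact {X : Type u} [AddCommGroup X] [Module K X]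
    {p : Ser K M'.carrier X} {q : Ser K L.carrier M'.carrier} (hq : PreservesGrading L M' q)
    (exact : ∀ i j, ∀ y ∈ M'.seriesGr i j, g.eval y = 0 → ∃ x ∈ M.seriesGr i j, f.eval x = y)
    (hpf : p.comp f = 0) (hgq : g.comp q = 0) : p.comp q = 0 := by
  refine L.ser_ext fun i j x hx => ?_
  obtain ⟨y, -, hy⟩ := exact i j _ (hq.eval_mem hx) (by rw [← Ser.eval_comp, hgq, Ser.eval_zero])
  rw [Ser.eval_comp, ← hy, ← Ser.eval_comp, hpf, Ser.eval_zero, Ser.eval_zero]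

lemma exists_isSplitting (hf : PreservesGrading M M' f) (hg : PreservesGrading M' M'' g)
    (hρ : PreservesGrading M' M ρ)
    (exact : ∀ i j, ∀ y ∈ M'.seriesGr i j, g.eval y = 0 ↔ ∃ x ∈ M.seriesGr i j, f.eval x = y)
    (surjective : ∀ i j, ∀ z ∈ M''.seriesGr i j, ∃ y ∈ M'.seriesGr i j, g.eval y = z)
    (retraction : ρ.comp f = Ser.const LinearMap.id) :
    ∃ σ, PreservesGrading M'' M' σ ∧ Ser.IsSplitting f g ρ σ := by
  obtain ⟨σ, hσ, hgσ⟩ := exists_section hg surjective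
  have hgf : g.comp f = 0 := M.ser_ext fun i j x hx => by
    rw [Ser.eval_comp, (exact i j _ (hf.eval_mem hx)).2 ⟨x, hx, rfl⟩, Ser.eval_zero]
  have correction : (Ser.const LinearMap.id - f.comp ρ).comp
      (σ.comp g - Ser.const LinearMap.id) = 0 := by
    refine comp_eq_zero_of_exact (L := M') ((hσ.comp hg).sub (.const fun _ _ _ h => h))
      (fun i j y hy => (exact i j y hy).1) ?_ ?_
    · simp [retraction]
    · simp [Ser.comp_eq_assoc hgσ]
  refine ⟨σ - f.comp (ρ.comp σ), hσ.sub (hf.comp (hρ.comp hσ)), retraction, ?_, ?_⟩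
  · simp [hgσ, Ser.comp_eq_assoc hgf]
  · simp only [Ser.sub_comp, Ser.comp_sub, Ser.id_comp, Ser.comp_id, Ser.comp_assoc,
      sub_eq_zero] at correction ⊢
    rw [correction, add_sub_cancel]

end Splitting

end BigradedSpace

namespace TopMod

section Taylor

variable {M N P : TopMod e}

lemma taylor_apply (f : Ser K M.R N.R) (w : TensorAlgebra K A.carrier) (n : ℕ) (m : M.carrier) :
    taylor f w n m = toCogen K A.carrier N.carrier (f n (m ⊗ₜ w)) := rfl

lemma taylor_add (f g : Ser K M.R N.R) (w : TensorAlgebra K A.carrier) :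
    taylor (f + g) w = taylor f w + taylor g w := by
  funext n
  ext m
  simp [taylor_apply]

lemma taylor_neg (f : Ser K M.R N.R) (w : TensorAlgebra K A.carrier) :
    taylor (-f) w = -taylor f w := by
  funext n
  ext m
  simp [taylor_apply]

lemma taylor_smul (c : K) (f : Ser K M.R N.R) (w : TensorAlgebra K A.carrier) :
    taylor (c • f) w = c • taylor f w := by
  funext n
  ext m
  simp [taylor_apply]

lemma taylor_sub (f g : Ser K M.R N.R) (w : TensorAlgebra K A.carrier) :
    taylor (f - g) w = taylor f w - taylor g w := by
  rw [sub_eq_add_neg, taylor_add, taylor_neg, ← sub_eq_add_neg]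

lemma taylor_strict_comp (ρ : Ser K N.carrier P.carrier) (f : Ser K M.R N.R)
    (w : TensorAlgebra K A.carrier) :
    taylor (N := P) ((Ser.strict A.carrier ρ).comp f) w = ρ.comp (taylor f w) := by
  funext n
  ext m
  simp only [taylor_apply, Ser.comp, LinearMap.sum_apply, LinearMap.comp_apply, map_sum]
  exact Finset.sum_congr rfl fun p _ => toCogen_strictMap _ _

lemma taylor_comp_strict (f : Ser K N.R P.R) (ρ : Ser K M.carrier N.carrier)
    (w : TensorAlgebra K A.carrier) :
    taylor (M := M) (f.comp (Ser.strict A.carrier ρ)) w = (taylor f w).comp ρ := by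
  funext n
  ext m
  simp only [taylor_apply, Ser.comp, LinearMap.sum_apply, LinearMap.comp_apply, map_sum]
  rfl

lemma taylor_strict_one (ρ : Ser K M.carrier N.carrier) :
    taylor (M := M) (N := N) (Ser.strict A.carrier ρ) 1 = ρ := by
  funext n
  ext m
  have h : counit K A.carrier 1 = 1 := map_one TensorAlgebra.algebraMapInv
  rw [taylor_apply, Ser.strict, toCogen_strictMap, toCogen_tmul, h, one_smul]

lemma taylor_strict_ι_mul (ρ : Ser K M.carrier N.carrier) (a : A.carrier)
    (t : TensorAlgebra K A.carrier) :
    taylor (M := M) (N := N) (Ser.strict A.carrier ρ) (TensorAlgebra.ι K a * t) = 0 := by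
  funext n
  ext m
  rw [taylor_apply, Ser.strict, toCogen_strictMap, toCogen_tmul, counit_ι_mul, zero_smul, map_zero]
  rfl

lemma eq_strict_of_taylor {f : Ser K M.R N.R} (hf : ∀ n, IsComoduleMap K A.carrier (f n))
    (h : ∀ a t, taylor f (TensorAlgebra.ι K a * t) = 0) :
    f = Ser.strict A.carrier (taylor f 1) := by
  funext n
  exact (hf n).eq_strictMap fun m a t => LinearMap.congr_fun (congrFun (h a t) n) m

lemma taylor_one_mem {f : Ser K M.R N.R} {r : ℤ}
    (hf : ∀ n, HasDegree A.toBigradedSpace M.toBigradedSpace N.toBigradedSpace r (f n))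
    {i j k : ℤ} (hk : i + r = k) (n : ℕ) {m : M.carrier} (hm : m ∈ M.gr i j) :
    taylor f 1 n m ∈ N.gr k j :=
  toCogen_mem (by omega) (hf n _ _ _ (tmul_one_mem hm))

lemma preservesGrading_taylor (f : M ⟶ N) :
    PreservesGrading M.toBigradedSpace N.toBigradedSpace (taylor f.ser 1) :=
  fun n i _ _ hm => taylor_one_mem f.isPreHom.degree (add_zero i) n hm

lemma isPreHom_strict {ρ : Ser K M.carrier N.carrier}
    (hρ : PreservesGrading M.toBigradedSpace N.toBigradedSpace ρ) :
    IsPreHom M N 0 (Ser.strict A.carrier ρ) where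
  comodule n := coact_strictMap (ρ n)
  degree n := hasDegree_strictMap (hρ n)
  unital n := vanishesOn_strictMap _ (ρ n)

end Taylor

section Commutator

variable {M N : TopMod e} {ρ : Ser K M.carrier N.carrier}
  (hρ : PreservesGrading M.toBigradedSpace N.toBigradedSpace ρ)

lemma cofreeSign_comp_strictMap {l : M.carrier →ₗ[K] N.carrier}
    (hl : ∀ i j, ∀ m ∈ M.gr i j, l m ∈ N.gr i j) :
    cofreeSign A.toBigradedSpace N.toBigradedSpace ∘ₗ strictMap K A.carrier l =
      strictMap K A.carrier l ∘ₗ cofreeSign A.toBigradedSpace M.toBigradedSpace := by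
  refine TensorProduct.ext' fun m t => ?_
  have := LinearMap.congr_fun (parity_comp (M := M.toBigradedSpace) hl) m
  simp only [LinearMap.comp_apply] at this
  simp [cofreeSign, this]

lemma isComoduleMap_d_commutator {l : M.carrier →ₗ[K] N.carrier}
    (hl : ∀ i j, ∀ m ∈ M.gr i j, l m ∈ N.gr i j) (n : ℕ) :
    IsComoduleMap K A.carrier
      (N.d n ∘ₗ strictMap K A.carrier l - strictMap K A.carrier l ∘ₗ M.d n) := by
  have coact_comp : coact K A.carrier N.carrier ∘ₗ strictMap K A.carrier l =
      LinearMap.rTensor _ (strictMap K A.carrier l) ∘ₗ coact K A.carrier M.carrier :=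
    coact_strictMap l
  unfold IsComoduleMap
  rw [LinearMap.comp_sub, ← LinearMap.comp_assoc, N.d_coderivation, LinearMap.comp_assoc,
    coact_comp, ← LinearMap.comp_assoc (M.d n), coact_comp, LinearMap.comp_assoc (M.d n),
    M.d_coderivation, ← LinearMap.comp_assoc, ← LinearMap.comp_assoc, ← LinearMap.sub_comp]
  congr 1
  refine TensorProduct.ext' fun x t => ?_
  have := LinearMap.congr_fun (cofreeSign_comp_strictMap hl) x
  simp only [LinearMap.comp_apply] at this
  simp [this]

lemma d_commutator_apply (ρ : Ser K M.carrier N.carrier) (n : ℕ) :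
    (N.d.comp (Ser.strict A.carrier ρ) - (Ser.strict A.carrier ρ).comp M.d) n =
      ∑ p ∈ Finset.HasAntidiagonal.antidiagonal n,
        (N.d p.1 ∘ₗ strictMap K A.carrier (ρ p.2) - strictMap K A.carrier (ρ p.2) ∘ₗ M.d p.1) := by
  rw [Finset.sum_sub_distrib, ← Finset.Nat.sum_antidiagonal_swap
    (f := fun p => strictMap K A.carrier (ρ p.2) ∘ₗ M.d p.1)]
  rfl

include hρ

lemma isPreHom_d_commutator
    (compatible : ∀ a t, ρ.comp (taylor M.d (TensorAlgebra.ι K a * t)) =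
      (taylor N.d (TensorAlgebra.ι K a * t)).comp ρ) :
    IsPreHom M N 1 (N.d.comp (Ser.strict A.carrier ρ) - (Ser.strict A.carrier ρ).comp M.d) := by
  have comodule : ∀ n, IsComoduleMap K A.carrier
      ((N.d.comp (Ser.strict A.carrier ρ) - (Ser.strict A.carrier ρ).comp M.d) n) := fun n => by
    rw [d_commutator_apply]
    exact isComoduleMap_sum fun p _ => isComoduleMap_d_commutator (hρ p.2) p.1
  refine ⟨comodule, fun n i j x hx => ?_, fun n => ?_⟩
  · rw [d_commutator_apply, LinearMap.sum_apply]
    have hs := fun k => hasDegree_strictMap (A := A.toBigradedSpace) (hρ k)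
    exact Submodule.sum_mem _ fun p _ => sub_mem
      ((N.d_degree p.1).comp (hs p.2) (zero_add 1) i j x hx)
      ((hs p.2).comp (M.d_degree p.1) (add_zero 1) i j x hx)
  · rw [eq_strict_of_taylor comodule fun a t => by
      rw [taylor_sub, taylor_comp_strict, taylor_strict_comp, compatible, sub_self]]
    exact vanishesOn_strictMap _ _

end Commutator

lemma IsStrict.ser_eq {M N : TopMod e} {f : M ⟶ N} (hf : IsStrict f) :
    f.ser = Ser.strict A.carrier (taylor f.ser 1) :=
  eq_strict_of_taylor f.isPreHom.comodule hf

namespace IsSemiSplit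

variable {M M' M'' : TopMod e} {f : M ⟶ M'} {g : M' ⟶ M''} {ρ : Ser K M'.carrier M.carrier}
  (H : IsSemiSplit f g ρ)

include H

lemma exists_isSplitting : ∃ σ, IsPreHom M'' M' 0 σ ∧
    Ser.IsSplitting f.ser g.ser (Ser.strict A.carrier ρ) σ := by
  obtain ⟨σ, hσ, splitting⟩ := BigradedSpace.exists_isSplitting (preservesGrading_taylor f)
    (preservesGrading_taylor g) H.degree H.exact H.surjective H.retraction
  refine ⟨_, isPreHom_strict hσ, ?_⟩
  rw [H.strict_left.ser_eq, H.strict_right.ser_eq]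
  exact splitting.strict A.carrier

lemma existsUnique_connecting : ∃! h : M'' ⟶ M.shiftObj 1, IsConnecting g ρ h := by
  obtain ⟨σ, hσ, splitting⟩ := H.exists_isSplitting
  exact existsUnique_connecting_of_isSplitting splitting hσ
    (isPreHom_d_commutator H.degree H.compatible)

lemma exists_isSplit {h : M'' ⟶ M.shiftObj 1} (hh : IsConnecting g ρ h) :
    ∃ σ, IsSplit f g h (Ser.strict A.carrier ρ) σ := by
  obtain ⟨σ, hσ, splitting⟩ := H.exists_isSplitting
  exact ⟨σ, splitting, isPreHom_strict H.degree, hσ, hh⟩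

end IsSemiSplit

/-! ### The triangulated structure -/

section StrictHom

variable {M N : TopMod e} {l : M.carrier →ₗ[K] N.carrier}
  (hl : ∀ i j, ∀ m ∈ M.gr i j, l m ∈ N.gr i j)
  (hd : ∀ n, N.d n ∘ₗ strictMap K A.carrier l = strictMap K A.carrier l ∘ₗ M.d n)

lemma taylor_strictHom_one : taylor (strictHom l hl hd).ser 1 = Ser.const l := by
  change taylor (M := M) (N := N) (Ser.const (strictMap K A.carrier l)) 1 = _
  rw [← Ser.strict_const, taylor_strict_one]

lemma eval_taylor_strictHom_one (x : ℕ → M.carrier) :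
    (taylor (strictHom l hl hd).ser 1).eval x = fun n => l (x n) := by
  rw [taylor_strictHom_one, Ser.eval_const]

lemma isStrict_strictHom : IsStrict (strictHom l hl hd) := fun a t => by
  change taylor (M := M) (N := N) (Ser.const (strictMap K A.carrier l)) _ = _
  rw [← Ser.strict_const, taylor_strict_ι_mul]

end StrictHom

section Cylinder

variable {M N : TopMod e} (f : M ⟶ N)

lemma eval_taylor_cylIn (x : ℕ → M.carrier) :
    (taylor (cylIn f).ser 1).eval x = fun n => (0, (x n, 0)) :=
  eval_taylor_strictHom_one _ _ x

lemma eval_taylor_cylOut (y : ℕ → (cyl f).carrier) :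
    (taylor (cylOut f).ser 1).eval y = fun n => ((y n).1, (y n).2.2) :=
  eval_taylor_strictHom_one _ _ y

lemma eval_taylor_cylOut_eq_zero_iff {i j : ℤ} {y : ℕ → (cyl f).carrier}
    (hy : y ∈ (cyl f).seriesGr i j) : (taylor (cylOut f).ser 1).eval y = 0 ↔
      ∃ x ∈ M.seriesGr i j, (taylor (cylIn f).ser 1).eval x = y := by
  rw [eval_taylor_cylOut]
  constructor
  · intro h
    refine ⟨fun n => (y n).2.1, mem_seriesGr.2 fun n => (mem_seriesGr.1 hy n).2.1, ?_⟩
    rw [eval_taylor_cylIn]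
    funext n
    obtain ⟨h₁, h₂⟩ := Prod.ext_iff.1 (congrFun h n)
    exact Prod.ext h₁.symm (Prod.ext rfl h₂.symm)
  · rintro ⟨x, -, rfl⟩
    rw [eval_taylor_cylIn]
    rfl

/-- The projection `Cyl(f) → M`, as a series of linear maps; it splits the cylinder sequence. -/
def cylRetraction : Ser K (cyl f).carrier M.carrier :=
  Ser.const (LinearMap.fst K M.carrier N.carrier ∘ₗ
    LinearMap.snd K M.carrier (M.carrier × N.carrier))

lemma strict_cylRetraction : Ser.strict A.carrier (cylRetraction f) =
    (Ser.fst K A.carrier M.carrier N.carrier).comp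
      (Ser.snd K A.carrier M.carrier (M.carrier × N.carrier)) := by
  rw [Ser.fst, Ser.snd, Ser.const_comp_const, strictMap_comp, ← Ser.strict_const]
  rfl

lemma cylRetraction_d_commutator :
    M.d.comp (Ser.strict A.carrier (cylRetraction f)) -
        (Ser.strict A.carrier (cylRetraction f)).comp (cyl f).d =
      Ser.fst K A.carrier M.carrier (M.carrier × N.carrier) := by
  rw [strict_cylRetraction, cyl_d]
  simp

lemma cylRetraction_comp_taylor_d (a : A.carrier) (t : TensorAlgebra K A.carrier) :
    (cylRetraction f).comp (taylor (cyl f).d (TensorAlgebra.ι K a * t)) =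
      (taylor M.d (TensorAlgebra.ι K a * t)).comp (cylRetraction f) := by
  have h := congrArg (taylor (M := cyl f) (N := M) · (TensorAlgebra.ι K a * t))
    (cylRetraction_d_commutator f)
  dsimp only at h
  rw [Ser.fst, ← Ser.strict_const, taylor_sub, taylor_comp_strict, taylor_strict_comp] at h
  exact (sub_eq_zero.1 (h.trans (taylor_strict_ι_mul _ a t))).symm

lemma isSemiSplit_cyl : IsSemiSplit (cylIn f) (cylOut f) (cylRetraction f) where
  strict_left := isStrict_strictHom _ _
  strict_right := isStrict_strictHom _ _
  injective i j x _ h := by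
    rw [eval_taylor_cylIn] at h
    funext n
    exact congrArg (fun p : M.carrier × (M.carrier × N.carrier) => p.2.1) (congrFun h n)
  exact i j y hy := eval_taylor_cylOut_eq_zero_iff f hy
  surjective i j z hz := by
    have hz' := mem_seriesGr.1 hz
    refine ⟨fun n => ((z n).1, (0, (z n).2)), mem_seriesGr.2 fun n =>
      ⟨(hz' n).1, Submodule.zero_mem _, (hz' n).2⟩, ?_⟩
    rw [eval_taylor_cylOut]
  degree := PreservesGrading.const fun _ _ _ hy => hy.2.1
  retraction := by
    refine (congrArg _ (taylor_strictHom_one _ _)).trans ?_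
    rw [cylRetraction, Ser.const_comp_const]
    rfl
  compatible := cylRetraction_comp_taylor_d f

lemma isConnecting_cyl : IsConnecting (cylOut f) (cylRetraction f) (coneOut f) := by
  refine Eq.trans ?_ (cylRetraction_d_commutator f).symm
  rw [ser_cylOut]
  exact Ser.fst_lift _ _

end Cylinder

section DistinguishedTriangles

lemma isomorphic_mem (T₁ : Triangle (HoCat e)) (hT₁ : T₁ ∈ semiSplitTriangles e)
    (T₂ : Triangle (HoCat e)) (i : T₂ ≅ T₁) : T₂ ∈ semiSplitTriangles e := by
  obtain ⟨M, M', M'', f, g, ρ, h, H, hh, ⟨j⟩⟩ := hT₁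
  exact ⟨M, M', M'', f, g, ρ, h, H, hh, ⟨i ≪≫ j⟩⟩

lemma cylTriangle_mem {M N : TopMod e} (f : M ⟶ N) :
    (hoFunctor e).mapTriangle.obj (cylTriangle f) ∈ semiSplitTriangles e :=
  ⟨M, cyl f, cone f, cylIn f, cylOut f, cylRetraction f, coneOut f, isSemiSplit_cyl f,
    isConnecting_cyl f, ⟨Iso.refl _⟩⟩

lemma coneTriangle_mem {M N : TopMod e} (f : M ⟶ N) :
    (hoFunctor e).mapTriangle.obj (coneTriangle f) ∈ semiSplitTriangles e :=
  isomorphic_mem _ (cylTriangle_mem f) _ (nonempty_iso_cylTriangle f).some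

lemma IsSplit.triangle_mem {M M' M'' : TopMod e} {f : M ⟶ M'} {g : M' ⟶ M''}
    {h : M'' ⟶ M.shiftObj 1} {ρ : Ser K M'.R M.R} {σ : Ser K M''.R M'.R}
    (H : IsSplit f g h ρ σ) :
    (hoFunctor e).mapTriangle.obj (Triangle.mk f g h) ∈ semiSplitTriangles e :=
  isomorphic_mem _ (coneTriangle_mem f) _ H.nonempty_iso_coneTriangle.some

lemma exists_iso_isSplit {T : Triangle (HoCat e)} (hT : T ∈ semiSplitTriangles e) :
    ∃ (M M' M'' : TopMod e) (f : M ⟶ M') (g : M' ⟶ M'') (h : M'' ⟶ M.shiftObj 1)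
      (ρ : Ser K M'.R M.R) (σ : Ser K M''.R M'.R), IsSplit f g h ρ σ ∧
        Nonempty (T ≅ (hoFunctor e).mapTriangle.obj (Triangle.mk f g h)) := by
  obtain ⟨M, M', M'', f, g, ρ, h, H, hh, i⟩ := hT
  obtain ⟨σ, hσ⟩ := H.exists_isSplit hh
  exact ⟨M, M', M'', f, g, h, _, σ, hσ, i⟩

lemma exists_iso_coneTriangle {T : Triangle (HoCat e)} (hT : T ∈ semiSplitTriangles e) :
    ∃ (M N : TopMod e) (f : M ⟶ N),
      Nonempty (T ≅ (hoFunctor e).mapTriangle.obj (coneTriangle f)) := by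
  obtain ⟨M, M', M'', f, g, h, ρ, σ, H, ⟨i⟩⟩ := exists_iso_isSplit hT
  obtain ⟨j⟩ := H.nonempty_iso_coneTriangle
  exact ⟨M, M', f, ⟨i ≪≫ j⟩⟩

lemma isZero_cone_id (M : TopMod e) : IsZero ((hoFunctor e).obj (cone (𝟙 M))) := by
  rw [IsZero.iff_id_eq_zero, ← CategoryTheory.Functor.map_id, ← (hoFunctor e).map_zero]
  refine hoFunctor_map_eq ((isPreHom_cone_inl (𝟙 M)).comp (isPreHom_cone_snd (𝟙 M)) (by omega)) ?_
  rw [cone_d]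
  exact (sub_zero _).trans (Ser.id_eq_twisted_id_homotopy (dX := M.d))

lemma contractible_mem (X : HoCat e) : contractibleTriangle X ∈ semiSplitTriangles e := by
  obtain ⟨M⟩ := X
  refine isomorphic_mem _ (coneTriangle_mem (𝟙 M)) _ ?_
  have h := isZero_cone_id M
  refine Triangle.isoMk _ _ (Iso.refl _) (Iso.refl _) h.isoZero.symm ?_ (h.eq_of_tgt _ _)
    ((isZero_zero (HoCat e)).eq_of_src _ _)
  exact (Category.comp_id _).trans (((hoFunctor e).map_id M).symm.trans (Category.id_comp _).symm)

lemma exists_distinguished_completion {X Y : HoCat e} (f : X ⟶ Y) :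
    ∃ (Z : HoCat e) (g : Y ⟶ Z) (h : Z ⟶ X⟦(1 : ℤ)⟧), Triangle.mk f g h ∈ semiSplitTriangles e := by
  obtain ⟨X⟩ := X
  obtain ⟨Y⟩ := Y
  obtain ⟨f, rfl⟩ := (hoFunctor e).map_surjective f
  exact ⟨_, _, _, coneTriangle_mem f⟩

lemma rotate_mem (T : Triangle (HoCat e)) (hT : T ∈ semiSplitTriangles e) :
    T.rotate ∈ semiSplitTriangles e := by
  obtain ⟨M, N, f, ⟨i⟩⟩ := exists_iso_coneTriangle hT
  exact isomorphic_mem _ (isSplit_cone f).triangle_mem _ ((rotate _).mapIso i ≪≫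
    ((hoFunctor e).mapTriangleRotateIso).app (coneTriangle f))

lemma shift_mem (T : Triangle (HoCat e)) (hT : T ∈ semiSplitTriangles e) (n : ℤ) :
    (Triangle.shiftFunctor (HoCat e) n).obj T ∈ semiSplitTriangles e := by
  obtain ⟨M, M', M'', f, g, h, ρ, σ, H, ⟨i⟩⟩ := exists_iso_isSplit hT
  exact isomorphic_mem _ (H.shift n).triangle_mem _ ((Triangle.shiftFunctor _ n).mapIso i ≪≫
    ((hoFunctor e).mapTriangleCommShiftIso n).symm.app (Triangle.mk f g h))

lemma invRotate_mem (T : Triangle (HoCat e)) (hT : T ∈ semiSplitTriangles e) :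
    T.invRotate ∈ semiSplitTriangles e :=
  isomorphic_mem _ (shift_mem _ (rotate_mem _ (rotate_mem T hT)) (-1)) _
    ((invRotateIsoRotateRotateShiftFunctorNegOne _).app T)

lemma rotate_mem_iff (T : Triangle (HoCat e)) :
    T ∈ semiSplitTriangles e ↔ T.rotate ∈ semiSplitTriangles e :=
  ⟨rotate_mem T, fun hT => isomorphic_mem _ (invRotate_mem _ hT) _
    ((triangleRotation _).unitIso.app T)⟩

lemma exists_coneTriangle_hom {M N M' N' : TopMod e} (f : M ⟶ N) (f' : M' ⟶ N')
    (a : ((hoFunctor e).mapTriangle.obj (coneTriangle f)).obj₁ ⟶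
      ((hoFunctor e).mapTriangle.obj (coneTriangle f')).obj₁)
    (b : ((hoFunctor e).mapTriangle.obj (coneTriangle f)).obj₂ ⟶
      ((hoFunctor e).mapTriangle.obj (coneTriangle f')).obj₂)
    (fac : ((hoFunctor e).mapTriangle.obj (coneTriangle f)).mor₁ ≫ b =
      a ≫ ((hoFunctor e).mapTriangle.obj (coneTriangle f')).mor₁) :
    ∃ φ : (hoFunctor e).mapTriangle.obj (coneTriangle f) ⟶
      (hoFunctor e).mapTriangle.obj (coneTriangle f'), φ.hom₁ = a ∧ φ.hom₂ = b := by
  change (hoFunctor e).obj M ⟶ (hoFunctor e).obj M' at a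
  change (hoFunctor e).obj N ⟶ (hoFunctor e).obj N' at b
  obtain ⟨a, rfl⟩ := (hoFunctor e).map_surjective a
  obtain ⟨b, rfl⟩ := (hoFunctor e).map_surjective b
  have fac' : (hoFunctor e).map (f ≫ b) = (hoFunctor e).map (a ≫ f') := fac
  obtain ⟨H, hH, h⟩ := (CategoryTheory.Quotient.functor_map_eq_iff (homotopic e) _ _).1 fac'
  exact ⟨hoTriangleHom (T₁ := coneTriangle f) (T₂ := coneTriangle f') a b (coneMap f f' a b hH h)
    fac' (congrArg _ (coneIn_coneMap f f' a b hH h))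
    (congrArg _ (coneMap_coneOut f f' a b hH h).symm), rfl, rfl⟩

lemma exists_triangle_hom_of_iso {T₁ T₂ T₁' T₂' : Triangle (HoCat e)} (i₁ : T₁ ≅ T₁')
    (i₂ : T₂ ≅ T₂')
    (h : ∀ (a : T₁'.obj₁ ⟶ T₂'.obj₁) (b : T₁'.obj₂ ⟶ T₂'.obj₂), T₁'.mor₁ ≫ b = a ≫ T₂'.mor₁ →
      ∃ φ : T₁' ⟶ T₂', φ.hom₁ = a ∧ φ.hom₂ = b)
    (a : T₁.obj₁ ⟶ T₂.obj₁) (b : T₁.obj₂ ⟶ T₂.obj₂) (fac : T₁.mor₁ ≫ b = a ≫ T₂.mor₁) :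
    ∃ φ : T₁ ⟶ T₂, φ.hom₁ = a ∧ φ.hom₂ = b := by
  obtain ⟨φ, h₁, h₂⟩ := h (i₁.inv.hom₁ ≫ a ≫ i₂.hom.hom₁) (i₁.inv.hom₂ ≫ b ≫ i₂.hom.hom₂) (by
    rw [i₁.inv.comm₁_assoc, reassoc_of% fac, i₂.hom.comm₁]
    simp only [Category.assoc])
  exact ⟨i₁.hom ≫ φ ≫ i₂.inv, by simp [h₁], by simp [h₂]⟩

lemma exists_triangle_hom (T₁ T₂ : Triangle (HoCat e)) (hT₁ : T₁ ∈ semiSplitTriangles e)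
    (hT₂ : T₂ ∈ semiSplitTriangles e) (a : T₁.obj₁ ⟶ T₂.obj₁) (b : T₁.obj₂ ⟶ T₂.obj₂)
    (fac : T₁.mor₁ ≫ b = a ≫ T₂.mor₁) :
    ∃ c : T₁.obj₃ ⟶ T₂.obj₃, T₁.mor₂ ≫ c = b ≫ T₂.mor₂ ∧ T₁.mor₃ ≫ a⟦(1 : ℤ)⟧' = c ≫ T₂.mor₃ := by
  obtain ⟨M₁, N₁, f₁, ⟨i₁⟩⟩ := exists_iso_coneTriangle hT₁
  obtain ⟨M₂, N₂, f₂, ⟨i₂⟩⟩ := exists_iso_coneTriangle hT₂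
  obtain ⟨φ, rfl, rfl⟩ := exists_triangle_hom_of_iso i₁ i₂ (exists_coneTriangle_hom f₁ f₂) a b fac
  exact ⟨φ.hom₃, φ.comm₂, φ.comm₃⟩

end DistinguishedTriangles

section Octahedron

variable {X Y Z : TopMod e} (f : X ⟶ Y) (g : Y ⟶ Z)

/-- The morphism from the cone triangle of `f` to that of `f ≫ g`. -/
def coneCompRightHom : (hoFunctor e).mapTriangle.obj (coneTriangle f) ⟶
    (hoFunctor e).mapTriangle.obj (coneTriangle (f ≫ g)) :=
  hoTriangleHom (T₁ := coneTriangle f) (T₂ := coneTriangle (f ≫ g)) (𝟙 X) g (coneCompRight f g)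
    (congrArg _ (Category.id_comp (f ≫ g)).symm) (congrArg _ (coneIn_coneMap _ _ _ _ _ _))
    (congrArg _ (coneMap_coneOut _ _ _ _ _ _).symm)

/-- The morphism from the cone triangle of `f ≫ g` to that of `g`. -/
def coneCompLeftHom : (hoFunctor e).mapTriangle.obj (coneTriangle (f ≫ g)) ⟶
    (hoFunctor e).mapTriangle.obj (coneTriangle g) :=
  hoTriangleHom (T₁ := coneTriangle (f ≫ g)) (T₂ := coneTriangle g) f (𝟙 Z) (coneCompLeft f g)
    (congrArg _ (Category.comp_id (f ≫ g))) (congrArg _ (coneIn_coneMap _ _ _ _ _ _))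
    (congrArg _ (coneMap_coneOut _ _ _ _ _ _).symm)

lemma hoFunctor_map_comp_shift {P Q : TopMod e} (p : P ⟶ Q⟦(1 : ℤ)⟧) {Q' : TopMod e}
    (q : Q ⟶ Q') :
    (hoFunctor e).map (p ≫ q⟦(1 : ℤ)⟧') ≫ ((hoFunctor e).commShiftIso (1 : ℤ)).hom.app Q' =
      ((hoFunctor e).map p ≫ ((hoFunctor e).commShiftIso (1 : ℤ)).hom.app Q) ≫
        ((hoFunctor e).map q)⟦(1 : ℤ)⟧' := by
  rw [Functor.map_comp, Category.assoc, Functor.commShiftIso_hom_naturality, Category.assoc]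

lemma coneCompTriangle_mem : Triangle.mk ((hoFunctor e).map (coneCompRight f g))
    ((hoFunctor e).map (coneCompLeft f g))
    (((hoFunctor e).mapTriangle.obj (coneTriangle g)).mor₃ ≫
      (((hoFunctor e).map (coneIn f))⟦(1 : ℤ)⟧')) ∈ semiSplitTriangles e := by
  have h := isomorphic_mem _ (coneTriangle_mem _) _ (nonempty_iso_coneCompTriangle f g).some
  exact (congrArg (fun x => Triangle.mk ((hoFunctor e).map (coneCompRight f g))
    ((hoFunctor e).map (coneCompLeft f g)) x ∈ semiSplitTriangles e)
    (hoFunctor_map_comp_shift (coneOut g) (coneIn f))).mp h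

end Octahedron

variable (e) in
/-- The homotopy category of `A∞`-modules, with the triangles of semi-split sequences. -/
abbrev pretriangulatedHoCat : Pretriangulated (HoCat e) where
  distinguishedTriangles := semiSplitTriangles e
  isomorphic_distinguished := isomorphic_mem
  contractible_distinguished := contractible_mem
  distinguished_cocone_triangle := exists_distinguished_completion
  rotate_distinguished_triangle := rotate_mem_iff
  complete_distinguished_triangle_morphism := exists_triangle_hom

attribute [local instance] pretriangulatedHoCat

lemma isTriangulated_hoCat : IsTriangulated (HoCat e) := IsTriangulated.mk' (by
  rintro ⟨X₁⟩ ⟨X₂⟩ ⟨X₃⟩ u v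
  obtain ⟨u, rfl⟩ := (hoFunctor e).map_surjective u
  obtain ⟨v, rfl⟩ := (hoFunctor e).map_surjective v
  refine ⟨_, _, _, _, _, _, _, _, Iso.refl _, Iso.refl _, Iso.refl _,
    (Category.comp_id _).trans (Category.id_comp _).symm,
    (Category.comp_id _).trans (Category.id_comp _).symm,
    _, _, coneTriangle_mem u, _, _, coneTriangle_mem v, _, _, coneTriangle_mem (u ≫ v), ⟨?_⟩⟩
  refine Triangulated.Octahedron.mk ((hoFunctor e).map (coneCompRight u v))
    ((hoFunctor e).map (coneCompLeft u v)) (coneCompRightHom u v).comm₂ ?_ ?_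
    (coneCompLeftHom u v).comm₃ (coneCompTriangle_mem u v)
  · refine (coneCompRightHom u v).comm₃.symm.trans ?_
    change _ ≫ ((hoFunctor e).map (𝟙 X₁))⟦(1 : ℤ)⟧' = _
    rw [CategoryTheory.Functor.map_id, CategoryTheory.Functor.map_id]
    exact Category.comp_id _
  · refine (coneCompLeftHom u v).comm₂.trans ?_
    change (hoFunctor e).map (𝟙 X₃) ≫ _ = _
    rw [CategoryTheory.Functor.map_id]
    exact Category.id_comp _)

/-! ### Acyclic modules and quasi-isomorphisms -/

section Cogenerators

variable {M N P : TopMod e}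

/-- The series `f` maps the cogenerators `M ⊗ 1` to the cogenerators `N ⊗ 1`, so that it is given
there by its Taylor component `f⁰`. -/
def PreservesCogenerators (f : Ser K M.R N.R) : Prop :=
  ∀ n m, f n (m ⊗ₜ 1) = taylor f 1 n m ⊗ₜ 1

lemma coact_tmul_one (m : M.carrier) :
    coact K A.carrier M.carrier (m ⊗ₜ 1) = (m ⊗ₜ 1) ⊗ₜ 1 := by
  simp [coact, deconc_one]

lemma eq_toCogen_tmul_one {x : N.R} (hx : coact K A.carrier N.carrier x = x ⊗ₜ 1) :
    x = toCogen K A.carrier N.carrier x ⊗ₜ 1 := by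
  have h := cogen_coact x
  rw [hx, LinearMap.rTensor_tmul] at h
  exact h.symm

lemma IsPreHom.preservesCogenerators {r : ℤ} {f : Ser K M.R N.R} (hf : IsPreHom M N r f) :
    PreservesCogenerators f := by
  intro n m
  refine eq_toCogen_tmul_one ?_
  have h := LinearMap.congr_fun (hf.comodule n) (m ⊗ₜ 1)
  rwa [LinearMap.comp_apply, LinearMap.comp_apply, coact_tmul_one, LinearMap.rTensor_tmul] at h

lemma preservesCogenerators_d (hA : A.IsFlat) (M : TopMod e) : PreservesCogenerators M.d := by
  intro n m
  refine eq_toCogen_tmul_one ?_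
  have h := LinearMap.congr_fun (M.d_coderivation n) (m ⊗ₜ 1)
  rwa [LinearMap.comp_apply, LinearMap.comp_apply, coact_tmul_one, LinearMap.add_apply,
    TensorProduct.map_tmul, TensorProduct.map_tmul, hA n, tmul_zero, add_zero,
    LinearMap.id_apply] at h

lemma taylor_comp_one (g : Ser K N.R P.R) {f : Ser K M.R N.R} (hf : PreservesCogenerators f) :
    taylor (M := M) (N := P) (g.comp f) 1 = (taylor g 1).comp (taylor f 1) := by
  funext n
  ext m
  simp only [taylor_apply, Ser.comp, LinearMap.sum_apply, LinearMap.comp_apply, map_sum]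
  exact Finset.sum_congr rfl fun p _ => congrArg (fun x => toCogen K A.carrier P.carrier (g p.1 x))
    (hf p.2 m)

lemma taylor_id_one (M : TopMod e) :
    taylor (M := M) (N := M) (Ser.const LinearMap.id) 1 = Ser.const LinearMap.id := by
  rw [← Ser.strict_id, taylor_strict_one]

end Cogenerators

section Acyclic

variable {M N : TopMod e}

/-- The differential `d⁰` of the complex underlying `M`. -/
abbrev diff (M : TopMod e) : Ser K M.carrier M.carrier := taylor M.d 1

lemma diff_eval_taylor (hA : A.IsFlat) (f : M ⟶ N) (x : ℕ → M.carrier) :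
    N.diff.eval ((taylor f.ser 1).eval x) = (taylor f.ser 1).eval (M.diff.eval x) := by
  rw [← Ser.eval_comp, ← taylor_comp_one _ f.isPreHom.preservesCogenerators, f.comm,
    taylor_comp_one _ (preservesCogenerators_d hA M), Ser.eval_comp]

lemma diff_shiftObj (M : TopMod e) (a : ℤ) :
    (M.shiftObj a).diff = ((-1 : K) ^ a • M.diff : Ser K M.carrier M.carrier) :=
  taylor_smul (M := M) (N := M) _ M.d 1

lemma eval_taylor_mem (f : M ⟶ N) {i j : ℤ} {x : ℕ → M.carrier} (hx : x ∈ M.seriesGr i j) :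
    (taylor f.ser 1).eval x ∈ N.seriesGr i j :=
  (preservesGrading_taylor f).eval_mem hx

lemma exists_eval_taylor_homotopy (hA : A.IsFlat) {f g : M ⟶ N} (hfg : homotopic e f g)
    {i j : ℤ} {x : ℕ → M.carrier} (hx : x ∈ M.seriesGr i j) (hdx : M.diff.eval x = 0) :
    ∃ y ∈ N.seriesGr (i - 1) j,
      N.diff.eval y = (taylor f.ser 1).eval x - (taylor g.ser 1).eval x := by
  obtain ⟨H, hH, h⟩ := hfg
  refine ⟨(taylor H 1).eval x,
    eval_mem_seriesGr (fun n _ hm => taylor_one_mem hH.degree rfl n hm) hx, ?_⟩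
  rw [← Ser.eval_sub, ← taylor_sub, h, taylor_add, Ser.eval_add,
    taylor_comp_one _ hH.preservesCogenerators, taylor_comp_one _ (preservesCogenerators_d hA M),
    Ser.eval_comp, Ser.eval_comp, hdx, map_zero, add_zero]

/-- The complex underlying `M` is acyclic in every bidegree. -/
def IsAcyclic (M : TopMod e) : Prop :=
  ∀ i j, ∀ x ∈ M.seriesGr i j, M.diff.eval x = 0 → ∃ y ∈ M.seriesGr (i - 1) j, M.diff.eval y = x

lemma IsAcyclic.of_homotopy_retract (hA : A.IsFlat) (f : M ⟶ N) (g : N ⟶ M)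
    (hfg : homotopic e (f ≫ g) (𝟙 M)) (hN : N.IsAcyclic) : M.IsAcyclic := by
  intro i j x hx hdx
  obtain ⟨y, hy, hyx⟩ := hN i j _ (eval_taylor_mem f hx) (by
    rw [diff_eval_taylor hA, hdx, map_zero])
  obtain ⟨z, hz, hzx⟩ := exists_eval_taylor_homotopy hA hfg hx hdx
  refine ⟨(taylor g.ser 1).eval y - z, sub_mem (eval_taylor_mem g hy) hz, ?_⟩
  rw [map_sub, hzx, diff_eval_taylor hA, hyx, ser_comp, ser_id, taylor_id_one, Ser.eval_id,
    taylor_comp_one _ f.isPreHom.preservesCogenerators, Ser.eval_comp, sub_sub_cancel]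

lemma IsAcyclic.shift (hM : M.IsAcyclic) (a : ℤ) : (M.shiftObj a).IsAcyclic := by
  have sign_ne_zero : (-1 : K) ^ a ≠ 0 := zpow_ne_zero a (neg_ne_zero.2 one_ne_zero)
  intro i j x hx hdx
  rw [diff_shiftObj, Ser.eval_smul, smul_eq_zero_iff_right sign_ne_zero] at hdx
  obtain ⟨y, hy, rfl⟩ := hM (i + a) j x hx hdx
  refine ⟨((-1 : K) ^ a)⁻¹ • y, Submodule.smul_mem _ _ ?_, ?_⟩
  · change y ∈ M.seriesGr (i - 1 + a) j
    rwa [show i - 1 + a = i + a - 1 by omega]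
  · rw [diff_shiftObj, Ser.eval_smul, map_smul, smul_inv_smul₀ sign_ne_zero]

end Acyclic

section ConeAcyclic

variable {M N : TopMod e} (f : M ⟶ N)

lemma fst_comp_diff_cone : (Ser.const (LinearMap.fst K M.carrier N.carrier)).comp (cone f).diff =
    (-M.diff).comp (Ser.const (LinearMap.fst K M.carrier N.carrier)) := by
  rw [← taylor_neg]
  refine (taylor_strict_comp (M := cone f) (N := cone f) (P := M) _ _ 1).symm.trans
    (Eq.trans ?_ (taylor_comp_strict (M := cone f) _ _ 1))
  rw [Ser.strict_const, cone_d]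
  exact congrArg (fun s => taylor (M := cone f) (N := M) s 1) (Ser.fst_twisted _ _ _)

lemma snd_comp_diff_cone : (Ser.const (LinearMap.snd K M.carrier N.carrier)).comp (cone f).diff =
    (taylor f.ser 1).comp (Ser.const (LinearMap.fst K M.carrier N.carrier)) +
      N.diff.comp (Ser.const (LinearMap.snd K M.carrier N.carrier)) := by
  refine (taylor_strict_comp (M := cone f) (N := cone f) (P := N) _ _ 1).symm.trans
    (Eq.trans ?_ (congrArg₂ (· + ·) (taylor_comp_strict (M := cone f) f.ser _ 1)
      (taylor_comp_strict (M := cone f) N.d _ 1)))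
  rw [Ser.strict_const, cone_d, ← taylor_add, Ser.strict_const]
  exact congrArg (fun s => taylor (M := cone f) (N := N) s 1) (Ser.snd_twisted _ _ _)

lemma diff_cone_eval_eq_iff {x x' : ℕ → M.carrier} {y y' : ℕ → N.carrier} :
    (cone f).diff.eval (fun n => (x n, y n)) = (fun n => (x' n, y' n)) ↔
      -M.diff.eval x = x' ∧ (taylor f.ser 1).eval x + N.diff.eval y = y' := by
  have h₁ := congrArg (fun s => s.eval fun n => (x n, y n)) (fst_comp_diff_cone f)
  have h₂ := congrArg (fun s => s.eval fun n => (x n, y n)) (snd_comp_diff_cone f)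
  simp only [Ser.eval_comp, Ser.eval_const, Ser.eval_neg, Ser.eval_add] at h₁ h₂
  constructor
  · intro h
    rw [h] at h₁ h₂
    exact ⟨h₁.symm, h₂.symm⟩
  · rintro ⟨rfl, rfl⟩
    funext n
    exact Prod.ext (congrFun h₁ n) (congrFun h₂ n)

lemma prod_mem_seriesGr_cone_iff {i j : ℤ} {x : ℕ → M.carrier} {y : ℕ → N.carrier} :
    (fun n => (x n, y n)) ∈ (cone f).seriesGr i j ↔
      x ∈ M.seriesGr (i + 1) j ∧ y ∈ N.seriesGr i j := by
  rw [mem_seriesGr, mem_seriesGr, mem_seriesGr]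
  exact forall_and

lemma isAcyclic_cone_iff : (cone f).IsAcyclic ↔
    ∀ i j, ∀ x ∈ M.seriesGr (i + 1) j, ∀ y ∈ N.seriesGr i j, M.diff.eval x = 0 →
      (taylor f.ser 1).eval x + N.diff.eval y = 0 → ∃ x' ∈ M.seriesGr i j,
        ∃ y' ∈ N.seriesGr (i - 1) j,
          -M.diff.eval x' = x ∧ (taylor f.ser 1).eval x' + N.diff.eval y' = y := by
  constructor
  · intro h i j x hx y hy hdx hdy
    obtain ⟨z, hz, hdz⟩ := h i j _ ((prod_mem_seriesGr_cone_iff f).2 ⟨hx, hy⟩)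
      ((diff_cone_eval_eq_iff f (x' := 0) (y' := 0)).2 ⟨neg_eq_zero.2 hdx, hdy⟩)
    obtain ⟨hx', hy'⟩ := (prod_mem_seriesGr_cone_iff f).1 hz
    rw [sub_add_cancel] at hx'
    exact ⟨_, hx', _, hy', (diff_cone_eval_eq_iff f).1 hdz⟩
  · intro h i j z hz hdz
    obtain ⟨hx, hy⟩ := (prod_mem_seriesGr_cone_iff f).1 hz
    obtain ⟨hdx, hdy⟩ := (diff_cone_eval_eq_iff f (x' := 0) (y' := 0)).1 hdz
    obtain ⟨x', hx', y', hy', h'⟩ := h i j _ hx _ hy (neg_eq_zero.1 hdx) hdy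
    exact ⟨_, (prod_mem_seriesGr_cone_iff f).2 ⟨by rwa [sub_add_cancel], hy'⟩,
      (diff_cone_eval_eq_iff f).2 h'⟩

variable {f}

lemma IsQuasiIso.isAcyclic_cone (hA : A.IsFlat) (hf : IsQuasiIso f) : (cone f).IsAcyclic := by
  refine (isAcyclic_cone_iff f).2 fun i j x hx y hy hdx hdy => ?_
  have hfx : (taylor f.ser 1).eval x = N.diff.eval (-y) := by
    rw [map_neg, eq_neg_of_add_eq_zero_left hdy]
  obtain ⟨u, hu, rfl⟩ := hf.injective (i + 1) j x hx hdx
    ⟨-y, neg_mem (by rwa [add_sub_cancel_right]), hfx.symm⟩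
  rw [add_sub_cancel_right] at hu
  obtain ⟨v, hv, hdv, w, hw, hvw⟩ := hf.surjective i j (y + (taylor f.ser 1).eval u)
    (add_mem hy (eval_taylor_mem f hu))
    (by rw [map_add, diff_eval_taylor hA, hfx, map_neg, add_neg_cancel])
  refine ⟨v - u, sub_mem hv hu, w, hw, ?_, ?_⟩
  · rw [map_sub, hdv, zero_sub, neg_neg]
  · rw [map_sub, sub_add_eq_add_sub, ← hvw, add_sub_cancel_right]

lemma isQuasiIso_of_isAcyclic_cone (hf : (cone f).IsAcyclic) : IsQuasiIso f where
  injective i j x hx hdx := by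
    rintro ⟨y, hy, hyx⟩
    obtain ⟨x', hx', -, -, h, -⟩ := (isAcyclic_cone_iff f).1 hf (i - 1) j x
      (by rwa [sub_add_cancel]) (-y) (neg_mem hy) hdx (by rw [map_neg, hyx, add_neg_cancel])
    exact ⟨-x', neg_mem hx', by rw [map_neg, h]⟩
  surjective i j y hy hdy := by
    obtain ⟨x', hx', y', hy', h, h'⟩ := (isAcyclic_cone_iff f).1 hf i j 0 (zero_mem _) y hy
      (map_zero _) (by rw [map_zero, hdy, zero_add])
    exact ⟨x', hx', neg_eq_zero.1 h, y', hy', h'.symm⟩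

lemma isQuasiIso_iff_isAcyclic_cone (hA : A.IsFlat) : IsQuasiIso f ↔ (cone f).IsAcyclic :=
  ⟨IsQuasiIso.isAcyclic_cone hA, isQuasiIso_of_isAcyclic_cone⟩

lemma isQuasiIso_of_isAcyclic (hM : M.IsAcyclic) (hN : N.IsAcyclic) : IsQuasiIso f where
  injective i j x hx hdx _ := hM i j x hx hdx
  surjective i j y hy hdy := by
    obtain ⟨y', hy', h⟩ := hN i j y hy hdy
    exact ⟨0, zero_mem _, map_zero _, y', hy', by rw [map_zero, zero_add, h]⟩

end ConeAcyclic

section Localization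

variable (e) in
/-- The acyclic modules, as a property of objects of the homotopy category. -/
def acyclic : ObjectProperty (HoCat e) := fun X => X.as.IsAcyclic

lemma isClosedUnderIsomorphisms_acyclic (hA : A.IsFlat) :
    (acyclic e).IsClosedUnderIsomorphisms where
  of_iso {X Y} i hX := by
    obtain ⟨X⟩ := X
    obtain ⟨Y⟩ := Y
    obtain ⟨f, hf⟩ := (hoFunctor e).map_surjective i.inv
    obtain ⟨g, hg⟩ := (hoFunctor e).map_surjective i.hom
    refine IsAcyclic.of_homotopy_retract hA f g
      ((CategoryTheory.Quotient.functor_map_eq_iff (homotopic e) _ _).1 ?_) hX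
    refine ((hoFunctor e).map_comp f g).trans ?_
    rw [hf, hg]
    exact i.inv_hom_id

lemma isStableUnderShift_acyclic (hA : A.IsFlat) : (acyclic e).IsStableUnderShift ℤ where
  isStableUnderShiftBy a :=
    { le_shift := by
        rintro ⟨M⟩ hM
        have := isClosedUnderIsomorphisms_acyclic (e := e) hA
        exact (acyclic e).prop_of_iso (((hoFunctor e).commShiftIso a).app M)
          (IsAcyclic.shift hM a) }

lemma isTriangulatedClosed₃_acyclic (hA : A.IsFlat) : (acyclic e).IsTriangulatedClosed₃ := by
  have := isClosedUnderIsomorphisms_acyclic (e := e) hA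
  refine .mk' fun T hT hM hN => ?_
  obtain ⟨M, N, f, ⟨i⟩⟩ := exists_iso_coneTriangle hT
  have hM' : M.IsAcyclic := (acyclic e).prop_of_iso (Triangle.π₁.mapIso i) hM
  have hN' : N.IsAcyclic := (acyclic e).prop_of_iso (Triangle.π₂.mapIso i) hN
  exact (acyclic e).prop_of_iso (Triangle.π₃.mapIso i.symm)
    ((isQuasiIso_of_isAcyclic hM' hN').isAcyclic_cone hA)

lemma isTriangulated_acyclic (hA : A.IsFlat) : (acyclic e).IsTriangulated := by
  have := isClosedUnderIsomorphisms_acyclic (e := e) hA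
  have := isStableUnderShift_acyclic (e := e) hA
  have := isTriangulatedClosed₃_acyclic (e := e) hA
  have := ObjectProperty.IsTriangulatedClosed₂.of_isTriangulatedClosed₃ (P := acyclic e)
  have zero_acyclic : (zeroMod e).IsAcyclic := fun _ _ _ _ _ =>
    ⟨0, zero_mem _, Subsingleton.elim (α := ℕ → PUnit) _ _⟩
  exact
    { exists_zero := ⟨_, isZero_cone_id (zeroMod e),
        (isQuasiIso_of_isAcyclic zero_acyclic zero_acyclic).isAcyclic_cone hA⟩ }

lemma qis_eq_trW (hA : A.IsFlat) : qis e = (acyclic e).trW := by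
  have := isClosedUnderIsomorphisms_acyclic (e := e) hA
  have trW_iff : ∀ {M N : TopMod e} (f : M ⟶ N),
      (acyclic e).trW ((hoFunctor e).map f) ↔ IsQuasiIso f := fun f =>
    ((acyclic e).trW_iff_of_distinguished _ (coneTriangle_mem f)).trans
      (isQuasiIso_iff_isAcyclic_cone hA).symm
  ext ⟨X⟩ ⟨Y⟩ φ
  constructor
  · rintro ⟨f, rfl, hf⟩
    exact (trW_iff f).2 hf
  · intro hφ
    obtain ⟨f, rfl⟩ := (hoFunctor e).map_surjective φ
    exact ⟨f, rfl, (trW_iff f).1 hφ⟩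

end Localization

end TopMod

end

end TopAInf

theorem mainTheorem6 {K : Type u} [Field K] (A : TopAInfAlg K) (hA : A.IsFlat)
    (e : A.StrictUnit) :
    (∀ (M M' M'' : TopMod e) (f : M ⟶ M') (g : M' ⟶ M'') (ρ : Ser K M'.carrier M.carrier),
      TopMod.IsSemiSplit f g ρ → ∃! h : M'' ⟶ M.shiftObj 1, TopMod.IsConnecting g ρ h) ∧
    ∃ _ : Pretriangulated (HoCat e),
      (distTriang (HoCat e)) = semiSplitTriangles e ∧
      IsTriangulated (HoCat e) ∧
      (∀ (M N : TopMod e) (f : M ⟶ N),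
        (hoFunctor e).mapTriangle.obj (TopMod.coneTriangle f) ∈ distTriang (HoCat e)) ∧
      (∀ (M N : TopMod e) (f : M ⟶ N),
        (hoFunctor e).mapTriangle.obj (TopMod.cylTriangle f) ∈ distTriang (HoCat e)) ∧
      ∃ (_ : (qis e).HasLeftCalculusOfFractions) (_ : (qis e).HasRightCalculusOfFractions)
        (_ : (qis e).IsCompatibleWithTriangulation),
        (distTriang (qis e).Localization) = (qis e).Q.essImageDistTriang ∧
        IsTriangulated (qis e).Localization := by
  refine ⟨fun M M' M'' f g ρ H => H.existsUnique_connecting, TopMod.pretriangulatedHoCat e, rfl,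
    TopMod.isTriangulated_hoCat, fun M N f => TopMod.coneTriangle_mem f,
    fun M N f => TopMod.cylTriangle_mem f, ?_⟩
  let _ := TopMod.pretriangulatedHoCat e
  have : IsTriangulated (HoCat e) := TopMod.isTriangulated_hoCat
  have : (TopMod.acyclic e).IsTriangulated := TopMod.isTriangulated_acyclic hA
  rw [TopMod.qis_eq_trW hA]
  exact ⟨inferInstance, inferInstance, inferInstance, rfl, inferInstance⟩
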